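/- **Setting.** Let $\phi:\mathbb R\to\mathbb R$ be a differentiable even function such that $\{x:\phi(x)\neq 0\}$ is non-empty and contained in $(-1,1)$. Let $P_\xi$ and $P_\kappa$ be Borel probability measures on $\mathbb R$ concentrated on $[-1,1]$ and on $(0,1]$, respectively. Let $\omega=\{(\tau,\eta,\xi,\kappa)\}$ be a Poisson point process on $\mathbb Z\times\mathbb R\times\mathbb R\times\mathbb R$ (a random locally finite configuration with law $\mathsf P$) with driving measure $P_\tau\times P_\eta\times P_\xi\times P_\kappa$, where $P_\tau$ is the counting measure on $\mathbb Z$ and $P_\eta$ is the Lebesgue measure on $\mathbb R$. Define the random potential $$F_\omega(n,x)=\sum_{(n,\eta,\xi,\kappa)\in\omega}\xi\,\phi\!\left(\frac{x-\eta}{\kappa}\right),\qquad (n,x)\in\mathbb Z\times\mathbb R .$$ Fix $p\in[0,1]$. For integers $n<m$ and $x,y\in\mathbb R$, the optimal action from $(n,x)$ to $(m,y)$ is $$A_\omega^{n,m}(x,y)=\min_{\gamma}\left\{\frac12\sum_{k=n}^{m-1}(\gamma_{k+1}-\gamma_k)^2+\sum_{k=n}^{m-1}\bigl(pF_\omega(k,\gamma_k)+(1-p)F_\omega(k+1,\gamma_{k+1})\bigr)\right\},$$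 the minimum being over all $\gamma:\{n,\dots,m\}\to\mathbb R$ with $\gamma_n=x$ and $\gamma_m=y$. Write $A^n(x,y)=A^{0,n}(x,y)$ and let $$\alpha(v)=\inf_{n\ge1}\frac{\mathsf E A^{n}(0,vn)}{n},\qquad v\in\mathbb R .$$ **Theorem.** These objects are well defined: for every $v\in\mathbb R$ and every integer $n\ge 1$, the minimum defining $A^n(0,vn)$ is attained almost surely and $\mathsf E|A^n(0,vn)|<\infty$; and for every $v\in\mathbb R$ the infimum defining $\alpha(v)$ is finite. Moreover, there are positive constants $c_0,c_1,c_2,c_3,c_4$ such that for any $v\in\mathbb R$, all integers $n>c_0$, and all $u\in(c_3n^{1/2}\ln^2 n,\ c_4n^{3/2}\ln n]$, $$\mathsf P\{|A^n(0,vn)-\alpha(v)n|>u\}\le c_1\exp\left\{-c_2\frac{u}{n^{1/2}\ln n}\right\}.$$ -/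

import Mathlib

open MeasureTheory ProbabilityTheory

noncomputable section

namespace KickedBurgers

/-- The space `ℤ × ℝ × ℝ × ℝ` of marked space-time points `(τ, η, ξ, κ)`: time, position,
amplitude and scaling factor. -/
abbrev MarkedPoint : Type := ℤ × ℝ × ℝ × ℝ

/-- Locally finite point configurations in `ℤ × ℝ × ℝ × ℝ`. -/
structure Config where
  points : Set MarkedPoint
  locallyFinite : ∀ B : Set MarkedPoint, Bornology.IsBounded B → (points ∩ B).Finite

/-- The number `ω(B)` of points of the configuration `ω` in the set `B`
(used for bounded `B`, where it is a genuine finite cardinality). -/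
def Config.count (ω : Config) (B : Set MarkedPoint) : ℕ := (ω.points ∩ B).ncard

/-- The σ-algebra on configurations generated by the counts `ω ↦ ω(B)` of bounded Borel sets. -/
instance : MeasurableSpace Config :=
  ⨆ (B : Set MarkedPoint) (_ : Bornology.IsBounded B ∧ MeasurableSet B),
    MeasurableSpace.comap (fun ω : Config => ω.count B) ⊤

/-- `P` is the law of the Poisson point process with driving measure `μ`: the counts of mutually
disjoint bounded Borel sets are independent, and the count of a bounded Borel set `B` is a Poisson
random variable with parameter `μ B`. -/
structure IsPoissonLaw (P : Measure Config) (μ : Measure MarkedPoint) : Prop where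
  indep : ∀ (k : ℕ) (B : Fin k → Set MarkedPoint),
    (∀ i, Bornology.IsBounded (B i) ∧ MeasurableSet (B i)) →
    Pairwise (Function.onFun Disjoint B) →
    iIndepFun (fun (i : Fin k) (ω : Config) => ω.count (B i)) P
  poisson : ∀ B : Set MarkedPoint, Bornology.IsBounded B → MeasurableSet B →
    P.map (fun ω : Config => ω.count B) = poissonMeasure (μ B).toNNReal

/-- The driving measure: counting measure in time, Lebesgue measure in space, and the laws
`Pξ`, `Pκ` for amplitudes and scaling factors. -/
def drivingMeasure (Pξ Pκ : Measure ℝ) : Measure MarkedPoint :=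
  (Measure.count : Measure ℤ).prod ((volume : Measure ℝ).prod (Pξ.prod Pκ))

/-- The shot-noise potential `F_ω(n, x) = ∑ ξ φ((x - η) / κ)`, the sum being over the points
`(n, η, ξ, κ)` of `ω` (almost surely, only finitely many terms are nonzero, for all `(n, x)`). -/
def potential (φ : ℝ → ℝ) (ω : Config) (n : ℤ) (x : ℝ) : ℝ :=
  ∑ᶠ q ∈ {q : MarkedPoint | q ∈ ω.points ∧ q.1 = n}, q.2.2.1 * φ ((x - q.2.1) / q.2.2.2)

/-- The kinetic action `S^{n,m}(γ)`. Only the values of `γ` on `{n, …, m}` matter. -/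
def kineticAction (n m : ℤ) (γ : ℤ → ℝ) : ℝ :=
  (1 / 2) * ∑ k ∈ Finset.Ico n m, (γ (k + 1) - γ k) ^ 2

/-- The potential action `F_ω^{n,m}(γ)` with endpoint parameter `p`. -/
def potentialAction (φ : ℝ → ℝ) (p : ℝ) (ω : Config) (n m : ℤ) (γ : ℤ → ℝ) : ℝ :=
  ∑ k ∈ Finset.Ico n m,
    (p * potential φ ω k (γ k) + (1 - p) * potential φ ω (k + 1) (γ (k + 1)))

/-- The set of values of the total action over all paths from `(n, x)` to `(m, y)`. -/
def actionValues (φ : ℝ → ℝ) (p : ℝ) (ω : Config) (n m : ℤ) (x y : ℝ) : Set ℝ :=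
  {a : ℝ | ∃ γ : ℤ → ℝ, γ n = x ∧ γ m = y ∧
    a = kineticAction n m γ + potentialAction φ p ω n m γ}

/-- The optimal action `A_ω^{n,m}(x, y)`. -/
def optimalAction (φ : ℝ → ℝ) (p : ℝ) (ω : Config) (n m : ℤ) (x y : ℝ) : ℝ :=
  sInf (actionValues φ p ω n m x y)

/-- The numbers `E A^{0,n}(0, v n) / n`, `n = 1, 2, …`. -/
def meanActionRates (φ : ℝ → ℝ) (p : ℝ) (P : Measure Config) (v : ℝ) : Set ℝ :=
  {r : ℝ | ∃ n : ℕ, 1 ≤ n ∧ r = (∫ ω, optimalAction φ p ω 0 n 0 (v * n) ∂P) / n}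

/-- The shape function `α(v) = inf_{n ≥ 1} E A^{0,n}(0, v n) / n`. -/
def shapeFunction (φ : ℝ → ℝ) (p : ℝ) (P : Measure Config) (v : ℝ) : ℝ :=
  sInf (meanActionRates φ p P v)

end KickedBurgers

end

open scoped ENNReal

namespace KickedBurgers

/-! ### Counting variables -/

/-! Uniformity in the slope comes from invariance. A Poisson law is determined by its driving
measure (`IsPoissonLaw.unique`), and shears of space-time preserve that measure. A shear carrying a
line of slope `v` to the time axis changes the action of every path along it by the same constant `v
^ 2 / 2 * n` (`act_line`). So the optimal action is almost surely a bridge action of the sheared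
configuration plus this constant, the shape function is a constant plus `v ^ 2 / 2`, and only paths
from `0` to `0` have to be studied.

The potential is unbounded, so its sum along a path must be controlled for all paths at once.
`pathWeight` sums over lattice paths the exponential of total load minus length. Independence in
time bounds its mean by `exp (C n)`, and one term is at most the sum, so its logarithm `excess`
bounds the load of every path up to its length (`sum_load_le_excess`). The length is absorbed by the
kinetic action (`Controlled.le_act`). This gives optimal bridges, integrable actions, and minimizers
of spatial range `O(n)` outside an event of exponentially small probability.

For concentration, paths are restricted to a finite grid in such a range. The grid action is a
function of `n + 1` independent time slices, and resampling one slice changes it by at most a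
multiple of two maximal loads over `O(n)` cells. A maximal load divided by `log n` has a bounded
exponential moment, so an induction over the variables (`lintegral_exp_pi_le`) bounds the
exponential moment at scale `√n log n`. The mesh is not quantified, because that bound does not
depend on it. The result is `ShotNoise.exists_concentration`, whose `exp (-n)` error terms force the
upper limit on `u`.

It remains to replace the mean by its linear asymptotics. Means are subadditive. Conversely, an
optimal bridge of length `2n` can be cut at time `n` near a lattice point into two sheared bridges,
and by concentration all `O(n)` candidate halves are simultaneously close to their mean with
positive probability. Hence the means are almost additive under doubling with error `√n log² n`
(`ShotNoise.exists_doubling`). Iterating the doubling (`sub_lim_le_of_doubling`) gives a bias of the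
same order, which the lower limit on `u` dominates. -/

lemma Config.measurable_count {B : Set MarkedPoint} (hb : Bornology.IsBounded B)
    (hm : MeasurableSet B) : Measurable (fun ω : Config => ω.count B) := by
  refine Measurable.of_comap_le ?_
  exact le_iSup₂_of_le (f := fun (B : Set MarkedPoint)
    (_ : Bornology.IsBounded B ∧ MeasurableSet B) =>
      MeasurableSpace.comap (fun ω : Config => ω.count B) ⊤) B ⟨hb, hm⟩ le_rfl

lemma Config.measurable_of_count {α : Type*} [MeasurableSpace α] {f : α → Config}
    (h : ∀ B : Set MarkedPoint, Bornology.IsBounded B → MeasurableSet B →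
      Measurable (fun a => (f a).count B)) : Measurable f := by
  refine Measurable.of_le_map ?_
  refine iSup₂_le fun B hB => ?_
  rw [← MeasurableSpace.comap_le_iff_le_map, MeasurableSpace.comap_comp]
  exact (h B hB.1 hB.2).comap_le

/-- The cylinder event prescribing the counts of finitely many sets. -/
def cylinder (L : Finset (Set MarkedPoint × ℕ)) : Set Config :=
  {ω | ∀ q ∈ L, ω.count q.1 = q.2}

/-- The set of points belonging to exactly the members of `T` among the members of `L`. -/
def cell (L T : Finset (Set MarkedPoint)) : Set MarkedPoint :=
  {x | ∀ C ∈ L, x ∈ C ↔ C ∈ T}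

lemma measurableSet_cell {L : Finset (Set MarkedPoint)} (hL : ∀ C ∈ L, MeasurableSet C)
    (T : Finset (Set MarkedPoint)) : MeasurableSet (cell L T) := by
  have : cell L T = ⋂ C ∈ L, {x | x ∈ C ↔ C ∈ T} := by ext x; simp [cell]
  rw [this]
  refine Finset.measurableSet_biInter _ fun C hC => ?_
  by_cases h : C ∈ T
  · simpa [h] using hL C hC
  · have : {x | x ∈ C ↔ C ∈ T} = Cᶜ := by ext x; simp [h]
    rw [this]
    exact (hL C hC).compl

lemma disjoint_cell {L T T' : Finset (Set MarkedPoint)} (hT : T ⊆ L) (hT' : T' ⊆ L)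
    (h : T ≠ T') : Disjoint (cell L T) (cell L T') := by
  rw [Set.disjoint_left]
  intro x hx hx'
  apply h
  ext C
  constructor
  · intro hC; exact (hx' C (hT hC)).1 ((hx C (hT hC)).2 hC)
  · intro hC; exact (hx C (hT' hC)).1 ((hx' C (hT' hC)).2 hC)

lemma cell_subset {L T : Finset (Set MarkedPoint)} (hT : T ⊆ L) {C : Set MarkedPoint}
    (hC : C ∈ T) : cell L T ⊆ C := fun _ hx => (hx C (hT hC)).2 hC

open Classical in
/-- The nonempty subfamilies of a finite family of sets. -/
def subfamilies (L : Finset (Set MarkedPoint)) : Finset (Finset (Set MarkedPoint)) :=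
  L.powerset.filter (fun T => T.Nonempty)

lemma mem_subfamilies {L T : Finset (Set MarkedPoint)} :
    T ∈ subfamilies L ↔ T ⊆ L ∧ T.Nonempty := by
  simp [subfamilies]

lemma isBounded_cell {L T : Finset (Set MarkedPoint)} (hL : ∀ C ∈ L, Bornology.IsBounded C)
    (hT : T ∈ subfamilies L) : Bornology.IsBounded (cell L T) := by
  obtain ⟨hTL, C, hC⟩ := mem_subfamilies.1 hT
  exact (hL C (hTL hC)).subset (cell_subset hTL hC)

open Classical in
-- Points of `C` are sorted by the exact subfamily of `L` to which they belong. That subfamily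
-- contains `C`, so it is nonempty and its cell is bounded.
lemma Config.count_eq_sum_cell (ω : Config) {L : Finset (Set MarkedPoint)}
    (hL : ∀ C ∈ L, Bornology.IsBounded C) {C : Set MarkedPoint} (hC : C ∈ L) :
    ω.count C = ∑ T ∈ (subfamilies L).filter (fun T => C ∈ T), ω.count (cell L T) := by
  have hfin := ω.locallyFinite C (hL C hC)
  have h1 : ω.count C = hfin.toFinset.card := Set.ncard_eq_toFinset_card _ hfin
  rw [h1, Finset.card_eq_sum_card_fiberwise
    (f := fun x => L.filter (fun D => x ∈ D))
    (t := (subfamilies L).filter (fun T => C ∈ T))]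
  · refine Finset.sum_congr rfl fun T hT => ?_
    rw [Finset.mem_filter, mem_subfamilies] at hT
    have hb : (ω.points ∩ cell L T).Finite :=
      hfin.subset (Set.inter_subset_inter_right _ (cell_subset hT.1.1 hT.2))
    rw [Config.count, Set.ncard_eq_toFinset_card _ hb]
    congr 1
    ext x
    simp only [Finset.mem_filter, Set.Finite.mem_toFinset, Set.mem_inter_iff]
    constructor
    · rintro ⟨⟨hx, -⟩, hxT⟩
      refine ⟨hx, fun D hD => ?_⟩
      rw [← hxT]; simp [hD]
    · rintro ⟨hx, hxT⟩
      refine ⟨⟨hx, cell_subset hT.1.1 hT.2 hxT⟩, ?_⟩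
      ext D
      rw [Finset.mem_filter]
      constructor
      · rintro ⟨hD, hxD⟩; exact (hxT D hD).1 hxD
      · intro hD; exact ⟨hT.1.1 hD, (hxT D (hT.1.1 hD)).2 hD⟩
  · intro x hx
    simp only [Finset.coe_filter, Set.mem_ofPred_eq, mem_subfamilies]
    have hxC : x ∈ C := by
      have : x ∈ ω.points ∩ C := by simpa using hx
      exact this.2
    have : C ∈ L.filter (fun D => x ∈ D) := by simp [hC, hxC]
    exact ⟨⟨Finset.filter_subset _ _, ⟨C, this⟩⟩, this⟩

lemma measurableSet_cylinder {L : Finset (Set MarkedPoint × ℕ)}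
    (hL : ∀ q ∈ L, Bornology.IsBounded q.1 ∧ MeasurableSet q.1) :
    MeasurableSet (cylinder L) := by
  have : cylinder L = ⋂ q ∈ L, (fun ω : Config => ω.count q.1) ⁻¹' {q.2} := by
    ext ω; simp [cylinder]
  rw [this]
  exact Finset.measurableSet_biInter _ fun q hq =>
    Config.measurable_count (hL q hq).1 (hL q hq).2 (measurableSet_singleton _)

/-- The π-system of cylinder events. -/
def cylinders : Set (Set Config) :=
  {s | ∃ L : Finset (Set MarkedPoint × ℕ),
    (∀ q ∈ L, Bornology.IsBounded q.1 ∧ MeasurableSet q.1) ∧ cylinder L = s}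

open Classical in
lemma cylinder_union (L L' : Finset (Set MarkedPoint × ℕ)) :
    cylinder (L ∪ L') = cylinder L ∩ cylinder L' := by
  ext ω
  simp only [cylinder, Finset.mem_union, Set.mem_ofPred_eq, Set.mem_inter_iff]
  constructor
  · intro h; exact ⟨fun q hq => h q (Or.inl hq), fun q hq => h q (Or.inr hq)⟩
  · rintro ⟨h1, h2⟩ q (hq | hq)
    exacts [h1 q hq, h2 q hq]

lemma isPiSystem_cylinders : IsPiSystem cylinders := by
  classical
  rintro _ ⟨L, hL, rfl⟩ _ ⟨L', hL', rfl⟩ -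
  refine ⟨L ∪ L', ?_, cylinder_union L L'⟩
  intro q hq
  rcases Finset.mem_union.1 hq with h | h
  exacts [hL q h, hL' q h]

lemma generateFrom_cylinders :
    instMeasurableSpaceConfig = MeasurableSpace.generateFrom cylinders := by
  apply le_antisymm
  · refine iSup₂_le fun B hB => ?_
    let m' : MeasurableSpace Config := MeasurableSpace.generateFrom cylinders
    have : Measurable[m'] (fun ω : Config => ω.count B) := by
      refine @measurable_to_countable' _ _ _ _ m' _ fun n => ?_
      refine MeasurableSpace.measurableSet_generateFrom ⟨{(B, n)}, ?_, ?_⟩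
      · simpa using hB
      · ext ω; simp [cylinder]
    exact this.comap_le
  · refine MeasurableSpace.generateFrom_le ?_
    rintro _ ⟨L, hL, rfl⟩
    exact measurableSet_cylinder hL

lemma IsPoissonLaw.iIndepFun_fintype {P : Measure Config} {μ : Measure MarkedPoint}
    (hP : IsPoissonLaw P μ) {ι : Type*} [Fintype ι] {B : ι → Set MarkedPoint}
    (hB : ∀ i, Bornology.IsBounded (B i) ∧ MeasurableSet (B i))
    (hd : Pairwise (Function.onFun Disjoint B)) :
    iIndepFun (fun (i : ι) (ω : Config) => ω.count (B i)) P := by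
  have e := Fintype.equivFin ι
  have := hP.indep (Fintype.card ι) (B ∘ e.symm) (fun i => hB _)
    (fun i j hij => hd (e.symm.injective.ne hij))
  have h2 := this.precomp e.injective
  simpa [Function.comp_def] using h2

/-- The sets whose counts a cylinder event prescribes. -/
noncomputable def cylinderSets (L : Finset (Set MarkedPoint × ℕ)) : Finset (Set MarkedPoint) := by
  classical exact L.image Prod.fst

lemma mem_cylinderSets {L : Finset (Set MarkedPoint × ℕ)} {C : Set MarkedPoint} :
    C ∈ cylinderSets L ↔ ∃ n, (C, n) ∈ L := by
  simp [cylinderSets]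

open Classical in
lemma cylinder_eq_preimage {L : Finset (Set MarkedPoint × ℕ)} {M : Finset (Set MarkedPoint)}
    (hLM : ∀ q ∈ L, q.1 ∈ M) (hM : ∀ C ∈ M, Bornology.IsBounded C) :
    cylinder L = {ω | ∀ q ∈ L,
      ∑ T ∈ (subfamilies M).filter (fun T => q.1 ∈ T), ω.count (cell M T) = q.2} := by
  ext ω
  simp only [cylinder, Set.mem_ofPred_eq]
  refine forall₂_congr fun q hq => ?_
  rw [ω.count_eq_sum_cell hM (hLM q hq)]

/-- A Poisson law is determined by its driving measure. -/
theorem IsPoissonLaw.unique {P Q : Measure Config} [IsProbabilityMeasure P]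
    [IsProbabilityMeasure Q] {μ : Measure MarkedPoint} (hP : IsPoissonLaw P μ)
    (hQ : IsPoissonLaw Q μ) : P = Q := by
  classical
  refine ext_of_generate_finite cylinders generateFrom_cylinders isPiSystem_cylinders ?_ (by simp)
  rintro _ ⟨L, hL, rfl⟩
  set M := cylinderSets L with hM
  have hMb : ∀ C ∈ M, Bornology.IsBounded C ∧ MeasurableSet C := by
    intro C hC
    obtain ⟨n, hn⟩ := mem_cylinderSets.1 hC
    exact hL _ hn
  have hLM : ∀ q ∈ L, q.1 ∈ M := fun q hq => mem_cylinderSets.2 ⟨q.2, hq⟩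
  let ι := {T // T ∈ subfamilies M}
  let X : ι → Config → ℕ := fun T ω => ω.count (cell M T.1)
  have hcell : ∀ T : ι, Bornology.IsBounded (cell M T.1) ∧ MeasurableSet (cell M T.1) :=
    fun T => ⟨isBounded_cell (fun C hC => (hMb C hC).1) T.2,
      measurableSet_cell (fun C hC => (hMb C hC).2) _⟩
  have hX : ∀ T, Measurable (X T) := fun T => Config.measurable_count (hcell T).1 (hcell T).2
  have hd : Pairwise (Function.onFun Disjoint (fun T : ι => cell M T.1)) := by
    intro T T' h
    exact disjoint_cell (mem_subfamilies.1 T.2).1 (mem_subfamilies.1 T'.2).1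
      (fun h' => h (Subtype.ext h'))
  -- The prescribed sets may overlap, but the cells they generate are disjoint. Their counts are
  -- independent Poisson variables under every Poisson law, so the joint law depends on `μ` alone.
  have key : ∀ R : Measure Config, IsProbabilityMeasure R → IsPoissonLaw R μ →
      R.map (fun ω T => X T ω) = Measure.pi (fun T : ι =>
        poissonMeasure (μ (cell M T.1)).toNNReal) := by
    intro R _ hR
    rw [(iIndepFun_iff_map_fun_eq_pi_map (fun T => (hX T).aemeasurable)).1
      (hR.iIndepFun_fintype hcell hd)]
    congr 1
    ext1 T
    exact hR.poisson _ (hcell T).1 (hcell T).2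
  let S : Set (ι → ℕ) := {x | ∀ q ∈ L,
    ∑ T ∈ Finset.univ.filter (fun T : ι => q.1 ∈ T.1), x T = q.2}
  have hS : cylinder L = (fun ω T => X T ω) ⁻¹' S := by
    rw [cylinder_eq_preimage hLM (fun C hC => (hMb C hC).1)]
    ext ω
    simp only [Set.mem_ofPred_eq, Set.mem_preimage, S, X]
    refine forall₂_congr fun q hq => ?_
    rw [Finset.sum_filter, Finset.sum_filter, ← Finset.sum_coe_sort (subfamilies M)]
  have hSm : MeasurableSet S := by
    have : S = ⋂ q ∈ L, {x | ∑ T ∈ Finset.univ.filter (fun T : ι => q.1 ∈ T.1), x T = q.2} := by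
      ext x; simp [S]
    rw [this]
    refine Finset.measurableSet_biInter _ fun q _ => ?_
    exact measurableSet_eq_fun (by fun_prop) measurable_const
  have hXm : Measurable (fun ω T => X T ω) := measurable_pi_lambda _ hX
  rw [hS, ← Measure.map_apply hXm hSm, ← Measure.map_apply hXm hSm, key P ‹_› hP, key Q ‹_› hQ]

/-- Cylinder events supported in disjoint regions are independent. -/
lemma IsPoissonLaw.measure_cylinder_inter {P : Measure Config} [IsProbabilityMeasure P]
    {μ : Measure MarkedPoint} (hP : IsPoissonLaw P μ) {U U' : Set MarkedPoint}
    (hU : Disjoint U U') {L L' : Finset (Set MarkedPoint × ℕ)}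
    (hL : ∀ q ∈ L, (Bornology.IsBounded q.1 ∧ MeasurableSet q.1) ∧ q.1 ⊆ U)
    (hL' : ∀ q ∈ L', (Bornology.IsBounded q.1 ∧ MeasurableSet q.1) ∧ q.1 ⊆ U') :
    P (cylinder L ∩ cylinder L') = P (cylinder L) * P (cylinder L') := by
  classical
  -- The Boolean records which family a cell comes from. Cells are disjoint within a family by
  -- construction and across families because `U` and `U'` are, so independence can be applied to
  -- all of them together and then grouped by the Boolean.
  let B : (Bool × Finset (Set MarkedPoint)) → Set MarkedPoint := fun b =>
    if b.1 then cell (cylinderSets L) b.2 else cell (cylinderSets L') b.2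
  let ι := {b : Bool × Finset (Set MarkedPoint) //
    b ∈ ((subfamilies (cylinderSets L)).image (Prod.mk true)) ∪
      ((subfamilies (cylinderSets L')).image (Prod.mk false))}
  have hM : ∀ C ∈ cylinderSets L, (Bornology.IsBounded C ∧ MeasurableSet C) ∧ C ⊆ U := by
    intro C hC
    obtain ⟨n, hn⟩ := mem_cylinderSets.1 hC
    exact hL _ hn
  have hM' : ∀ C ∈ cylinderSets L', (Bornology.IsBounded C ∧ MeasurableSet C) ∧ C ⊆ U' := by
    intro C hC
    obtain ⟨n, hn⟩ := mem_cylinderSets.1 hC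
    exact hL' _ hn
  have hLM : ∀ q ∈ L, q.1 ∈ cylinderSets L := fun q hq => mem_cylinderSets.2 ⟨q.2, hq⟩
  have hLM' : ∀ q ∈ L', q.1 ∈ cylinderSets L' := fun q hq => mem_cylinderSets.2 ⟨q.2, hq⟩
  have hcases : ∀ b : ι, (∃ T, T ∈ subfamilies (cylinderSets L) ∧ b.1 = (true, T)) ∨
      (∃ T, T ∈ subfamilies (cylinderSets L') ∧ b.1 = (false, T)) := by
    intro b
    rcases Finset.mem_union.1 b.2 with h | h
    · obtain ⟨T, hT, h⟩ := Finset.mem_image.1 h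
      exact Or.inl ⟨T, hT, h.symm⟩
    · obtain ⟨T, hT, h⟩ := Finset.mem_image.1 h
      exact Or.inr ⟨T, hT, h.symm⟩
  have hsub : ∀ b : ι, (b.1.1 = true → B b.1 ⊆ U) ∧ (b.1.1 = false → B b.1 ⊆ U') := by
    intro b
    rcases hcases b with ⟨T, hT, h⟩ | ⟨T, hT, h⟩
    · obtain ⟨hTL, C, hC⟩ := mem_subfamilies.1 hT
      simp only [h, B]
      simpa using (cell_subset hTL hC).trans (hM C (hTL hC)).2
    · obtain ⟨hTL, C, hC⟩ := mem_subfamilies.1 hT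
      simp only [h, B]
      simpa using (cell_subset hTL hC).trans (hM' C (hTL hC)).2
  have hB : ∀ b : ι, Bornology.IsBounded (B b.1) ∧ MeasurableSet (B b.1) := by
    intro b
    rcases hcases b with ⟨T, hT, h⟩ | ⟨T, hT, h⟩
    · simp only [h, B, if_true]
      exact ⟨isBounded_cell (fun C hC => (hM C hC).1.1) hT,
        measurableSet_cell (fun C hC => (hM C hC).1.2) _⟩
    · simp only [h, B, Bool.false_eq_true, if_false]
      exact ⟨isBounded_cell (fun C hC => (hM' C hC).1.1) hT,
        measurableSet_cell (fun C hC => (hM' C hC).1.2) _⟩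
  have hd : Pairwise (Function.onFun Disjoint (fun b : ι => B b.1)) := by
    intro b b' hbb
    have hne : b.1 ≠ b'.1 := fun h => hbb (Subtype.ext h)
    have h1 := hsub b
    have h2 := hsub b'
    rcases hcases b with ⟨T, hT, h⟩ | ⟨T, hT, h⟩ <;>
    rcases hcases b' with ⟨T', hT', h'⟩ | ⟨T', hT', h'⟩
    · simp only [Function.onFun, h, h', B, if_true]
      refine disjoint_cell (mem_subfamilies.1 hT).1 (mem_subfamilies.1 hT').1 ?_
      rintro rfl; exact hne (h.trans h'.symm)
    · exact hU.mono (h1.1 (by simp [h])) (h2.2 (by simp [h']))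
    · exact (hU.mono (h2.1 (by simp [h'])) (h1.2 (by simp [h]))).symm
    · simp only [Function.onFun, h, h', B, Bool.false_eq_true, if_false]
      refine disjoint_cell (mem_subfamilies.1 hT).1 (mem_subfamilies.1 hT').1 ?_
      rintro rfl; exact hne (h.trans h'.symm)
  have hmeas : ∀ b : ι, Measurable (fun ω : Config => ω.count (B b.1)) :=
    fun b => Config.measurable_count (hB b).1 (hB b).2
  have hind := (hP.iIndepFun_fintype hB hd).indepFun_finset
    (Finset.univ.filter (fun b : ι => b.1.1 = true))
    (Finset.univ.filter (fun b : ι => b.1.1 = false))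
    (by
      rw [Finset.disjoint_left]; intro b hb hb'
      simp only [Finset.mem_filter] at hb hb'
      simp [hb.2] at hb') hmeas
  let G : Bool → Set (Config) := fun c => if c then cylinder L else cylinder L'
  have hrep : ∀ (c : Bool) (K : Finset (Set MarkedPoint × ℕ)),
      (∀ T ∈ subfamilies (cylinderSets K), ∃ h : (c, T) ∈
        ((subfamilies (cylinderSets L)).image (Prod.mk true)) ∪
      ((subfamilies (cylinderSets L')).image (Prod.mk false)), True) →
      (∀ T, B (c, T) = cell (cylinderSets K) T) →
      (∀ q ∈ K, Bornology.IsBounded q.1) →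
      ∃ S : Set ({b : ι // b ∈ Finset.univ.filter (fun b : ι => b.1.1 = c)} → ℕ),
        cylinder K = (fun (ω : Config) (b : {b : ι // b ∈ Finset.univ.filter
          (fun b : ι => b.1.1 = c)}) => ω.count (B b.1.1)) ⁻¹' S := by
    intro c K hK1 hK2 hK3
    -- The default value `0` only makes the expression total: by `hK1` every `T` in the sum carries
    -- an index of `ι`.
    refine ⟨{x | ∀ q ∈ K, ∑ T ∈ (subfamilies (cylinderSets K)).filter (fun T => q.1 ∈ T),
      (if h : (c, T) ∈ ((subfamilies (cylinderSets L)).image (Prod.mk true)) ∪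
      ((subfamilies (cylinderSets L')).image (Prod.mk false)) then
        x ⟨⟨(c, T), h⟩, by simp⟩ else 0) = q.2}, ?_⟩
    rw [cylinder_eq_preimage (M := cylinderSets K)
      (fun q hq => mem_cylinderSets.2 ⟨q.2, hq⟩)
      (fun C hC => by obtain ⟨n, hn⟩ := mem_cylinderSets.1 hC; exact hK3 _ hn)]
    ext ω
    simp only [Set.mem_ofPred_eq, Set.mem_preimage]
    refine forall₂_congr fun q hq => ?_
    refine Eq.congr_left (Finset.sum_congr rfl fun T hT => ?_)
    obtain ⟨h, -⟩ := hK1 T (Finset.mem_filter.1 hT).1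
    rw [dif_pos h, hK2]
  obtain ⟨S, hS⟩ := hrep true L (fun T hT => ⟨by simp [hT], trivial⟩) (fun T => by simp [B])
    (fun q hq => (hL q hq).1.1)
  obtain ⟨S', hS'⟩ := hrep false L' (fun T hT => ⟨by simp [hT], trivial⟩) (fun T => by simp [B])
    (fun q hq => (hL' q hq).1.1)
  rw [hS, hS']
  -- Finite families of natural numbers form a countable space, so `S` and `S'` are measurable
  -- whatever they are.
  exact hind.measure_inter_preimage_eq_mul _ _ (Set.to_countable S).measurableSet
    (Set.to_countable S').measurableSet

/-! ### Time slices and affine changes of coordinates -/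

/-- The part of a configuration at time `k`. -/
def Config.slice (k : ℤ) (ω : Config) : Config where
  points := ω.points ∩ {q | q.1 = k}
  locallyFinite B hB := (ω.locallyFinite B hB).subset
    (Set.inter_subset_inter_left _ Set.inter_subset_left)

lemma Config.count_slice (k : ℤ) (ω : Config) (B : Set MarkedPoint) :
    (ω.slice k).count B = ω.count (B ∩ {q | q.1 = k}) := by
  simp only [Config.count, Config.slice]
  congr 1
  ext q
  simp only [Set.mem_inter_iff]
  tauto

lemma measurableSet_time (k : ℤ) : MeasurableSet {q : MarkedPoint | q.1 = k} :=
  measurable_fst (measurableSet_singleton k)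

lemma Config.measurable_slice (k : ℤ) : Measurable (Config.slice k) := by
  refine Config.measurable_of_count fun B hB hm => ?_
  simp only [Config.count_slice]
  exact Config.measurable_count (hB.subset Set.inter_subset_left) (hm.inter (measurableSet_time k))

/-- The time slices of a Poisson process are independent. -/
theorem IsPoissonLaw.iIndepFun_slice {P : Measure Config} [IsProbabilityMeasure P]
    {μ : Measure MarkedPoint} (hP : IsPoissonLaw P μ) : iIndepFun Config.slice P := by
  classical
  have hpre : ∀ (k : ℤ) (L : Finset (Set MarkedPoint × ℕ)),
      Config.slice k ⁻¹' cylinder L =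
        cylinder (L.image (fun q => (q.1 ∩ {x | x.1 = k}, q.2))) := by
    intro k L
    ext ω
    simp only [cylinder, Set.mem_preimage, Set.mem_ofPred_eq, Config.count_slice,
      Finset.forall_mem_image]
  rw [iIndepFun_iff_iIndep]
  refine iIndepSets.iIndep (fun k => (Config.measurable_slice k).comap_le)
    (fun k => Set.preimage (Config.slice k) '' cylinders) (fun k => ?_) (fun k => ?_) ?_
  · have := isPiSystem_cylinders.comap (Config.slice k)
    convert this using 1
    ext s; simp [Set.mem_image]
  · rw [generateFrom_cylinders, MeasurableSpace.comap_generateFrom]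
  · rw [iIndepSets_iff]
    intro s f hf
    -- The induction carries along a representation of the intersection as one cylinder living at
    -- times in `s`; this makes `measure_cylinder_inter` applicable when a new time is inserted.
    have key : ∃ L : Finset (Set MarkedPoint × ℕ), (⋂ i ∈ s, f i) = cylinder L ∧
        (∀ q ∈ L, (Bornology.IsBounded q.1 ∧ MeasurableSet q.1) ∧ q.1 ⊆ {x | x.1 ∈ s}) ∧
        P (⋂ i ∈ s, f i) = ∏ i ∈ s, P (f i) := by
      induction s using Finset.induction_on with
      | empty => exact ⟨∅, by simp [cylinder], by simp, by simp⟩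
      | insert a s ha ih =>
        obtain ⟨L, hL1, hL2, hL3⟩ := ih (fun i hi => hf i (Finset.mem_insert_of_mem hi))
        obtain ⟨_, ⟨K, hK, rfl⟩, hfa⟩ := hf a (Finset.mem_insert_self _ _)
        change Config.slice a ⁻¹' cylinder K = f a at hfa
        set K' := K.image (fun q => (q.1 ∩ {x : MarkedPoint | x.1 = a}, q.2)) with hK'
        have hfa' : f a = cylinder K' := by rw [← hfa, hpre]
        have hK2 : ∀ q ∈ K', (Bornology.IsBounded q.1 ∧ MeasurableSet q.1) ∧
            q.1 ⊆ {x | x.1 = a} := by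
          intro q hq
          obtain ⟨q', hq', rfl⟩ := Finset.mem_image.1 hq
          exact ⟨⟨(hK q' hq').1.subset Set.inter_subset_left,
            (hK q' hq').2.inter (measurableSet_time a)⟩, Set.inter_subset_right⟩
        refine ⟨K' ∪ L, ?_, ?_, ?_⟩
        · rw [Finset.set_biInter_insert, hL1, hfa', cylinder_union]
        · intro q hq
          rcases Finset.mem_union.1 hq with h | h
          · refine ⟨(hK2 q h).1, fun x hx => ?_⟩
            have : x.1 = a := (hK2 q h).2 hx
            simp [this]
          · refine ⟨(hL2 q h).1, fun x hx => ?_⟩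
            have : x.1 ∈ s := (hL2 q h).2 hx
            simp [this]
        · rw [Finset.set_biInter_insert, Finset.prod_insert ha, ← hL3, hL1, hfa']
          refine hP.measure_cylinder_inter ?_ hK2 hL2
          rw [Set.disjoint_left]
          intro x hx hx'
          have h1 : x.1 = a := hx
          have h2 : x.1 ∈ s := hx'
          exact ha (h1 ▸ h2)
    obtain ⟨_, -, -, h⟩ := key
    exact h

/-- The change of coordinates moving the line `x = b + v (t - a)` to the time axis. -/
def shear (a : ℤ) (b v : ℝ) : MarkedPoint ≃ₜ MarkedPoint where
  toFun q := (q.1 - a, q.2.1 - (b + v * ((q.1 - a : ℤ) : ℝ)), q.2.2)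
  invFun q := (q.1 + a, q.2.1 + (b + v * (q.1 : ℝ)), q.2.2)
  left_inv q := by ext <;> simp
  right_inv q := by ext <;> simp
  continuous_toFun := by
    have : Continuous (fun n : ℤ => (n : ℝ)) := continuous_of_discreteTopology
    have h2 : Continuous (fun q : MarkedPoint => ((q.1 - a : ℤ) : ℝ)) :=
      this.comp (continuous_fst.sub continuous_const)
    fun_prop
  continuous_invFun := by
    have : Continuous (fun n : ℤ => (n : ℝ)) := continuous_of_discreteTopology
    have h2 : Continuous (fun q : MarkedPoint => (q.1 : ℝ)) := this.comp continuous_fst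
    fun_prop

/-- The marked space is proper, so a bounded set has compact closure, and compactness is preserved
by any homeomorphism. This is what keeps images of configurations locally finite. -/
lemma isBounded_preimage_homeomorph (e : MarkedPoint ≃ₜ MarkedPoint) {B : Set MarkedPoint}
    (hB : Bornology.IsBounded B) : Bornology.IsBounded (e ⁻¹' B) := by
  have h : IsCompact (closure B) := hB.isCompact_closure
  refine (h.image e.symm.continuous).isBounded.subset ?_
  intro q hq
  exact ⟨e q, subset_closure hq, e.symm_apply_apply q⟩

/-- The image of a configuration under a homeomorphism. -/
def Config.image (e : MarkedPoint ≃ₜ MarkedPoint) (ω : Config) : Config where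
  points := e '' ω.points
  locallyFinite B hB := by
    rw [← Set.image_inter_preimage]
    exact (ω.locallyFinite _ (isBounded_preimage_homeomorph e hB)).image e

lemma Config.count_image (e : MarkedPoint ≃ₜ MarkedPoint) (ω : Config) (B : Set MarkedPoint) :
    (ω.image e).count B = ω.count (e ⁻¹' B) := by
  simp only [Config.count, Config.image]
  rw [← Set.image_inter_preimage, Set.ncard_image_of_injective _ e.injective]

lemma Config.measurable_image (e : MarkedPoint ≃ₜ MarkedPoint) :
    Measurable (Config.image e) := by
  refine Config.measurable_of_count fun B hB hm => ?_
  simp only [Config.count_image]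
  exact Config.measurable_count (isBounded_preimage_homeomorph e hB) (e.continuous.measurable hm)

/-- Mapping theorem: the counts of the image configuration are counts of preimages, which are again
disjoint, bounded, and of the same driving measure. -/
lemma IsPoissonLaw.map_image {P : Measure Config} [IsProbabilityMeasure P]
    {μ : Measure MarkedPoint} (hP : IsPoissonLaw P μ) {e : MarkedPoint ≃ₜ MarkedPoint}
    (he : MeasurePreserving e μ μ) : IsPoissonLaw (P.map (Config.image e)) μ := by
  have hm := Config.measurable_image e
  have : IsProbabilityMeasure (P.map (Config.image e)) :=
    Measure.isProbabilityMeasure_map hm.aemeasurable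
  constructor
  · intro k B hB hd
    have hc : ∀ i, Measurable (fun ω : Config => ω.count (B i)) :=
      fun i => Config.measurable_count (hB i).1 (hB i).2
    have h1 := hP.indep k (fun i => e ⁻¹' B i)
      (fun i => ⟨isBounded_preimage_homeomorph e (hB i).1, e.continuous.measurable (hB i).2⟩)
      (fun i j hij => (hd hij).preimage e)
    have hc' : ∀ i, Measurable (fun ω : Config => ω.count (e ⁻¹' B i)) := fun i =>
      Config.measurable_count (isBounded_preimage_homeomorph e (hB i).1)
        (e.continuous.measurable (hB i).2)
    rw [iIndepFun_iff_map_fun_eq_pi_map (fun i => (hc' i).aemeasurable)] at h1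
    rw [iIndepFun_iff_map_fun_eq_pi_map (fun i => (hc i).aemeasurable),
      Measure.map_map (measurable_pi_lambda _ hc) hm]
    have h2 : ∀ i, Measure.map (fun ω : Config => ω.count (B i)) (P.map (Config.image e)) =
        P.map (fun ω : Config => ω.count (e ⁻¹' B i)) := by
      intro i
      rw [Measure.map_map (hc i) hm]
      simp only [Function.comp_def, Config.count_image]
    simp only [h2, Function.comp_def, Config.count_image]
    exact h1
  · intro B hB hmB
    rw [Measure.map_map (Config.measurable_count hB hmB) hm]
    simp only [Function.comp_def, Config.count_image]
    rw [hP.poisson _ (isBounded_preimage_homeomorph e hB) (e.continuous.measurable hmB),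
      he.measure_preimage hmB.nullMeasurableSet]

/-- A shear is a skew product: a translation of time, followed at each fixed time by a translation
of space that leaves the marks alone. -/
lemma measurePreserving_shear (Pξ Pκ : Measure ℝ) [IsProbabilityMeasure Pξ]
    [IsProbabilityMeasure Pκ] (a : ℤ) (b v : ℝ) :
    MeasurePreserving (shear a b v) (drivingMeasure Pξ Pκ) (drivingMeasure Pξ Pκ) := by
  have h1 : MeasurePreserving (fun n : ℤ => n - a) Measure.count Measure.count := by
    refine ⟨measurable_from_top, ?_⟩
    ext s hs
    rw [Measure.map_apply measurable_from_top hs]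
    have : (fun n : ℤ => n - a) ⁻¹' s = (Equiv.subRight a) ⁻¹' s := rfl
    rw [this, Measure.count_apply (by trivial), Measure.count_apply hs,
      ← Equiv.image_symm_eq_preimage, (Equiv.subRight a).symm.injective.encard_image]
  refine MeasurePreserving.skew_product (f := fun n : ℤ => n - a)
    (g := fun (n : ℤ) (y : ℝ × ℝ × ℝ) => (y.1 - (b + v * ((n - a : ℤ) : ℝ)), y.2)) h1 ?_ ?_
  · have : Measurable (fun n : ℤ => (((n - a : ℤ) : ℝ))) := measurable_from_top
    have h2 : Measurable (fun q : ℤ × ℝ × ℝ × ℝ => (((q.1 - a : ℤ) : ℝ))) :=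
      this.comp measurable_fst
    unfold Function.uncurry
    fun_prop
  · refine Filter.Eventually.of_forall fun n => ?_
    exact ((measurePreserving_sub_right (volume : Measure ℝ) _).prod
      (MeasurePreserving.id (Pξ.prod Pκ))).map_eq

/-- The image law is Poisson with the same driving measure, so uniqueness identifies it with `P`.
Stationarity in time and space and invariance under change of slope are all special cases. -/
theorem IsPoissonLaw.measurePreserving_image_shear {Pξ Pκ : Measure ℝ}
    [IsProbabilityMeasure Pξ] [IsProbabilityMeasure Pκ] {P : Measure Config}
    [IsProbabilityMeasure P] (hP : IsPoissonLaw P (drivingMeasure Pξ Pκ)) (a : ℤ) (b v : ℝ) :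
    MeasurePreserving (Config.image (shear a b v)) P P := by
  have hm := Config.measurable_image (shear a b v)
  have : IsProbabilityMeasure (P.map (Config.image (shear a b v))) :=
    Measure.isProbabilityMeasure_map hm.aemeasurable
  exact ⟨hm, (hP.map_image (measurePreserving_shear Pξ Pκ a b v)).unique hP⟩

/-! ### The shot-noise potential -/

/-- The admissible amplitudes and scaling factors. -/
def marks : Set (ℝ × ℝ) := Set.Icc (-1) 1 ×ˢ Set.Ioc 0 1

/-- A configuration is regular if all its marks are admissible. -/
def Config.IsRegular (ω : Config) : Prop := ∀ q ∈ ω.points, q.2.2 ∈ marks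

/-- The points at time `k` with position in `[l, r)` and admissible marks. -/
def window (k : ℤ) (l r : ℝ) : Set MarkedPoint := {k} ×ˢ (Set.Ico l r ×ˢ marks)

lemma isBounded_window (k : ℤ) (l r : ℝ) : Bornology.IsBounded (window k l r) := by
  refine Bornology.IsBounded.prod Bornology.isBounded_singleton ?_
  exact (Metric.isBounded_Ico l r).prod ((Metric.isBounded_Icc _ _).prod (Metric.isBounded_Ioc _ _))

lemma measurableSet_marks : MeasurableSet marks := measurableSet_Icc.prod measurableSet_Ioc

lemma measurableSet_window (k : ℤ) (l r : ℝ) : MeasurableSet (window k l r) :=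
  (measurableSet_singleton k).prod (measurableSet_Ico.prod measurableSet_marks)

lemma prod_marks_compl {Pξ Pκ : Measure ℝ} [IsProbabilityMeasure Pξ] [IsProbabilityMeasure Pκ]
    (hξ : Pξ (Set.Icc (-1) 1)ᶜ = 0) (hκ : Pκ (Set.Ioc 0 1)ᶜ = 0) :
    (Pξ.prod Pκ) marksᶜ = 0 := by
  have h1 : Pξ (Set.Icc (-1) 1) = 1 := (prob_compl_eq_zero_iff measurableSet_Icc).1 hξ
  have h2 : Pκ (Set.Ioc 0 1) = 1 := (prob_compl_eq_zero_iff measurableSet_Ioc).1 hκ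
  rw [prob_compl_eq_zero_iff measurableSet_marks, marks, Measure.prod_prod, h1, h2, one_mul]

lemma drivingMeasure_window {Pξ Pκ : Measure ℝ} [IsProbabilityMeasure Pξ]
    [IsProbabilityMeasure Pκ] (hξ : Pξ (Set.Icc (-1) 1)ᶜ = 0) (hκ : Pκ (Set.Ioc 0 1)ᶜ = 0)
    (k : ℤ) (l r : ℝ) :
    drivingMeasure Pξ Pκ (window k l r) = ENNReal.ofReal (r - l) := by
  have h := (prob_compl_eq_zero_iff measurableSet_marks).1 (prod_marks_compl hξ hκ)
  rw [drivingMeasure, window, Measure.prod_prod, Measure.prod_prod, h, Real.volume_Ico]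
  simp

/-- Inadmissible marks have driving measure zero. Poisson counts are specified only for bounded
sets, hence the exhaustion by balls. -/
lemma IsPoissonLaw.ae_isRegular {Pξ Pκ : Measure ℝ}
    [IsProbabilityMeasure Pξ] [IsProbabilityMeasure Pκ] (hξ : Pξ (Set.Icc (-1) 1)ᶜ = 0)
    (hκ : Pκ (Set.Ioc 0 1)ᶜ = 0) {P : Measure Config}
    (hP : IsPoissonLaw P (drivingMeasure Pξ Pκ)) : ∀ᵐ ω ∂P, ω.IsRegular := by
  let bad : Set MarkedPoint := Set.univ ×ˢ (Set.univ ×ˢ marksᶜ)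
  have hbad : MeasurableSet bad :=
    MeasurableSet.univ.prod (MeasurableSet.univ.prod measurableSet_marks.compl)
  have hbad0 : drivingMeasure Pξ Pκ bad = 0 := by
    rw [drivingMeasure, Measure.prod_prod, Measure.prod_prod, prod_marks_compl hξ hκ]
    simp
  have h0 : ∀ m : ℕ, ∀ᵐ ω ∂P, ω.count (bad ∩ Metric.closedBall 0 m) = 0 := by
    intro m
    have hb : Bornology.IsBounded (bad ∩ Metric.closedBall 0 (m : ℝ)) :=
      Metric.isBounded_closedBall.subset Set.inter_subset_right
    have hm : MeasurableSet (bad ∩ Metric.closedBall 0 (m : ℝ)) :=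
      hbad.inter Metric.isClosed_closedBall.measurableSet
    have h1 := hP.poisson _ hb hm
    rw [measure_mono_null Set.inter_subset_left hbad0, ENNReal.toNNReal_zero] at h1
    have h2 : ∀ᵐ n ∂(P.map (fun ω : Config => ω.count (bad ∩ Metric.closedBall 0 (m : ℝ)))),
        n = 0 := by
      rw [h1, ae_iff]
      have : {a : ℕ | ¬a = 0} = {0}ᶜ := rfl
      rw [this, prob_compl_eq_zero_iff (measurableSet_singleton 0), poissonMeasure_singleton]
      simp
    exact ae_of_ae_map (Config.measurable_count hb hm).aemeasurable h2
  filter_upwards [ae_all_iff.2 h0] with ω hω q hq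
  by_contra hcon
  obtain ⟨m, hm⟩ := exists_nat_ge ‖q‖
  have hfin := ω.locallyFinite (bad ∩ Metric.closedBall 0 (m : ℝ))
    (Metric.isBounded_closedBall.subset Set.inter_subset_right)
  have := (Set.ncard_eq_zero hfin).1 (hω m)
  have hmem : q ∈ ω.points ∩ (bad ∩ Metric.closedBall 0 (m : ℝ)) :=
    ⟨hq, ⟨trivial, trivial, hcon⟩, by simpa using hm⟩
  rw [this] at hmem
  exact hmem

/-- The sum of `g` over the points of a configuration lying in `B`. -/
noncomputable def shotSum (g : MarkedPoint → ℝ) (B : Set MarkedPoint) (ω : Config) : ℝ :=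
  ∑ᶠ q ∈ ω.points ∩ B, g q

lemma shotSum_eq_sum (g : MarkedPoint → ℝ) {B : Set MarkedPoint} (hB : Bornology.IsBounded B)
    (ω : Config) : shotSum g B ω = ∑ q ∈ (ω.locallyFinite B hB).toFinset, g q :=
  finsum_mem_eq_finite_toFinset_sum _ _

/-- For a simple function the sum is a finite linear combination of counts; the general case is a
pointwise limit, since each sum is finite. -/
lemma measurable_shotSum {g : MarkedPoint → ℝ} (hg : Measurable g) {B : Set MarkedPoint}
    (hB : Bornology.IsBounded B) (hm : MeasurableSet B) : Measurable (shotSum g B) := by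
  classical
  have hg' := hg.stronglyMeasurable
  have hlim : ∀ ω, Filter.Tendsto (fun n => shotSum (hg'.approx n) B ω) Filter.atTop
      (nhds (shotSum g B ω)) := by
    intro ω
    simp only [shotSum_eq_sum _ hB]
    exact tendsto_finsetSum _ fun q _ => hg'.tendsto_approx q
  refine measurable_of_tendsto_metrizable (fun n => ?_) (tendsto_pi_nhds.2 hlim)
  set s := hg'.approx n
  have : shotSum s B = fun ω => ∑ c ∈ s.range, (ω.count (B ∩ s ⁻¹' {c}) : ℝ) * c := by
    ext ω
    rw [shotSum_eq_sum _ hB, ← Finset.sum_fiberwise_of_maps_to (g := fun q => s q)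
      (t := s.range) (fun q _ => s.mem_range_self q)]
    refine Finset.sum_congr rfl fun c _ => ?_
    rw [Finset.sum_congr rfl (g := fun _ => c) (fun q hq => (Finset.mem_filter.1 hq).2),
      Finset.sum_const, nsmul_eq_mul]
    congr 2
    rw [Config.count, Set.ncard_eq_toFinset_card _
      (ω.locallyFinite _ (hB.subset Set.inter_subset_left))]
    congr 1
    ext q
    simp [and_assoc]
  rw [this]
  refine Finset.measurable_sum _ fun c _ => ?_
  have := Config.measurable_count (hB.subset (Set.inter_subset_left (t := s ⁻¹' {c})))
    (hm.inter (s.measurableSet_fiber c))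
  have h2 : Measurable (fun n : ℕ => (n : ℝ)) := measurable_from_top
  exact (h2.comp this).mul_const c

/-- The contribution of a marked point to the potential at `x`. -/
noncomputable def kick (φ : ℝ → ℝ) (x : ℝ) (q : MarkedPoint) : ℝ :=
  q.2.2.1 * φ ((x - q.2.1) / q.2.2.2)

/-- Scaling factors are at most `1`, so only points within distance `1` of `x` contribute. The
window may be larger than necessary, so one window serves all nearby `x`; continuity of the
potential rests on this. -/
lemma potential_eq_shotSum {φ : ℝ → ℝ} (hφ_supp : {x : ℝ | φ x ≠ 0} ⊆ Set.Ioo (-1) 1)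
    {ω : Config} (hω : ω.IsRegular) {k : ℤ} {l r x : ℝ} (hl : l + 1 ≤ x) (hr : x + 1 ≤ r) :
    potential φ ω k x = shotSum (kick φ x) (window k l r) ω := by
  refine finsum_mem_inter_support_eq _ _ _ ?_
  ext q
  simp only [Set.mem_inter_iff, Set.mem_ofPred_eq, Function.mem_support]
  constructor
  · rintro ⟨⟨hq, hk⟩, hne⟩
    refine ⟨⟨hq, hk, ?_, hω q hq⟩, hne⟩
    have h1 := hφ_supp (right_ne_zero_of_mul hne)
    obtain ⟨h2, h3⟩ := (hω q hq).2
    rw [Set.mem_Ioo, lt_div_iff₀ h2, div_lt_iff₀ h2] at h1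
    constructor <;> linarith [h1.1, h1.2]
  · rintro ⟨⟨hq, hk, -⟩, hne⟩
    exact ⟨⟨hq, hk⟩, hne⟩

lemma potential_slice (φ : ℝ → ℝ) (ω : Config) (k : ℤ) (x : ℝ) :
    potential φ (ω.slice k) k x = potential φ ω k x := by
  have : {q | q ∈ (ω.slice k).points ∧ q.1 = k} = {q | q ∈ ω.points ∧ q.1 = k} := by
    ext q
    simp [Config.slice]
  rw [potential, this, potential]

lemma continuous_potential {φ : ℝ → ℝ} (hφ : Continuous φ)
    (hφ_supp : {x : ℝ | φ x ≠ 0} ⊆ Set.Ioo (-1) 1) {ω : Config} (hω : ω.IsRegular) (k : ℤ) :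
    Continuous (potential φ ω k) := by
  rw [continuous_iff_continuousAt]
  intro x
  have h1 : (fun y => shotSum (kick φ y) (window k (x - 2) (x + 2)) ω) =ᶠ[nhds x]
      potential φ ω k := by
    filter_upwards [Ioo_mem_nhds (show x - 1 < x by linarith) (show x < x + 1 by linarith)]
      with y hy
    exact (potential_eq_shotSum hφ_supp hω (by linarith [hy.1]) (by linarith [hy.2])).symm
  refine ContinuousAt.congr ?_ h1
  simp only [shotSum_eq_sum _ (isBounded_window k (x - 2) (x + 2)), kick]
  fun_prop

/-- The number of points at time `k` that can influence the potential on `[i, i + 1)`. -/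
noncomputable def Config.load (ω : Config) (k i : ℤ) : ℕ :=
  ω.count (window k (i - 1) (i + 2))

lemma Config.measurable_load (k i : ℤ) : Measurable (fun ω : Config => ω.load k i) :=
  Config.measurable_count (isBounded_window _ _ _) (measurableSet_window _ _ _)

lemma abs_shotSum_kick_le {φ : ℝ → ℝ} {K : ℝ} (hK : ∀ x, |φ x| ≤ K) (ω : Config) (k : ℤ)
    (l r x : ℝ) :
    |shotSum (kick φ x) (window k l r) ω| ≤ K * ω.count (window k l r) := by
  rw [shotSum_eq_sum _ (isBounded_window k l r)]
  refine (Finset.abs_sum_le_sum_abs _ _).trans ?_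
  rw [Config.count, Set.ncard_eq_toFinset_card _ (ω.locallyFinite _ (isBounded_window k l r)),
    mul_comm, ← nsmul_eq_mul]
  refine Finset.sum_le_card_nsmul _ _ _ fun q hq => ?_
  have hq' : q ∈ ω.points ∩ window k l r := by simpa using hq
  obtain ⟨-, -, -, h, -⟩ := hq'
  have hξ : |q.2.2.1| ≤ 1 := abs_le.2 ⟨h.1, h.2⟩
  rw [kick, abs_mul]
  calc |q.2.2.1| * |φ ((x - q.2.1) / q.2.2.2)| ≤ 1 * K :=
        mul_le_mul hξ (hK _) (abs_nonneg _) zero_le_one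
    _ = K := one_mul K

lemma abs_potential_le {φ : ℝ → ℝ} (hφ_supp : {x : ℝ | φ x ≠ 0} ⊆ Set.Ioo (-1) 1) {K : ℝ}
    (hK : ∀ x, |φ x| ≤ K) {ω : Config} (hω : ω.IsRegular) (k : ℤ) (x : ℝ) :
    |potential φ ω k x| ≤ K * ω.load k ⌊x⌋ := by
  rw [potential_eq_shotSum hφ_supp hω (l := (⌊x⌋ : ℝ) - 1) (r := (⌊x⌋ : ℝ) + 2)
    (by linarith [Int.floor_le x]) (by linarith [Int.lt_floor_add_one x])]
  exact abs_shotSum_kick_le hK ω k _ _ x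

lemma measurable_kick {φ : ℝ → ℝ} (hφ : Measurable φ) (x : ℝ) : Measurable (kick φ x) := by
  unfold kick
  fun_prop

/-- The exponential moment of the load of a unit cell. -/
noncomputable def loadMoment : ℝ := Real.exp (3 * (Real.exp 1 - 1))

lemma lintegral_exp_poissonMeasure (r : NNReal) :
    ∫⁻ n, ENNReal.ofReal (Real.exp n) ∂(poissonMeasure r) =
      ENNReal.ofReal (Real.exp (r * (Real.exp 1 - 1))) := by
  have hs : HasSum (fun n : ℕ => Real.exp (-r) * ((r * Real.exp 1) ^ n / n.factorial))
      (Real.exp (r * (Real.exp 1 - 1))) := by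
    have := (NormedSpace.expSeries_div_hasSum_exp ((r : ℝ) * Real.exp 1)).mul_left
      (Real.exp (-r))
    rw [← Real.exp_eq_exp_ℝ, ← Real.exp_add] at this
    rw [show (r : ℝ) * (Real.exp 1 - 1) = -r + r * Real.exp 1 by ring]
    exact this
  rw [poissonMeasure, lintegral_sum_measure, ← hs.tsum_eq,
    ENNReal.ofReal_tsum_of_nonneg (fun n => by positivity) hs.summable]
  refine tsum_congr fun n => ?_
  rw [lintegral_smul_measure, lintegral_dirac, smul_eq_mul,
    ← ENNReal.ofReal_mul (by positivity)]
  congr 1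
  rw [mul_pow, ← Real.exp_nat_mul, mul_one]
  ring

/-- The window defining a load has length `3`, the source of the factor `3` in `loadMoment`. -/
lemma IsPoissonLaw.lintegral_exp_load {Pξ Pκ : Measure ℝ}
    [IsProbabilityMeasure Pξ] [IsProbabilityMeasure Pκ] (hξ : Pξ (Set.Icc (-1) 1)ᶜ = 0)
    (hκ : Pκ (Set.Ioc 0 1)ᶜ = 0) {P : Measure Config}
    (hP : IsPoissonLaw P (drivingMeasure Pξ Pκ)) (k i : ℤ) :
    ∫⁻ ω, ENNReal.ofReal (Real.exp (ω.load k i)) ∂P = ENNReal.ofReal loadMoment := by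
  have h1 : P.map (fun ω => ω.load k i) = _ :=
    hP.poisson _ (isBounded_window k (i - 1) (i + 2)) (measurableSet_window _ _ _)
  rw [drivingMeasure_window hξ hκ] at h1
  have h3 : (ENNReal.ofReal ((i : ℝ) + 2 - (i - 1))).toNNReal = 3 := by
    rw [show (i : ℝ) + 2 - (i - 1) = 3 by ring]; exact Real.toNNReal_ofNat 3
  rw [h3] at h1
  have h2 := lintegral_exp_poissonMeasure 3
  rw [← h1, lintegral_map (measurable_from_top (f := fun n : ℕ => ENNReal.ofReal (Real.exp n)))
    (Config.measurable_load k i)] at h2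
  exact h2

/-! ### Loads along discretized paths -/

/-- The position at time `k` of the lattice path from the origin with increments `d`. -/
def position {n : ℕ} (d : Fin n → ℤ) (k : ℕ) : ℤ :=
  ∑ l ∈ Finset.univ.filter (fun l : Fin n => (l : ℕ) < k), d l

/-- The weighted number of lattice paths of `n` steps from the origin, a path being weighted by
the exponential of its total load minus its length. -/
noncomputable def pathWeight (n : ℕ) (ω : Config) : ℝ≥0∞ :=
  ∑' d : Fin n → ℤ, (∏ k : Fin (n + 1), ENNReal.ofReal (Real.exp (ω.load k (position d k)))) *
    ∏ l, ENNReal.ofReal (Real.exp (-|(d l : ℝ)|))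

/-- The logarithm of the path weight. -/
noncomputable def excess (n : ℕ) (ω : Config) : ℝ := Real.log (pathWeight n ω).toReal

/-- The total weight of the lattice steps. -/
noncomputable def stepWeight : ℝ≥0∞ := ∑' j : ℤ, ENNReal.ofReal (Real.exp (-|(j : ℝ)|))

lemma stepWeight_ne_top : stepWeight ≠ ⊤ := by
  have h : Summable (fun j : ℤ => Real.exp (-|(j : ℝ)|)) := by
    refine Summable.of_nat_of_neg ?_ ?_
    · simpa using Real.summable_exp_neg_nat
    · simpa using Real.summable_exp_neg_nat
  rw [stepWeight, ← ENNReal.ofReal_tsum_of_nonneg (fun _ => (Real.exp_pos _).le) h]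
  exact ENNReal.ofReal_ne_top

lemma tsum_fin_prod (w : ℤ → ℝ≥0∞) (n : ℕ) :
    ∑' d : Fin n → ℤ, ∏ l, w (d l) = (∑' j, w j) ^ n := by
  induction n with
  | zero => simp
  | succ n ih =>
    rw [← (Fin.consEquiv (fun _ : Fin (n + 1) => ℤ)).tsum_eq, ENNReal.tsum_prod', pow_succ', ← ih]
    simp only [Fin.consEquiv, Equiv.coe_fn_mk, Fin.prod_univ_succ, Fin.cons_zero, Fin.cons_succ,
      ENNReal.tsum_mul_left, ENNReal.tsum_mul_right]

lemma measurable_ofReal_exp_load (k i : ℤ) :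
    Measurable (fun ω : Config => ENNReal.ofReal (Real.exp (ω.load k i))) :=
  (measurable_from_top (f := fun n : ℕ => ENNReal.ofReal (Real.exp n))).comp
    (Config.measurable_load k i)

lemma measurable_pathWeight (n : ℕ) : Measurable (pathWeight n) := by
  refine Measurable.tsum fun d => Measurable.mul_const ?_ _
  exact Finset.measurable_prod _ fun k _ => measurable_ofReal_exp_load _ _

lemma measurable_excess (n : ℕ) : Measurable (excess n) :=
  (measurable_pathWeight n).ennreal_toReal.log

/-- Along a fixed lattice path the loads sit at distinct times and are independent, so the mean of
their exponential is the same for every path. The remaining sum over increments factorizes. -/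
lemma IsPoissonLaw.lintegral_pathWeight {Pξ Pκ : Measure ℝ}
    [IsProbabilityMeasure Pξ] [IsProbabilityMeasure Pκ] (hξ : Pξ (Set.Icc (-1) 1)ᶜ = 0)
    (hκ : Pκ (Set.Ioc 0 1)ᶜ = 0) {P : Measure Config}
    (hP : IsPoissonLaw P (drivingMeasure Pξ Pκ)) (n : ℕ) :
    ∫⁻ ω, pathWeight n ω ∂P = ENNReal.ofReal loadMoment ^ (n + 1) * stepWeight ^ n := by
  have hload : ∀ d : Fin n → ℤ,
      ∫⁻ ω, ∏ k : Fin (n + 1), ENNReal.ofReal (Real.exp (ω.load k (position d k))) ∂P =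
        ENNReal.ofReal loadMoment ^ (n + 1) := by
    intro d
    have hi : iIndepFun (fun (k : Fin (n + 1)) (ω : Config) => ω.load k (position d k)) P := by
      refine hP.iIndepFun_fintype
        (B := fun k : Fin (n + 1) => window k (position d k - 1) (position d k + 2))
        (fun k => ⟨isBounded_window _ _ _, measurableSet_window _ _ _⟩) ?_
      intro k k' hk
      rw [Function.onFun, Set.disjoint_left]
      rintro q ⟨h1, -⟩ ⟨h2, -⟩
      rw [Set.mem_singleton_iff] at h1 h2
      exact hk (Fin.ext (by exact_mod_cast h1.symm.trans h2))
    have := lintegral_prod_eq_prod_lintegral_of_indepFun Finset.univ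
      (fun (k : Fin (n + 1)) (ω : Config) =>
        ENNReal.ofReal (Real.exp (ω.load k (position d k))))
      (hi.comp (fun _ m => ENNReal.ofReal (Real.exp m)) (fun _ => measurable_from_top))
      (fun k => measurable_ofReal_exp_load _ _)
    rw [this]
    simp [hP.lintegral_exp_load hξ hκ]
  have hm : ∀ d : Fin n → ℤ, Measurable (fun ω : Config =>
      ∏ k : Fin (n + 1), ENNReal.ofReal (Real.exp (ω.load k (position d k)))) :=
    fun d => Finset.measurable_prod _ fun k _ => measurable_ofReal_exp_load _ _
  unfold pathWeight
  rw [lintegral_tsum (fun d => ((hm d).mul_const _).aemeasurable)]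
  simp only [lintegral_mul_const _ (hm _), hload, ENNReal.tsum_mul_left]
  rw [tsum_fin_prod (fun j => ENNReal.ofReal (Real.exp (-|(j : ℝ)|))), stepWeight]

lemma IsPoissonLaw.exists_lintegral_pathWeight_le {Pξ Pκ : Measure ℝ}
    [IsProbabilityMeasure Pξ] [IsProbabilityMeasure Pκ] (hξ : Pξ (Set.Icc (-1) 1)ᶜ = 0)
    (hκ : Pκ (Set.Ioc 0 1)ᶜ = 0) {P : Measure Config}
    (hP : IsPoissonLaw P (drivingMeasure Pξ Pκ)) :
    ∃ C : ℝ, 1 ≤ C ∧ ∀ n : ℕ, 1 ≤ n →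
      ∫⁻ ω, pathWeight n ω ∂P ≤ ENNReal.ofReal (Real.exp (C * n)) := by
  set s := max stepWeight.toReal 1 with hs
  have hs1 : 1 ≤ s := le_max_right _ _
  have hle : stepWeight ≤ ENNReal.ofReal s := by
    rw [← ENNReal.ofReal_toReal stepWeight_ne_top]
    exact ENNReal.ofReal_le_ofReal (le_max_left _ _)
  set a := 3 * (Real.exp 1 - 1) with ha
  have he : 2 ≤ Real.exp 1 := by linarith [Real.add_one_le_exp (1 : ℝ)]
  have hls : 0 ≤ Real.log s := Real.log_nonneg hs1
  -- The factor `2` absorbs the extra time through `n + 1 ≤ 2 n`.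
  refine ⟨2 * a + Real.log s, by linarith, fun n hn => ?_⟩
  rw [hP.lintegral_pathWeight hξ hκ]
  calc ENNReal.ofReal loadMoment ^ (n + 1) * stepWeight ^ n
      ≤ ENNReal.ofReal loadMoment ^ (n + 1) * ENNReal.ofReal s ^ n := by gcongr
    _ = ENNReal.ofReal (Real.exp (a * (n + 1) + Real.log s * n)) := by
        rw [loadMoment, ← ENNReal.ofReal_pow (Real.exp_pos _).le,
          ← ENNReal.ofReal_pow (by linarith), ← ENNReal.ofReal_mul (by positivity), Real.exp_add,
          show a * ((n : ℝ) + 1) = ((n + 1 : ℕ) : ℝ) * a by push_cast; ring,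
          mul_comm (Real.log s), Real.exp_nat_mul, Real.exp_nat_mul, Real.exp_log (by linarith)]
    _ ≤ _ := by
        refine ENNReal.ofReal_le_ofReal (Real.exp_le_exp.2 ?_)
        have : (1 : ℝ) ≤ n := by exact_mod_cast hn
        nlinarith

lemma position_increments (i : ℕ → ℤ) (h0 : i 0 = 0) (n : ℕ) {k : ℕ} (hk : k ≤ n) :
    position (fun l : Fin n => i (l + 1) - i l) k = i k := by
  rw [position, Finset.sum_filter, Fin.sum_univ_eq_sum_range
    (fun l => if l < k then i (l + 1) - i l else 0) n, ← Finset.sum_filter]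
  have : Finset.filter (fun l => l < k) (Finset.range n) = Finset.range k := by
    ext l; simp; omega
  rw [this, Finset.sum_range_sub, h0, sub_zero]

/-- One term of the sum defining `pathWeight` is at most the whole; take logarithms. The gain is
that the same random variable `excess n ω` serves every path. -/
lemma sum_load_le_excess {n : ℕ} {ω : Config} (hω : pathWeight n ω ≠ ⊤) (i : ℕ → ℤ)
    (h0 : i 0 = 0) :
    ∑ k ∈ Finset.range (n + 1), (ω.load k (i k) : ℝ) ≤
      excess n ω + ∑ k ∈ Finset.range n, |(i (k + 1) : ℝ) - i k| := by
  set d : Fin n → ℤ := fun l => i (l + 1) - i l with hd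
  have h1 := ENNReal.le_tsum (f := fun d : Fin n → ℤ =>
    (∏ k : Fin (n + 1), ENNReal.ofReal (Real.exp (ω.load k (position d k)))) *
      ∏ l, ENNReal.ofReal (Real.exp (-|(d l : ℝ)|))) d
  change _ ≤ pathWeight n ω at h1
  rw [← ENNReal.ofReal_prod_of_nonneg (fun _ _ => (Real.exp_pos _).le),
    ← ENNReal.ofReal_prod_of_nonneg (fun _ _ => (Real.exp_pos _).le),
    ← ENNReal.ofReal_mul (Finset.prod_nonneg fun _ _ => (Real.exp_pos _).le),
    ← Real.exp_sum, ← Real.exp_sum, ← Real.exp_add, ENNReal.ofReal_le_iff_le_toReal hω] at h1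
  have h2 := Real.log_le_log (Real.exp_pos _) h1
  rw [Real.log_exp] at h2
  have h3 : ∑ k : Fin (n + 1), (ω.load k (position d k) : ℝ) =
      ∑ k ∈ Finset.range (n + 1), (ω.load k (i k) : ℝ) := by
    rw [← Fin.sum_univ_eq_sum_range (fun k => (ω.load k (i k) : ℝ))]
    refine Finset.sum_congr rfl fun k _ => ?_
    rw [hd, position_increments i h0 n (by omega)]
  have h4 : ∑ l : Fin n, -|(d l : ℝ)| = -∑ k ∈ Finset.range n, |(i (k + 1) : ℝ) - i k| := by
    rw [← Fin.sum_univ_eq_sum_range (fun k => |(i (k + 1) : ℝ) - i k|), Finset.sum_neg_distrib]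
    simp [hd]
  rw [h3, h4] at h2
  change _ ≤ excess n ω at h2
  linarith

lemma excess_nonneg {n : ℕ} {ω : Config} (hω : pathWeight n ω ≠ ⊤) : 0 ≤ excess n ω := by
  have := sum_load_le_excess hω (fun _ => 0) rfl
  simp only [sub_self, abs_zero, Finset.sum_const_zero, add_zero] at this
  exact (Finset.sum_nonneg fun _ _ => Nat.cast_nonneg _).trans this

lemma abs_floor_sub_floor_le (x y : ℝ) : |(⌊y⌋ : ℝ) - ⌊x⌋| ≤ |y - x| + 1 := by
  rw [abs_le]
  have h1 := Int.floor_le x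
  have h2 := Int.lt_floor_add_one x
  have h3 := Int.floor_le y
  have h4 := Int.lt_floor_add_one y
  have h5 := abs_le.1 (le_refl |y - x|)
  constructor <;> linarith [h5.1, h5.2]

/-- Rounding a path to the lattice lengthens each step by at most `1`, which accounts for the extra
`n`. -/
lemma sum_load_floor_le {n : ℕ} {ω : Config} (hω : pathWeight n ω ≠ ⊤) (γ : ℕ → ℝ)
    (h0 : γ 0 = 0) :
    ∑ k ∈ Finset.range (n + 1), (ω.load k ⌊γ k⌋ : ℝ) ≤
      excess n ω + n + ∑ k ∈ Finset.range n, |γ (k + 1) - γ k| := by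
  have h1 := sum_load_le_excess hω (fun k => ⌊γ k⌋) (by simp [h0])
  have h2 : ∑ k ∈ Finset.range n, |(⌊γ (k + 1)⌋ : ℝ) - ⌊γ k⌋| ≤
      ∑ k ∈ Finset.range n, (|γ (k + 1) - γ k| + 1) :=
    Finset.sum_le_sum fun k _ => abs_floor_sub_floor_le _ _
  rw [Finset.sum_add_distrib] at h2
  simp only [Finset.sum_const, Finset.card_range, nsmul_eq_mul, mul_one] at h2
  linarith

/-! ### Action of bridges in a deterministic field -/

/-- The total action of a path of `n` steps in the field `F`. -/
noncomputable def act (F : ℕ → ℝ → ℝ) (p : ℝ) (n : ℕ) (γ : ℕ → ℝ) : ℝ :=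
  (1 / 2) * ∑ k ∈ Finset.range n, (γ (k + 1) - γ k) ^ 2 +
    ∑ k ∈ Finset.range n, (p * F k (γ k) + (1 - p) * F (k + 1) (γ (k + 1)))

/-- The values of the action on paths from `0` to `0`. -/
def bridgeValues (F : ℕ → ℝ → ℝ) (p : ℝ) (n : ℕ) : Set ℝ :=
  {a | ∃ γ : ℕ → ℝ, γ 0 = 0 ∧ γ n = 0 ∧ a = act F p n γ}

/-- The optimal action of paths from `0` to `0`. -/
noncomputable def bridgeAction (F : ℕ → ℝ → ℝ) (p : ℝ) (n : ℕ) : ℝ := sInf (bridgeValues F p n)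

/-- The sum of the field along any path from `0` is at most linear in `n` and the length. -/
def Controlled (F : ℕ → ℝ → ℝ) (n : ℕ) (K ℓ : ℝ) : Prop :=
  ∀ γ : ℕ → ℝ, γ 0 = 0 → ∑ k ∈ Finset.range (n + 1), |F k (γ k)| ≤
    K * (ℓ + n + ∑ k ∈ Finset.range n, |γ (k + 1) - γ k|)

lemma act_congr {F G : ℕ → ℝ → ℝ} {p : ℝ} {n : ℕ} {γ γ' : ℕ → ℝ}
    (h : ∀ k ≤ n, γ k = γ' k) (hF : ∀ k ≤ n, F k (γ k) = G k (γ k)) :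
    act F p n γ = act G p n γ' := by
  unfold act
  congr 1
  · congr 1
    refine Finset.sum_congr rfl fun k hk => ?_
    rw [Finset.mem_range] at hk
    rw [h k hk.le, h (k + 1) hk]
  · refine Finset.sum_congr rfl fun k hk => ?_
    rw [Finset.mem_range] at hk
    rw [hF k hk.le, hF (k + 1) hk, h k hk.le, h (k + 1) hk]

lemma abs_potential_sum_le {F : ℕ → ℝ → ℝ} {p : ℝ} (hp : p ∈ Set.Icc (0 : ℝ) 1) (n : ℕ)
    (γ : ℕ → ℝ) :
    |∑ k ∈ Finset.range n, (p * F k (γ k) + (1 - p) * F (k + 1) (γ (k + 1)))| ≤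
      ∑ k ∈ Finset.range (n + 1), |F k (γ k)| := by
  obtain ⟨hp0, hp1⟩ := hp
  have h1 : |∑ k ∈ Finset.range n, (p * F k (γ k) + (1 - p) * F (k + 1) (γ (k + 1)))| ≤
      p * ∑ k ∈ Finset.range n, |F k (γ k)| +
        (1 - p) * ∑ k ∈ Finset.range n, |F (k + 1) (γ (k + 1))| := by
    refine (Finset.abs_sum_le_sum_abs _ _).trans ?_
    rw [Finset.mul_sum, Finset.mul_sum, ← Finset.sum_add_distrib]
    refine Finset.sum_le_sum fun k _ => (abs_add_le _ _).trans ?_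
    rw [abs_mul, abs_mul, abs_of_nonneg hp0, abs_of_nonneg (sub_nonneg.2 hp1)]
  have h2 := Finset.sum_range_succ (fun k => |F k (γ k)|) n
  have h3 := Finset.sum_range_succ' (fun k => |F k (γ k)|) n
  have h4 := abs_nonneg (F n (γ n))
  have h5 := abs_nonneg (F 0 (γ 0))
  set T := ∑ k ∈ Finset.range (n + 1), |F k (γ k)|
  nlinarith

/-- The field costs at most `K` times the length. Since `K |d| ≤ d ^ 2 / 4 + K ^ 2` for each
increment `d`, half of the kinetic action pays for it. -/
lemma Controlled.le_act {F : ℕ → ℝ → ℝ} {n : ℕ} {K ℓ : ℝ} (hF : Controlled F n K ℓ) {p : ℝ}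
    (hp : p ∈ Set.Icc (0 : ℝ) 1) {γ : ℕ → ℝ} (h0 : γ 0 = 0) :
    (1 / 4) * ∑ k ∈ Finset.range n, (γ (k + 1) - γ k) ^ 2 - (K ^ 2 + K) * n - K * ℓ ≤
      act F p n γ := by
  have h1 := (abs_le.1 ((abs_potential_sum_le hp n γ).trans (hF γ h0))).1
  have h2 : K * ∑ k ∈ Finset.range n, |γ (k + 1) - γ k| ≤
      (1 / 4) * ∑ k ∈ Finset.range n, (γ (k + 1) - γ k) ^ 2 + K ^ 2 * n := by
    rw [Finset.mul_sum, Finset.mul_sum]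
    have : K ^ 2 * n = ∑ k ∈ Finset.range n, K ^ 2 := by simp [mul_comm]
    rw [this, ← Finset.sum_add_distrib]
    refine Finset.sum_le_sum fun k _ => ?_
    rw [← sq_abs (γ (k + 1) - γ k)]
    nlinarith [sq_nonneg (|γ (k + 1) - γ k| - 2 * K)]
  unfold act
  nlinarith

lemma Controlled.act_zero_le {F : ℕ → ℝ → ℝ} {n : ℕ} {K ℓ : ℝ} (hF : Controlled F n K ℓ) {p : ℝ}
    (hp : p ∈ Set.Icc (0 : ℝ) 1) : act F p n (fun _ => 0) ≤ K * (ℓ + n) := by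
  have h := (le_abs_self _).trans ((abs_potential_sum_le hp n (fun _ => 0)).trans
    (hF (fun _ => 0) rfl))
  simp only [sub_self, abs_zero, Finset.sum_const_zero, add_zero] at h
  simpa [act] using h

lemma abs_le_sum_increments {n : ℕ} {γ : ℕ → ℝ} (h0 : γ 0 = 0) {k : ℕ} (hk : k ≤ n) :
    |γ k| ≤ ∑ l ∈ Finset.range n, |γ (l + 1) - γ l| := by
  have h : γ k = ∑ l ∈ Finset.range k, (γ (l + 1) - γ l) := by
    rw [Finset.sum_range_sub, h0, sub_zero]
  rw [h]
  exact (Finset.abs_sum_le_sum_abs _ _).trans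
    (Finset.sum_le_sum_of_subset_of_nonneg (Finset.range_mono hk) fun _ _ _ => abs_nonneg _)

lemma sq_le_of_kinetic_le {n : ℕ} {γ : ℕ → ℝ} (h0 : γ 0 = 0) {k : ℕ} (hk : k ≤ n) :
    γ k ^ 2 ≤ n * ∑ l ∈ Finset.range n, (γ (l + 1) - γ l) ^ 2 := by
  have h1 := abs_le_sum_increments h0 hk
  have h2 := sq_sum_le_card_mul_sum_sq (s := Finset.range n) (f := fun l => |γ (l + 1) - γ l|)
  simp only [Finset.card_range, sq_abs] at h2
  rw [← sq_abs]
  exact (pow_le_pow_left₀ (abs_nonneg _) h1 2).trans h2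

lemma continuous_act {F : ℕ → ℝ → ℝ} (hF : ∀ k, Continuous (F k)) (p : ℝ) (n : ℕ) :
    Continuous (act F p n) := by
  have h : ∀ k, Continuous (fun γ : ℕ → ℝ => F k (γ k)) :=
    fun k => (hF k).comp (continuous_apply k)
  unfold act
  fun_prop

lemma zero_act_mem_bridgeValues (F : ℕ → ℝ → ℝ) (p : ℝ) (n : ℕ) :
    act F p n (fun _ => 0) ∈ bridgeValues F p n := ⟨_, rfl, rfl, rfl⟩

lemma Controlled.bddBelow {F : ℕ → ℝ → ℝ} {n : ℕ} {K ℓ : ℝ} (hF : Controlled F n K ℓ) {p : ℝ}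
    (hp : p ∈ Set.Icc (0 : ℝ) 1) : -(K ^ 2 + K) * n - K * ℓ ∈ lowerBounds (bridgeValues F p n) := by
  rintro _ ⟨γ, h0, -, rfl⟩
  have h := hF.le_act hp h0
  have : 0 ≤ ∑ k ∈ Finset.range n, (γ (k + 1) - γ k) ^ 2 :=
    Finset.sum_nonneg fun _ _ => sq_nonneg _
  linarith

/-- Optimal bridges exist in a continuous controlled field. -/
theorem Controlled.exists_minimizer {F : ℕ → ℝ → ℝ} {n : ℕ} {K ℓ : ℝ} (hF : Controlled F n K ℓ)
    {p : ℝ} (hp : p ∈ Set.Icc (0 : ℝ) 1) (hc : ∀ k, Continuous (F k)) :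
    ∃ γ : ℕ → ℝ, γ 0 = 0 ∧ γ n = 0 ∧ ∀ γ' : ℕ → ℝ, γ' 0 = 0 → γ' n = 0 →
      act F p n γ ≤ act F p n γ' := by
  -- A bridge doing no worse than the zero path has squared positions at most `R - 1`; the added `1`
  -- turns this into `|γ' k| ≤ R` without a square root.
  set R : ℝ := n * (4 * (act F p n (fun _ => 0) + (K ^ 2 + K) * n + K * ℓ)) + 1 with hR
  -- Radius zero at the endpoints encodes the boundary conditions, and radius zero after time `n`
  -- pins coordinates the action ignores. The box is then compact in the full product.
  set r : ℕ → ℝ := fun k => if 0 < k ∧ k < n then max R 0 else 0 with hr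
  have hr0 : ∀ k, 0 ≤ r k := by
    intro k; simp only [hr]; split_ifs
    · exact le_max_right _ _
    · exact le_rfl
  set S : Set (ℕ → ℝ) := Set.pi Set.univ (fun k => Set.Icc (-r k) (r k)) with hS
  have hcS : IsCompact S := isCompact_univ_pi fun _ => isCompact_Icc
  have h0S : (fun _ => 0 : ℕ → ℝ) ∈ S := fun k _ => ⟨by simpa using hr0 k, hr0 k⟩
  obtain ⟨γ, hγS, hγ⟩ := hcS.exists_isMinOn ⟨_, h0S⟩ (continuous_act hc p n).continuousOn
  have hz : ∀ k, ¬(0 < k ∧ k < n) → γ k = 0 := by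
    intro k hk
    have := hγS k (Set.mem_univ k)
    simp only [hr, hk, if_false, neg_zero, Set.Icc_self, Set.mem_singleton_iff] at this
    exact this
  refine ⟨γ, hz 0 (by simp), hz n (by simp), fun γ' h0 hn => ?_⟩
  rcases le_total (act F p n (fun _ => 0)) (act F p n γ') with h | h
  · exact (hγ h0S).trans h
  · set γ'' : ℕ → ℝ := fun k => if k ≤ n then γ' k else 0 with hγ''
    have heq : act F p n γ' = act F p n γ'' :=
      act_congr (fun k hk => by simp [hγ'', hk]) (fun _ _ => rfl)
    rw [heq]
    refine hγ ?_
    intro k _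
    by_cases hk : 0 < k ∧ k < n
    · have h1 := sq_le_of_kinetic_le h0 hk.2.le
      have h2 := hF.le_act hp h0
      have h3 : γ' k ^ 2 ≤ R - 1 := by
        refine h1.trans ?_
        rw [hR, add_sub_cancel_right]
        refine mul_le_mul_of_nonneg_left ?_ (Nat.cast_nonneg n)
        linarith
      have h4 : |γ' k| ≤ R := by
        rw [abs_le]
        constructor <;> nlinarith [sq_nonneg (γ' k - 1), sq_nonneg (γ' k + 1)]
      have h5 : γ'' k = γ' k := by simp [hγ'', hk.2.le]
      rw [h5]
      simp only [hr, hk, and_self, if_true]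
      exact abs_le.1 (h4.trans (le_max_left _ _))
    · have h5 : γ'' k = 0 := by
        rcases Nat.eq_zero_or_pos k with rfl | h'
        · simp [hγ'', h0]
        · rcases Nat.lt_or_ge n k with h'' | h''
          · simp [hγ'', h''.not_ge]
          · have : k = n := by omega
            simp [hγ'', this, hn]
      rw [h5]
      exact ⟨by simpa using hr0 k, hr0 k⟩

lemma Controlled.isLeast {F : ℕ → ℝ → ℝ} {n : ℕ} {K ℓ : ℝ} (hF : Controlled F n K ℓ)
    {p : ℝ} (hp : p ∈ Set.Icc (0 : ℝ) 1) (hc : ∀ k, Continuous (F k)) :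
    IsLeast (bridgeValues F p n) (bridgeAction F p n) := by
  obtain ⟨γ, h0, hn, h⟩ := hF.exists_minimizer hp hc
  have hl : IsLeast (bridgeValues F p n) (act F p n γ) :=
    ⟨⟨γ, h0, hn, rfl⟩, by rintro _ ⟨γ', h0', hn', rfl⟩; exact h γ' h0' hn'⟩
  rwa [bridgeAction, hl.csInf_eq]

lemma Controlled.bridgeAction_le {F : ℕ → ℝ → ℝ} {n : ℕ} {K ℓ : ℝ} (hF : Controlled F n K ℓ)
    {p : ℝ} (hp : p ∈ Set.Icc (0 : ℝ) 1) {γ : ℕ → ℝ} (h0 : γ 0 = 0) (hn : γ n = 0) :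
    bridgeAction F p n ≤ act F p n γ := csInf_le ⟨_, hF.bddBelow hp⟩ ⟨γ, h0, hn, rfl⟩

lemma Controlled.le_bridgeAction {F : ℕ → ℝ → ℝ} {n : ℕ} {K ℓ : ℝ} (hF : Controlled F n K ℓ)
    {p : ℝ} (hp : p ∈ Set.Icc (0 : ℝ) 1) : -(K ^ 2 + K) * n - K * ℓ ≤ bridgeAction F p n :=
  le_csInf ⟨_, zero_act_mem_bridgeValues F p n⟩ (hF.bddBelow hp)

lemma Controlled.bridgeAction_le_bound {F : ℕ → ℝ → ℝ} {n : ℕ} {K ℓ : ℝ}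
    (hF : Controlled F n K ℓ) {p : ℝ} (hp : p ∈ Set.Icc (0 : ℝ) 1) :
    bridgeAction F p n ≤ K * (ℓ + n) :=
  (hF.bridgeAction_le hp rfl rfl).trans (hF.act_zero_le hp)

lemma Controlled.kinetic_le {F : ℕ → ℝ → ℝ} {n : ℕ} {K ℓ : ℝ} (hF : Controlled F n K ℓ)
    {p : ℝ} (hp : p ∈ Set.Icc (0 : ℝ) 1) {γ : ℕ → ℝ} (h0 : γ 0 = 0)
    (hγ : act F p n γ ≤ act F p n (fun _ => 0)) :
    ∑ k ∈ Finset.range n, (γ (k + 1) - γ k) ^ 2 ≤ 4 * ((K ^ 2 + 2 * K) * n + 2 * K * ℓ) := by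
  have h1 := hF.le_act hp h0
  have h2 := hF.act_zero_le hp
  linarith

/-! ### Paths with values in a finite grid -/

/-- The path from `0` to `0` passing through the given points. -/
noncomputable def gridPath {n : ℕ} {D : Finset ℝ} (g : Fin n → D) (k : ℕ) : ℝ :=
  if h : 0 < k ∧ k < n then (g ⟨k, h.2⟩ : ℝ) else 0

lemma gridPath_zero {n : ℕ} {D : Finset ℝ} (g : Fin n → D) : gridPath g 0 = 0 := by
  simp [gridPath]

lemma gridPath_last {n : ℕ} {D : Finset ℝ} (g : Fin n → D) : gridPath g n = 0 := by
  simp [gridPath]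

/-- The optimal action over paths from `0` to `0` with values in a finite grid. -/
noncomputable def gridAction (F : ℕ → ℝ → ℝ) (p : ℝ) (n : ℕ) (D : Finset ℝ) : ℝ :=
  ⨅ g : Fin n → D, act F p n (gridPath g)

lemma gridAction_le (F : ℕ → ℝ → ℝ) (p : ℝ) (n : ℕ) {D : Finset ℝ} (g : Fin n → D) :
    gridAction F p n D ≤ act F p n (gridPath g) :=
  ciInf_le (Set.finite_range _).bddBelow g

lemma gridAction_le_zero (F : ℕ → ℝ → ℝ) (p : ℝ) (n : ℕ) {D : Finset ℝ} (hD : (0 : ℝ) ∈ D) :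
    gridAction F p n D ≤ act F p n (fun _ => 0) := by
  refine (gridAction_le F p n (fun _ => ⟨0, hD⟩)).trans_eq ?_
  congr 1
  ext k
  simp [gridPath]

lemma Controlled.bridgeAction_le_gridAction {F : ℕ → ℝ → ℝ} {n : ℕ} {K ℓ : ℝ}
    (hF : Controlled F n K ℓ) {p : ℝ} (hp : p ∈ Set.Icc (0 : ℝ) 1) {D : Finset ℝ}
    (hD : (0 : ℝ) ∈ D) : bridgeAction F p n ≤ gridAction F p n D := by
  have : Nonempty D := ⟨⟨0, hD⟩⟩
  exact le_ciInf fun g => hF.bridgeAction_le hp (gridPath_zero g) (gridPath_last g)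

/-- The grid of mesh `1 / (m + 1)` of the interval `[-r, r]`. -/
noncomputable def grid (r m : ℕ) : Finset ℝ :=
  (Finset.Icc (-(r * (m + 1) : ℤ)) (r * (m + 1))).image (fun j : ℤ => (j : ℝ) / (m + 1))

lemma zero_mem_grid (r m : ℕ) : (0 : ℝ) ∈ grid r m := by
  refine Finset.mem_image.2 ⟨0, ?_, by simp⟩
  rw [Finset.mem_Icc]
  constructor
  · have : (0 : ℤ) ≤ r * (m + 1) := by positivity
    linarith
  · positivity

lemma abs_le_of_mem_grid {r m : ℕ} {x : ℝ} (hx : x ∈ grid r m) : |x| ≤ r := by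
  obtain ⟨j, hj, rfl⟩ := Finset.mem_image.1 hx
  rw [Finset.mem_Icc] at hj
  have hm : (0 : ℝ) < m + 1 := by positivity
  have h1 : -((r : ℝ) * (m + 1)) ≤ j := by exact_mod_cast hj.1
  have h2 : (j : ℝ) ≤ r * (m + 1) := by exact_mod_cast hj.2
  rw [abs_le, le_div_iff₀ hm, div_le_iff₀ hm]
  constructor <;> linarith

lemma exists_mem_grid {r : ℕ} (m : ℕ) {x : ℝ} (hx : |x| ≤ r) :
    ∃ y ∈ grid r m, |y - x| ≤ 1 / (m + 1) := by
  have hm : (0 : ℝ) < m + 1 := by positivity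
  obtain ⟨h1, h2⟩ := abs_le.1 hx
  refine ⟨(⌊x * (m + 1)⌋ : ℝ) / (m + 1), Finset.mem_image.2 ⟨⌊x * (m + 1)⌋, ?_, rfl⟩, ?_⟩
  · rw [Finset.mem_Icc]
    constructor
    · rw [Int.le_floor]
      push_cast
      nlinarith
    · have : (⌊x * (m + 1)⌋ : ℝ) ≤ r * (m + 1) :=
        (Int.floor_le _).trans (mul_le_mul_of_nonneg_right h2 hm.le)
      exact_mod_cast this
  · have h3 := Int.floor_le (x * (m + 1))
    have h4 := Int.lt_floor_add_one (x * (m + 1))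
    have : (⌊x * (m + 1)⌋ : ℝ) / (m + 1) - x = (⌊x * (m + 1)⌋ - x * (m + 1)) / (m + 1) := by
      field_simp
    rw [this, abs_div, abs_of_pos hm]
    refine div_le_div_of_nonneg_right ?_ hm.le
    rw [abs_le]; constructor <;> linarith

/-- Grid actions converge to the optimal action if the grids fill an interval containing an
optimal bridge. -/
theorem Controlled.tendsto_gridAction {F : ℕ → ℝ → ℝ} {n : ℕ} {K ℓ : ℝ} (hF : Controlled F n K ℓ)
    {p : ℝ} (hp : p ∈ Set.Icc (0 : ℝ) 1) (hc : ∀ k, Continuous (F k)) {r : ℕ → ℕ}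
    {γ : ℕ → ℝ} (h0 : γ 0 = 0) (hn : γ n = 0) (hγ : ∀ γ' : ℕ → ℝ, γ' 0 = 0 → γ' n = 0 →
      act F p n γ ≤ act F p n γ')
    (hr : ∀ᶠ m in Filter.atTop, ∀ k ≤ n, |γ k| ≤ r m) :
    Filter.Tendsto (fun m => gridAction F p n (grid (r m) m)) Filter.atTop
      (nhds (bridgeAction F p n)) := by
  have hval : bridgeAction F p n = act F p n γ :=
    le_antisymm (hF.bridgeAction_le hp h0 hn)
      (le_csInf ⟨_, zero_act_mem_bridgeValues F p n⟩
        (by rintro _ ⟨γ', h0', hn', rfl⟩; exact hγ γ' h0' hn'))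
  have hex : ∀ m k, ∃ y : grid (r m) m, |γ k| ≤ r m → |(y : ℝ) - γ k| ≤ 1 / (m + 1) := by
    intro m k
    by_cases h : |γ k| ≤ r m
    · obtain ⟨y, hy, hy'⟩ := exists_mem_grid m h
      exact ⟨⟨y, hy⟩, fun _ => hy'⟩
    · exact ⟨⟨0, zero_mem_grid _ _⟩, fun h' => absurd h' h⟩
  choose y hy using hex
  set γ₀ : ℕ → ℝ := fun k => if k ≤ n then γ k else 0 with hγ₀
  have hγ₀act : act F p n γ₀ = act F p n γ :=
    act_congr (fun k hk => by simp [hγ₀, hk]) (fun k hk => rfl)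
  -- Rounding the optimal bridge to the grids converges coordinatewise, and the action is continuous
  -- for the product topology. The grid actions are thus squeezed between the optimum and the
  -- actions of the rounded bridges.
  have hconv : Filter.Tendsto (fun m => gridPath (fun k : Fin n => y m k)) Filter.atTop
      (nhds γ₀) := by
    rw [tendsto_pi_nhds]
    intro k
    by_cases hk : 0 < k ∧ k < n
    · have h1 : Filter.Tendsto (fun m => (y m k : ℝ)) Filter.atTop (nhds (γ k)) := by
        rw [tendsto_iff_dist_tendsto_zero]
        refine squeeze_zero' (Filter.Eventually.of_forall fun _ => dist_nonneg) ?_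
          (tendsto_one_div_add_atTop_nhds_zero_nat (𝕜 := ℝ))
        filter_upwards [hr] with m hm
        exact hy m k (hm k hk.2.le)
      simpa [gridPath, hk, hγ₀, hk.2.le] using h1
    · have h5 : γ₀ k = 0 := by
        rcases Nat.eq_zero_or_pos k with rfl | h'
        · simp [hγ₀, h0]
        · rcases Nat.lt_or_ge n k with h'' | h''
          · simp [hγ₀, h''.not_ge]
          · have : k = n := by omega
            simp [hγ₀, this, hn]
      rw [h5]
      simp [gridPath, hk]
  have hlim := ((continuous_act hc p n).tendsto γ₀).comp hconv
  rw [hγ₀act, ← hval] at hlim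
  exact tendsto_of_tendsto_of_tendsto_of_le_of_le tendsto_const_nhds hlim
    (fun m => hF.bridgeAction_le_gridAction hp (zero_mem_grid _ _))
    (fun m => gridAction_le F p n _)

/-! ### Relation to the optimal action -/

lemma sum_Ico_int (a : ℤ) (n : ℕ) (f : ℤ → ℝ) :
    ∑ k ∈ Finset.Ico a (a + n), f k = ∑ k ∈ Finset.range n, f (a + k) := by
  refine (Finset.sum_nbij' (fun k : ℕ => a + k) (fun k : ℤ => (k - a).toNat) ?_ ?_ ?_ ?_ ?_).symm
  · intro k hk; simp only [Finset.mem_range, Finset.mem_Ico] at *; omega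
  · intro k hk; simp only [Finset.mem_range, Finset.mem_Ico] at *; omega
  · intro k hk; simp
  · intro k hk; simp only [Finset.mem_Ico] at hk; omega
  · intro k hk; rfl

/-- The potential seen from the line `x = b + v (t - a)`. -/
noncomputable def lineField (φ : ℝ → ℝ) (ω : Config) (a : ℤ) (b v : ℝ) (k : ℕ) (x : ℝ) : ℝ :=
  potential φ ω (a + k) (b + v * k + x)

/-- Expand the squared increments relative to the line: the cross term telescopes to `v * (γ n - γ
0) = v ^ 2 * n`, so the correction does not depend on the path. -/
lemma act_line (F : ℕ → ℝ → ℝ) (p b v : ℝ) (n : ℕ) (γ : ℕ → ℝ) (h0 : γ 0 = b)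
    (hn : γ n = b + v * n) :
    act F p n γ =
      act (fun k x => F k (b + v * k + x)) p n (fun k => γ k - (b + v * k)) + v ^ 2 / 2 * n := by
  rw [act, act]
  have h1 : ∀ k : ℕ, (γ (k + 1) - (b + v * ↑(k + 1)) - (γ k - (b + v * k))) ^ 2 =
      (γ (k + 1) - γ k) ^ 2 - 2 * v * (γ (k + 1) - γ k) + v ^ 2 := by
    intro k
    push_cast
    ring
  simp only [h1, Finset.sum_add_distrib, Finset.sum_sub_distrib, ← Finset.mul_sum]
  rw [← Finset.sum_sub_distrib, Finset.sum_range_sub, hn, h0]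
  simp only [add_sub_cancel, Finset.sum_const, Finset.card_range, nsmul_eq_mul]
  ring

lemma action_eq_act (φ : ℝ → ℝ) (p : ℝ) (ω : Config) (a : ℤ) (b v : ℝ) (n : ℕ) (γ : ℤ → ℝ)
    (h0 : γ a = b) (hn : γ (a + n) = b + v * n) :
    kineticAction a (a + n) γ + potentialAction φ p ω a (a + n) γ =
      act (lineField φ ω a b v) p n (fun k => γ (a + k) - (b + v * k)) + v ^ 2 / 2 * n := by
  have h := act_line (fun k x => potential φ ω (a + k) x) p b v n (fun k => γ (a + k))
    (by simp [h0]) hn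
  rw [kineticAction, potentialAction, sum_Ico_int, sum_Ico_int]
  have h2 : ∀ k : ℕ, a + ((k + 1 : ℕ) : ℤ) = a + k + 1 := by intro k; push_cast; ring
  unfold lineField
  rw [← h, act]
  simp only [h2]

lemma actionValues_eq (φ : ℝ → ℝ) (p : ℝ) (ω : Config) (a : ℤ) (b v : ℝ) (n : ℕ) :
    actionValues φ p ω a (a + n) b (b + v * n) =
      (fun t => t + v ^ 2 / 2 * n) '' bridgeValues (lineField φ ω a b v) p n := by
  ext t
  constructor
  · rintro ⟨γ, h0, hn, rfl⟩
    exact ⟨_, ⟨_, by simp [h0], by simp [hn], rfl⟩, (action_eq_act φ p ω a b v n γ h0 hn).symm⟩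
  · rintro ⟨_, ⟨γ, h0, hn, rfl⟩, rfl⟩
    set Γ : ℤ → ℝ := fun k => γ (k - a).toNat + (b + v * (k - a).toNat) with hΓ
    have e0 : Γ a = b := by simp [hΓ, h0]
    have en : Γ (a + n) = b + v * n := by simp [hΓ, hn]
    refine ⟨Γ, e0, en, ?_⟩
    rw [action_eq_act φ p ω a b v n Γ e0 en]
    simp [hΓ]

lemma optimalAction_eq {φ : ℝ → ℝ} {p : ℝ} {ω : Config} {a : ℤ} {b v : ℝ} {n : ℕ}
    (hb : BddBelow (bridgeValues (lineField φ ω a b v) p n)) :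
    optimalAction φ p ω a (a + n) b (b + v * n) =
      bridgeAction (lineField φ ω a b v) p n + v ^ 2 / 2 * n := by
  rw [optimalAction, actionValues_eq, bridgeAction]
  exact ((OrderIso.addRight (v ^ 2 / 2 * (n : ℝ))).map_csInf'
    ⟨_, zero_act_mem_bridgeValues _ p n⟩ hb).symm

/-! ### The random bridge action -/

/-- The potential at nonnegative times. -/
noncomputable def field (φ : ℝ → ℝ) (ω : Config) (k : ℕ) (x : ℝ) : ℝ := potential φ ω k x

/-- This turns a change of frame for paths into a transformation of configurations, to which
invariance of the law applies. -/
lemma lineField_eq (φ : ℝ → ℝ) (ω : Config) (a : ℤ) (b v : ℝ) :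
    lineField φ ω a b v = field φ (ω.image (shear a b v)) := by
  ext k x
  have hset : {q : MarkedPoint | q ∈ (ω.image (shear a b v)).points ∧ q.1 = k} =
      shear a b v '' {q | q ∈ ω.points ∧ q.1 = a + k} := by
    ext q
    constructor
    · rintro ⟨⟨q', hq', rfl⟩, hk⟩
      refine ⟨q', ⟨hq', ?_⟩, rfl⟩
      have : q'.1 - a = k := hk
      linarith
    · rintro ⟨q', ⟨hq', hk⟩, rfl⟩
      refine ⟨⟨q', hq', rfl⟩, ?_⟩
      change q'.1 - a = k
      rw [hk]; ring
  rw [field, lineField, potential, potential, hset,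
    finsum_mem_image (shear a b v).injective.injOn]
  refine finsum_mem_congr rfl fun q hq => ?_
  have h1 : q.1 - a = k := by rw [hq.2]; ring
  have h2 : shear a b v q = (q.1 - a, q.2.1 - (b + v * ((q.1 - a : ℤ) : ℝ)), q.2.2) := rfl
  rw [h2, h1]
  simp only [Int.cast_natCast]
  congr 3
  ring

/-- A configuration is nice if it is regular and all path weights are finite. -/
def Config.IsNice (ω : Config) : Prop := ω.IsRegular ∧ ∀ n, pathWeight n ω ≠ ⊤

lemma IsPoissonLaw.ae_isNice {Pξ Pκ : Measure ℝ}
    [IsProbabilityMeasure Pξ] [IsProbabilityMeasure Pκ] (hξ : Pξ (Set.Icc (-1) 1)ᶜ = 0)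
    (hκ : Pκ (Set.Ioc 0 1)ᶜ = 0) {P : Measure Config}
    (hP : IsPoissonLaw P (drivingMeasure Pξ Pκ)) : ∀ᵐ ω ∂P, ω.IsNice := by
  have h : ∀ n, ∀ᵐ ω ∂P, pathWeight n ω < ⊤ := by
    intro n
    refine ae_lt_top (measurable_pathWeight n) ?_
    rw [hP.lintegral_pathWeight hξ hκ]
    exact ENNReal.mul_ne_top (ENNReal.pow_ne_top ENNReal.ofReal_ne_top)
      (ENNReal.pow_ne_top stepWeight_ne_top)
  filter_upwards [hP.ae_isRegular hξ hκ, ae_all_iff.2 h] with ω h1 h2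
  exact ⟨h1, fun n => (h2 n).ne⟩

lemma Config.IsNice.controlled {φ : ℝ → ℝ} (hφ_supp : {x : ℝ | φ x ≠ 0} ⊆ Set.Ioo (-1) 1)
    {K : ℝ} (hK0 : 0 ≤ K) (hK : ∀ x, |φ x| ≤ K) {ω : Config} (hω : ω.IsNice) (n : ℕ) :
    Controlled (field φ ω) n K (excess n ω) := by
  intro γ h0
  calc ∑ k ∈ Finset.range (n + 1), |field φ ω k (γ k)|
      ≤ ∑ k ∈ Finset.range (n + 1), K * (ω.load k ⌊γ k⌋ : ℝ) :=
        Finset.sum_le_sum fun k _ => abs_potential_le hφ_supp hK hω.1 k (γ k)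
    _ = K * ∑ k ∈ Finset.range (n + 1), (ω.load k ⌊γ k⌋ : ℝ) := by rw [Finset.mul_sum]
    _ ≤ _ := mul_le_mul_of_nonneg_left (sum_load_floor_le (hω.2 n) γ h0) hK0

/-- The potential generated at each time by a separate configuration, in a form that depends
measurably on these configurations. -/
noncomputable def shotField (φ : ℝ → ℝ) (x : ℕ → Config) (k : ℕ) (y : ℝ) : ℝ :=
  shotSum (kick φ y) (window k (⌊y⌋ - 1) (⌊y⌋ + 2)) (x k)

lemma measurable_shotSum_kick {φ : ℝ → ℝ} (hφ : Continuous φ) (k : ℕ) (y : ℝ) :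
    Measurable (shotSum (kick φ y) (window k (⌊y⌋ - 1) (⌊y⌋ + 2))) :=
  measurable_shotSum (measurable_kick hφ.measurable y) (isBounded_window _ _ _)
    (measurableSet_window _ _ _)

lemma Config.IsRegular.shotField_eq {φ : ℝ → ℝ} (hφ_supp : {x : ℝ | φ x ≠ 0} ⊆ Set.Ioo (-1) 1)
    {ω : Config} (hω : ω.IsRegular) :
    shotField φ (fun k => ω.slice k) = field φ ω := by
  ext k y
  have hs : (ω.slice k).IsRegular := fun q hq => hω q hq.1
  rw [shotField, ← potential_eq_shotSum hφ_supp hs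
    (by linarith [Int.floor_le y]) (by linarith [Int.lt_floor_add_one y]), potential_slice, field]

lemma measurable_gridAction {α : Type*} [MeasurableSpace α] {φ : ℝ → ℝ} (hφ : Continuous φ)
    {x : α → ℕ → Config} (hx : ∀ k, Measurable (fun a => x a k)) (p : ℝ) (n : ℕ) (D : Finset ℝ) :
    Measurable (fun a => gridAction (shotField φ (x a)) p n D) := by
  unfold gridAction
  refine Measurable.iInf (f := fun (g : Fin n → D) a => act (shotField φ (x a)) p n (gridPath g))
    fun g => ?_
  have h : ∀ (k : ℕ) (y : ℝ), Measurable (fun a => shotField φ (x a) k y) :=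
    fun k y => (measurable_shotSum_kick hφ k y).comp (hx k)
  have h2 : Measurable (fun a => ∑ k ∈ Finset.range n,
      (p * shotField φ (x a) k (gridPath g k) +
        (1 - p) * shotField φ (x a) (k + 1) (gridPath g (k + 1)))) :=
    Finset.measurable_sum _ fun k _ =>
      ((h k (gridPath g k)).const_mul p).add ((h (k + 1) (gridPath g (k + 1))).const_mul (1 - p))
  exact h2.const_add _

section Law

variable {φ : ℝ → ℝ} {K p : ℝ} {ω : Config}

/-- The infimum over uncountably many paths is almost surely a limit of finite grid infima. Here
mesh and interval vary together, so that every optimal bridge is eventually covered. -/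
lemma aemeasurable_bridgeAction (hφ : Continuous φ)
    (hφ_supp : {x : ℝ | φ x ≠ 0} ⊆ Set.Ioo (-1) 1) (hK0 : 0 ≤ K) (hK : ∀ x, |φ x| ≤ K)
    {P : Measure Config} (hnice : ∀ᵐ ω ∂P, ω.IsNice) (hp : p ∈ Set.Icc (0 : ℝ) 1) (n : ℕ) :
    AEMeasurable (fun ω => bridgeAction (field φ ω) p n) P := by
  have hs : ∀ k : ℕ, Measurable (fun ω : Config => ω.slice k) :=
    fun k => Config.measurable_slice k
  have hm : ∀ m : ℕ, Measurable
      (fun ω : Config => gridAction (shotField φ (fun k => ω.slice k)) p n (grid m m)) :=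
    fun m => measurable_gridAction hφ hs p n (grid m m)
  refine aemeasurable_of_tendsto_metrizable_ae Filter.atTop (fun m => (hm m).aemeasurable) ?_
  filter_upwards [hnice] with ω hω
  simp only [hω.1.shotField_eq hφ_supp]
  have hc := hω.controlled hφ_supp hK0 hK n
  have hcont : ∀ k, Continuous (field φ ω k) := fun k => continuous_potential hφ hφ_supp hω.1 k
  obtain ⟨γ, h0, hn, hγ⟩ := hc.exists_minimizer hp hcont
  refine hc.tendsto_gridAction hp hcont h0 hn hγ ?_
  obtain ⟨R, hR⟩ := exists_nat_ge (∑ l ∈ Finset.range n, |γ (l + 1) - γ l|)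
  filter_upwards [Filter.eventually_ge_atTop R] with m hm k hk
  have : (R : ℝ) ≤ m := by exact_mod_cast hm
  linarith [abs_le_sum_increments h0 hk]

/-- Outside an event of large excess, grid actions on a long enough interval converge to the
optimal action. -/
lemma Config.IsNice.tendsto_gridAction (hφ : Continuous φ)
    (hφ_supp : {x : ℝ | φ x ≠ 0} ⊆ Set.Ioo (-1) 1) (hK0 : 0 ≤ K) (hK : ∀ x, |φ x| ≤ K)
    (hω : ω.IsNice) (hp : p ∈ Set.Icc (0 : ℝ) 1) {n r : ℕ} {a : ℝ} (hℓ : excess n ω ≤ a * n)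
    (hr : 4 * (K ^ 2 + 2 * K + 2 * K * a) * n ^ 2 ≤ (r : ℝ) ^ 2) :
    Filter.Tendsto (fun m => gridAction (field φ ω) p n (grid r m)) Filter.atTop
      (nhds (bridgeAction (field φ ω) p n)) := by
  have hc := hω.controlled hφ_supp hK0 hK n
  have hcont : ∀ k, Continuous (field φ ω k) := fun k => continuous_potential hφ hφ_supp hω.1 k
  obtain ⟨γ, h0, hn, hγ⟩ := hc.exists_minimizer hp hcont
  refine hc.tendsto_gridAction (r := fun _ => r) hp hcont h0 hn hγ
    (Filter.Eventually.of_forall fun _ k hk => ?_)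
  have h1 := sq_le_of_kinetic_le h0 hk
  have h2 := hc.kinetic_le hp h0 (hγ _ rfl rfl)
  refine abs_le_of_sq_le_sq (h1.trans ?_) (Nat.cast_nonneg r)
  refine le_trans ?_ hr
  have h3 : K * excess n ω ≤ K * (a * n) := mul_le_mul_of_nonneg_left hℓ hK0
  calc (n : ℝ) * ∑ l ∈ Finset.range n, (γ (l + 1) - γ l) ^ 2
      ≤ n * (4 * ((K ^ 2 + 2 * K) * n + 2 * K * excess n ω)) :=
        mul_le_mul_of_nonneg_left h2 (Nat.cast_nonneg n)
    _ ≤ n * (4 * ((K ^ 2 + 2 * K) * n + 2 * (K * (a * n)))) :=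
        mul_le_mul_of_nonneg_left (by linarith) (Nat.cast_nonneg n)
    _ = _ := by ring

variable {P : Measure Config} {C : ℝ} {n : ℕ}

lemma one_le_pathWeight {ω : Config} (hω : pathWeight n ω ≠ ⊤) :
    1 ≤ (pathWeight n ω).toReal := by
  by_contra h
  have h0 := excess_nonneg hω
  -- Since `Real.log 0 = 0`, a nonnegative excess does not rule out weight zero; the path with zero
  -- increments does, by its positive contribution.
  rcases eq_or_lt_of_le (ENNReal.toReal_nonneg (a := pathWeight n ω)) with h' | h'
  · have h1 := ENNReal.le_tsum (f := fun d : Fin n → ℤ =>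
      (∏ k : Fin (n + 1), ENNReal.ofReal (Real.exp (ω.load k (position d k)))) *
        ∏ l, ENNReal.ofReal (Real.exp (-|(d l : ℝ)|))) (fun _ => 0)
    change _ ≤ pathWeight n ω at h1
    have h2 : pathWeight n ω = 0 :=
      ((ENNReal.toReal_eq_zero_iff _).1 h'.symm).resolve_right hω
    rw [h2, nonpos_iff_eq_zero, mul_eq_zero, Finset.prod_eq_zero_iff,
      Finset.prod_eq_zero_iff] at h1
    simp only [ENNReal.ofReal_eq_zero, (Real.exp_pos _).not_ge, and_false, exists_false,
      or_self] at h1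
  · exact absurd (Real.log_neg h' (not_le.1 h)) (not_lt.2 h0)

lemma exp_excess {ω : Config} (hω : pathWeight n ω ≠ ⊤) :
    Real.exp (excess n ω) = (pathWeight n ω).toReal :=
  Real.exp_log (zero_lt_one.trans_le (one_le_pathWeight hω))

lemma integrable_toReal_pathWeight
    (hW : ∫⁻ ω, pathWeight n ω ∂P ≤ ENNReal.ofReal (Real.exp (C * n))) :
    Integrable (fun ω => (pathWeight n ω).toReal) P :=
  integrable_toReal_of_lintegral_ne_top (measurable_pathWeight n).aemeasurable
    (hW.trans_lt ENNReal.ofReal_lt_top).ne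

lemma integral_toReal_pathWeight_le
    (hW : ∫⁻ ω, pathWeight n ω ∂P ≤ ENNReal.ofReal (Real.exp (C * n))) :
    ∫ ω, (pathWeight n ω).toReal ∂P ≤ Real.exp (C * n) := by
  rw [integral_toReal (measurable_pathWeight n).aemeasurable
    (ae_lt_top (measurable_pathWeight n) (hW.trans_lt ENNReal.ofReal_lt_top).ne)]
  exact ENNReal.toReal_le_of_le_ofReal (Real.exp_pos _).le hW

lemma integrable_excess (hnice : ∀ᵐ ω ∂P, ω.IsNice)
    (hW : ∫⁻ ω, pathWeight n ω ∂P ≤ ENNReal.ofReal (Real.exp (C * n))) :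
    Integrable (excess n) P := by
  refine (integrable_toReal_pathWeight hW).mono' (measurable_excess n).aestronglyMeasurable ?_
  filter_upwards [hnice] with ω hω
  rw [Real.norm_eq_abs, abs_of_nonneg (excess_nonneg (hω.2 n)), ← exp_excess (hω.2 n)]
  linarith [Real.add_one_le_exp (excess n ω)]

/-- Jensen's inequality for the logarithm, by integrating `1 + t ≤ exp t` at `t = excess - C n`. -/
lemma integral_excess_le [IsProbabilityMeasure P] (hnice : ∀ᵐ ω ∂P, ω.IsNice)
    (hW : ∫⁻ ω, pathWeight n ω ∂P ≤ ENNReal.ofReal (Real.exp (C * n))) :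
    ∫ ω, excess n ω ∂P ≤ C * n := by
  have h1 : ∫ ω, excess n ω ∂P ≤
      ∫ ω, ((pathWeight n ω).toReal * Real.exp (-(C * n)) + (C * n - 1)) ∂P := by
    refine integral_mono_ae (integrable_excess hnice hW)
      (((integrable_toReal_pathWeight hW).mul_const _).add (integrable_const _)) ?_
    filter_upwards [hnice] with ω hω
    rw [← exp_excess (hω.2 n), ← Real.exp_add]
    linarith [Real.add_one_le_exp (excess n ω + -(C * n))]
  rw [integral_add ((integrable_toReal_pathWeight hW).mul_const _) (integrable_const _),
    integral_mul_const, integral_const] at h1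
  have h2 : (∫ ω, (pathWeight n ω).toReal ∂P) * Real.exp (-(C * n)) ≤ 1 := by
    calc _ ≤ Real.exp (C * n) * Real.exp (-(C * n)) :=
          mul_le_mul_of_nonneg_right (integral_toReal_pathWeight_le hW) (Real.exp_pos _).le
      _ = 1 := by rw [← Real.exp_add]; simp
  simp only [probReal_univ, one_smul] at h1
  linarith

lemma measureReal_excess_gt_le [IsProbabilityMeasure P] (hnice : ∀ᵐ ω ∂P, ω.IsNice)
    (hW : ∫⁻ ω, pathWeight n ω ∂P ≤ ENNReal.ofReal (Real.exp (C * n))) (a : ℝ) :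
    P.real {ω | a * n < excess n ω} ≤ Real.exp ((C - a) * n) := by
  have h := mul_meas_ge_le_integral_of_nonneg (μ := P)
    (f := fun ω => (pathWeight n ω).toReal)
    (Filter.Eventually.of_forall fun _ => ENNReal.toReal_nonneg)
    (integrable_toReal_pathWeight hW) (Real.exp (a * n))
  have h1 : P.real {ω | a * n < excess n ω} ≤
      P.real {ω | Real.exp (a * n) ≤ (pathWeight n ω).toReal} := by
    refine ENNReal.toReal_mono (measure_ne_top _ _) (measure_mono_ae ?_)
    filter_upwards [hnice] with ω hω hlt
    change Real.exp (a * n) ≤ _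
    rw [← exp_excess (hω.2 n)]
    exact Real.exp_le_exp.2 (le_of_lt hlt)
  have h2 := h.trans (integral_toReal_pathWeight_le hW)
  have h3 : Real.exp ((C - a) * n) = Real.exp (C * n) * Real.exp (-(a * n)) := by
    rw [← Real.exp_add]; congr 1; ring
  rw [h3, Real.exp_neg, ← div_eq_mul_inv, le_div_iff₀ (Real.exp_pos _), mul_comm]
  exact (mul_le_mul_of_nonneg_left h1 (Real.exp_pos _).le).trans h2

end Law

/-! ### Exponential concentration for functions of independent variables -/

/-- A second-order bound valid for unbounded `t`; it plays the role of Hoeffding's lemma when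
increments have only exponential moments. -/
lemma exp_le_one_add_self_add_sq_mul_exp_abs (t : ℝ) :
    Real.exp t ≤ 1 + t + t ^ 2 * Real.exp |t| := by
  have h1 : Real.exp t - 1 ≤ t * Real.exp t := by
    have h := Real.add_one_le_exp (-t)
    have h2 : Real.exp (-t) * Real.exp t = 1 := by rw [← Real.exp_add]; simp
    nlinarith [Real.exp_pos t]
  rcases le_total 0 t with h | h
  · rw [abs_of_nonneg h]
    nlinarith [mul_le_mul_of_nonneg_left h1 h]
  · have h3 : 1 ≤ Real.exp |t| := Real.one_le_exp (abs_nonneg t)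
    have h4 := Real.add_one_le_exp t
    have h5 : t * (Real.exp t - 1) ≤ t * t := by
      refine mul_le_mul_of_nonpos_left ?_ h
      linarith
    nlinarith [sq_nonneg t]

section OneStep

variable {E : Type*} [MeasurableSpace E] {h Z : E → ℝ} {M : ℝ}

lemma integrable_of_integrable_exp_two_mul {ν : Measure E} (hZm : Measurable Z) (hZ0 : ∀ y, 0 ≤ Z y)
    (hZi : Integrable (fun y => Real.exp (2 * Z y)) ν) : Integrable Z ν := by
  refine hZi.mono' hZm.aestronglyMeasurable (Filter.Eventually.of_forall fun y => ?_)
  rw [Real.norm_eq_abs, abs_of_nonneg (hZ0 y)]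
  linarith [Real.add_one_le_exp (2 * Z y), hZ0 y]

variable {ν : Measure E} [IsProbabilityMeasure ν]

lemma exp_two_mul_integral_le (hZ : Integrable Z ν)
    (hZi : Integrable (fun y => Real.exp (2 * Z y)) ν) :
    Real.exp (2 * ∫ y, Z y ∂ν) ≤ ∫ y, Real.exp (2 * Z y) ∂ν := by
  set m := ∫ y, Z y ∂ν with hm
  have hi : Integrable (fun y => 2 * Z y - 2 * m) ν := (hZ.const_mul 2).sub (integrable_const _)
  have h1 : ∫ y, Real.exp (2 * m) * (1 + (2 * Z y - 2 * m)) ∂ν ≤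
      ∫ y, Real.exp (2 * Z y) ∂ν := by
    refine integral_mono (((integrable_const _).add hi).const_mul _) hZi fun y => ?_
    have h2 : Real.exp (2 * Z y) = Real.exp (2 * m) * Real.exp (2 * Z y - 2 * m) := by
      rw [← Real.exp_add]; congr 1; ring
    simp only
    rw [h2]
    exact mul_le_mul_of_nonneg_left (by linarith [Real.add_one_le_exp (2 * Z y - 2 * m)])
      (Real.exp_pos _).le
  rw [integral_const_mul, integral_add (integrable_const _) hi, integral_sub (hZ.const_mul 2)
    (integrable_const _), integral_const_mul, ← hm] at h1
  simpa using h1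

lemma integrable_of_oscillation (hh : Measurable h)
    (hosc : ∀ y y', |h y - h y'| ≤ Z y + Z y') (hZ : Integrable Z ν) : Integrable h ν := by
  obtain ⟨y₀⟩ : Nonempty E := ν.nonempty_of_neZero
  refine ((hZ.add (integrable_const (Z y₀ + |h y₀|)))).mono' hh.aestronglyMeasurable
    (Filter.Eventually.of_forall fun y => ?_)
  have h1 := hosc y y₀
  have h2 := abs_sub_abs_le_abs_sub (h y) (h y₀)
  simp only [Pi.add_apply, Real.norm_eq_abs]
  linarith

/-- Averaging the oscillation bound gives `|h - 𝔼 h| ≤ U` with `U = Z + 𝔼 Z`. In the second-order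
expansion the linear term integrates to zero and `U ^ 2 ≤ 2 exp U` leaves `2 s ^ 2 exp (2 U)`. Its
mean is at most `2 s ^ 2 M ^ 2`, one factor `M` coming from Jensen's inequality for `exp (2 𝔼 Z)`.
-/
lemma lintegral_exp_le_of_oscillation (hh : Measurable h) (hZm : Measurable Z)
    (hZ0 : ∀ y, 0 ≤ Z y) (hosc : ∀ y y', |h y - h y'| ≤ Z y + Z y')
    (hZi : Integrable (fun y => Real.exp (2 * Z y)) ν)
    (hM : ∫ y, Real.exp (2 * Z y) ∂ν ≤ M) {s : ℝ} (hs : |s| ≤ 1) :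
    ∫⁻ y, ENNReal.ofReal (Real.exp (s * (h y - ∫ y, h y ∂ν))) ∂ν ≤
      ENNReal.ofReal (Real.exp (2 * s ^ 2 * M ^ 2)) := by
  have hZ := integrable_of_integrable_exp_two_mul hZm hZ0 hZi
  have hhi := integrable_of_oscillation hh hosc hZ
  set m := ∫ y, h y ∂ν with hm
  set z := ∫ y, Z y ∂ν with hz
  have hdev : ∀ y, |h y - m| ≤ Z y + z := by
    intro y
    have h1 : h y - m = ∫ y', (h y - h y') ∂ν := by
      rw [integral_sub (integrable_const _) hhi]; simp [hm]
    have h2 : Z y + z = ∫ y', (Z y + Z y') ∂ν := by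
      rw [integral_add (integrable_const _) hZ]; simp [hz]
    rw [h1, h2]
    exact (abs_integral_le_integral_abs).trans (integral_mono
      ((integrable_const _).sub hhi).abs ((integrable_const _).add hZ) (fun y' => hosc y y'))
  have hpt : ∀ y, Real.exp (s * (h y - m)) ≤
      1 + s * (h y - m) + 2 * s ^ 2 * Real.exp (2 * z) * Real.exp (2 * Z y) := by
    intro y
    refine (exp_le_one_add_self_add_sq_mul_exp_abs _).trans ?_
    set U := Z y + z with hU
    have hU0 : 0 ≤ U := (abs_nonneg _).trans (hdev y)
    have h1 : |s * (h y - m)| ≤ U := by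
      rw [abs_mul]
      calc |s| * |h y - m| ≤ 1 * U := mul_le_mul hs (hdev y) (abs_nonneg _) zero_le_one
        _ = U := one_mul U
    have h2 : (s * (h y - m)) ^ 2 ≤ s ^ 2 * U ^ 2 := by
      rw [mul_pow]
      refine mul_le_mul_of_nonneg_left ?_ (sq_nonneg s)
      rw [← sq_abs (h y - m)]
      exact pow_le_pow_left₀ (abs_nonneg _) (hdev y) 2
    have h3 : U ^ 2 ≤ 2 * Real.exp U := by
      have := Real.quadratic_le_exp_of_nonneg hU0
      linarith
    have h4 : Real.exp (2 * z) * Real.exp (2 * Z y) = Real.exp U * Real.exp U := by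
      rw [← Real.exp_add, ← Real.exp_add]; congr 1; rw [hU]; ring
    have h5 : (s * (h y - m)) ^ 2 * Real.exp |s * (h y - m)| ≤
        s ^ 2 * (2 * Real.exp U) * Real.exp U := by
      refine mul_le_mul (h2.trans (mul_le_mul_of_nonneg_left h3 (sq_nonneg s)))
        (Real.exp_le_exp.2 h1) (Real.exp_pos _).le (by positivity)
    rw [mul_assoc (2 * s ^ 2), h4]
    linarith
  have hint0 : Integrable (fun y => s * (h y - m)) ν :=
    (hhi.sub (integrable_const _)).const_mul _
  have hint1 : Integrable (fun y => 1 + s * (h y - m)) ν := (integrable_const _).add hint0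
  have hint2 : Integrable (fun y => 2 * s ^ 2 * Real.exp (2 * z) * Real.exp (2 * Z y)) ν :=
    hZi.const_mul _
  have hint3 : Integrable (fun y => 1 + s * (h y - m) +
      2 * s ^ 2 * Real.exp (2 * z) * Real.exp (2 * Z y)) ν := hint1.add hint2
  calc ∫⁻ y, ENNReal.ofReal (Real.exp (s * (h y - m))) ∂ν
      ≤ ∫⁻ y, ENNReal.ofReal (1 + s * (h y - m) +
          2 * s ^ 2 * Real.exp (2 * z) * Real.exp (2 * Z y)) ∂ν :=
        lintegral_mono fun y => ENNReal.ofReal_le_ofReal (hpt y)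
    _ = ENNReal.ofReal (∫ y, (1 + s * (h y - m) +
          2 * s ^ 2 * Real.exp (2 * z) * Real.exp (2 * Z y)) ∂ν) := by
        rw [ofReal_integral_eq_lintegral_ofReal hint3]
        exact Filter.Eventually.of_forall fun y => (Real.exp_pos _).le.trans (hpt y)
    _ ≤ ENNReal.ofReal (Real.exp (2 * s ^ 2 * M ^ 2)) := by
        refine ENNReal.ofReal_le_ofReal ?_
        rw [integral_add hint1 hint2, integral_add (integrable_const _) hint0, integral_const_mul,
          integral_sub hhi (integrable_const _), integral_const_mul, ← hm]
        simp only [integral_const, probReal_univ, one_smul, sub_self, mul_zero, add_zero]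
        have h1 := (exp_two_mul_integral_le hZ hZi).trans hM
        have h2 : Real.exp (2 * z) * ∫ y, Real.exp (2 * Z y) ∂ν ≤ M ^ 2 := by
          rw [sq]
          exact mul_le_mul h1 hM (integral_nonneg fun _ => (Real.exp_pos _).le)
            ((Real.exp_pos _).le.trans h1)
        have h3 := Real.add_one_le_exp (2 * s ^ 2 * M ^ 2)
        have h4 := mul_le_mul_of_nonneg_left h2 (show 0 ≤ 2 * s ^ 2 by positivity)
        rw [← mul_assoc] at h4
        linarith

end OneStep

/-- Exponential concentration for a function of independent variables such that changing the
`i`-th variable from `y` to `y'` changes the value by at most `Z i y + Z i y'`. -/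
theorem lintegral_exp_pi_le {E : Type*} [MeasurableSpace E] {M : ℝ} (n : ℕ)
    (ν : Fin n → Measure E) [∀ i, IsProbabilityMeasure (ν i)] (f : (Fin n → E) → ℝ)
    (hf : Measurable f) (Z : Fin n → E → ℝ) (hZm : ∀ i, Measurable (Z i))
    (hZ0 : ∀ i y, 0 ≤ Z i y) (hZi : ∀ i, Integrable (fun y => Real.exp (2 * Z i y)) (ν i))
    (hM : ∀ i, ∫ y, Real.exp (2 * Z i y) ∂(ν i) ≤ M) (c : ℝ)
    (hfc : ∀ x, |f x| ≤ c + ∑ i, Z i (x i))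
    (hosc : ∀ x i y, |f (Function.update x i y) - f x| ≤ Z i y + Z i (x i))
    {s : ℝ} (hs : |s| ≤ 1) :
    Integrable f (Measure.pi ν) ∧
    ∫⁻ x, ENNReal.ofReal (Real.exp (s * (f x - ∫ x, f x ∂(Measure.pi ν)))) ∂(Measure.pi ν) ≤
      ENNReal.ofReal (Real.exp (2 * s ^ 2 * M ^ 2 * n)) := by
  have hZint : ∀ i, Integrable (Z i) (ν i) := fun i =>
    integrable_of_integrable_exp_two_mul (hZm i) (hZ0 i) (hZi i)
  have hfi : Integrable f (Measure.pi ν) := by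
    have hsum : Integrable (fun x : Fin n → E => c + ∑ i, Z i (x i)) (Measure.pi ν) :=
      (integrable_const _).add (integrable_finsetSum _ fun i _ =>
        (measurePreserving_eval ν i).integrable_comp_of_integrable (hZint i))
    exact hsum.mono' hf.aestronglyMeasurable (Filter.Eventually.of_forall hfc)
  refine ⟨hfi, ?_⟩
  induction n generalizing c with
  | zero =>
    have : ∀ x : Fin 0 → E, f x = ∫ x, f x ∂(Measure.pi ν) := by
      intro x
      have : f = fun _ => f x := by ext y; rw [Subsingleton.elim y x]
      rw [this]; simp
    have h0 : ∀ x, s * (f x - ∫ x, f x ∂(Measure.pi ν)) = 0 := fun x => by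
      rw [← this x, sub_self, mul_zero]
    simp only [h0]
    simp
  | succ n ih =>
    set ν' : Fin n → Measure E := fun i => ν i.succ with hν'
    set F : E × (Fin n → E) → ℝ := fun q => f (Fin.cons q.1 q.2) with hF
    have hcons : Measurable (fun q : E × (Fin n → E) => (Fin.cons q.1 q.2 : Fin (n + 1) → E)) := by
      refine measurable_pi_lambda _ fun i => ?_
      refine Fin.cases ?_ (fun j => ?_) i
      · simpa using measurable_fst
      · simpa [Function.comp_def] using
          (measurable_pi_apply (X := fun _ : Fin n => E) j).comp (measurable_snd (α := E))
    have hFm : Measurable F := hf.comp hcons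
    have hmp : MeasurePreserving (fun q : E × (Fin n → E) => (Fin.cons q.1 q.2 : Fin (n + 1) → E))
        ((ν 0).prod (Measure.pi ν')) (Measure.pi ν) := by
      have := (measurePreserving_piFinSuccAbove ν 0).symm
      have h1 : (fun q : E × (Fin n → E) => (Fin.cons q.1 q.2 : Fin (n + 1) → E)) =
          (MeasurableEquiv.piFinSuccAbove (fun _ => E) 0).symm := by
        ext q i
        simp [MeasurableEquiv.piFinSuccAbove, Fin.insertNthEquiv]
      rw [h1]
      simpa only [Fin.succAbove_zero] using this
    have hFi : Integrable F ((ν 0).prod (Measure.pi ν')) := hmp.integrable_comp_of_integrable hfi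
    -- Averaging out the first variable preserves the oscillation bounds in the others, so the
    -- induction hypothesis controls `g - m`. For fixed remaining variables the one-step bound
    -- controls `F - g`.
    set g : (Fin n → E) → ℝ := fun x => ∫ y, F (y, x) ∂(ν 0) with hg
    have hsl : ∀ x, Measurable (fun y => F (y, x)) := fun x => hFm.comp (by fun_prop)
    have hslosc : ∀ x y y', |F (y, x) - F (y', x)| ≤ Z 0 y + Z 0 y' := by
      intro x y y'
      have := hosc (Fin.cons y' x) 0 y
      rwa [Fin.update_cons_zero, Fin.cons_zero] at this
    have hsli : ∀ x, Integrable (fun y => F (y, x)) (ν 0) := fun x =>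
      integrable_of_oscillation (hsl x) (hslosc x) (hZint 0)
    have hgm : Measurable g := by
      have := (hFm.comp measurable_swap).stronglyMeasurable.integral_prod_right' (ν := ν 0)
      exact this.measurable
    have hgc : ∀ x, |g x| ≤ (c + ∫ y, Z 0 y ∂(ν 0)) + ∑ i, Z i.succ (x i) := by
      intro x
      calc |g x| ≤ ∫ y, |F (y, x)| ∂(ν 0) := abs_integral_le_integral_abs
        _ ≤ ∫ y, (Z 0 y + (c + ∑ i, Z (Fin.succ i) (x i))) ∂(ν 0) := by
            refine integral_mono (hsli x).abs ((hZint 0).add (integrable_const _)) fun y => ?_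
            have := hfc (Fin.cons y x)
            rw [Fin.sum_univ_succ] at this
            simp only [Fin.cons_zero, Fin.cons_succ] at this
            simp only [hF]
            linarith
        _ = _ := by
            rw [integral_add (hZint 0) (integrable_const _)]
            simp only [integral_const, probReal_univ, one_smul]
            ring
    have hgosc : ∀ x i y, |g (Function.update x i y) - g x| ≤ Z i.succ y + Z i.succ (x i) := by
      intro x i y
      rw [hg]
      simp only
      rw [← integral_sub (hsli _) (hsli _)]
      calc |∫ a, (F (a, Function.update x i y) - F (a, x)) ∂(ν 0)|
          ≤ ∫ a, |F (a, Function.update x i y) - F (a, x)| ∂(ν 0) := abs_integral_le_integral_abs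
        _ ≤ ∫ a, (Z i.succ y + Z i.succ (x i)) ∂(ν 0) := by
            refine integral_mono ((hsli _).sub (hsli _)).abs (integrable_const _) fun a => ?_
            have := hosc (Fin.cons a x) i.succ y
            rw [← Fin.cons_update, Fin.cons_succ] at this
            exact this
        _ = _ := by simp
    have hgi : Integrable g (Measure.pi ν') := hFi.swap.integral_prod_left
    have hfg : ∫ x, f x ∂(Measure.pi ν) = ∫ x, g x ∂(Measure.pi ν') := by
      rw [← hmp.map_eq, integral_map hmp.aemeasurable hf.aestronglyMeasurable]
      exact integral_prod_symm F hFi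
    have hih := ih ν' g hgm (fun i => Z i.succ) (fun i => hZm _) (fun i => hZ0 _)
      (fun i => hZi _) (fun i => hM _) (c + ∫ y, Z 0 y ∂(ν 0)) hgc hgosc
      (fun i => hZint _) hgi
    rw [hfg]
    set m := ∫ x, g x ∂(Measure.pi ν') with hm
    have hmeas : Measurable (fun x => ENNReal.ofReal (Real.exp (s * (f x - m)))) := by fun_prop
    have hmeasF : Measurable (fun q => ENNReal.ofReal (Real.exp (s * (F q - m)))) := by fun_prop
    rw [← hmp.map_eq, lintegral_map hmeas hmp.measurable]
    change ∫⁻ q, ENNReal.ofReal (Real.exp (s * (F q - m))) ∂((ν 0).prod (Measure.pi ν')) ≤ _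
    rw [lintegral_prod_symm' _ hmeasF]
    calc ∫⁻ x, ∫⁻ y, ENNReal.ofReal (Real.exp (s * (F (y, x) - m))) ∂(ν 0) ∂(Measure.pi ν')
        ≤ ∫⁻ x, ENNReal.ofReal (Real.exp (2 * s ^ 2 * M ^ 2)) *
            ENNReal.ofReal (Real.exp (s * (g x - m))) ∂(Measure.pi ν') := by
          refine lintegral_mono fun x => ?_
          have hsplit : ∀ y, ENNReal.ofReal (Real.exp (s * (F (y, x) - m))) =
              ENNReal.ofReal (Real.exp (s * (F (y, x) - g x))) *
                ENNReal.ofReal (Real.exp (s * (g x - m))) := by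
            intro y
            rw [← ENNReal.ofReal_mul (Real.exp_pos _).le, ← Real.exp_add]
            congr 2; ring
          simp only [hsplit]
          rw [lintegral_mul_const _ (by fun_prop)]
          exact mul_le_mul_left (lintegral_exp_le_of_oscillation (hsl x) (hZm 0) (hZ0 0)
            (hslosc x) (hZi 0) (hM 0) hs) _
      _ ≤ ENNReal.ofReal (Real.exp (2 * s ^ 2 * M ^ 2)) *
            ENNReal.ofReal (Real.exp (2 * s ^ 2 * M ^ 2 * n)) := by
          rw [lintegral_const_mul _ (by fun_prop)]
          exact mul_le_mul_right hih _
      _ = _ := by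
          rw [← ENNReal.ofReal_mul (Real.exp_pos _).le, ← Real.exp_add]
          congr 2
          push_cast
          ring

/-! ### Concentration of grid actions -/

lemma abs_act_sub_act_le (F G : ℕ → ℝ → ℝ) {p : ℝ} (hp : p ∈ Set.Icc (0 : ℝ) 1) (n : ℕ)
    (γ : ℕ → ℝ) :
    |act F p n γ - act G p n γ| ≤ ∑ k ∈ Finset.range (n + 1), |F k (γ k) - G k (γ k)| := by
  have h := abs_potential_sum_le (F := fun k x => F k x - G k x) hp n γ
  have h2 : act F p n γ - act G p n γ = ∑ k ∈ Finset.range n,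
      (p * (F k (γ k) - G k (γ k)) + (1 - p) * (F (k + 1) (γ (k + 1)) - G (k + 1) (γ (k + 1)))) := by
    rw [act, act, add_sub_add_left_eq_sub, ← Finset.sum_sub_distrib]
    exact Finset.sum_congr rfl fun k _ => by ring
  rw [h2]
  exact h

lemma gridPath_mem {n : ℕ} {D : Finset ℝ} (hD : (0 : ℝ) ∈ D) (g : Fin n → D) (k : ℕ) :
    gridPath g k ∈ D := by
  unfold gridPath
  split_ifs
  · exact (g _).2
  · exact hD

lemma gridAction_le_add {F G : ℕ → ℝ → ℝ} {p : ℝ} (hp : p ∈ Set.Icc (0 : ℝ) 1) {n : ℕ}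
    {D : Finset ℝ} (hD : (0 : ℝ) ∈ D) {b : ℕ → ℝ}
    (hb : ∀ k ≤ n, ∀ y ∈ D, |F k y - G k y| ≤ b k) :
    gridAction F p n D ≤ gridAction G p n D + ∑ k ∈ Finset.range (n + 1), b k := by
  have : Nonempty D := ⟨⟨0, hD⟩⟩
  rw [← sub_le_iff_le_add]
  refine le_ciInf fun g => ?_
  have h1 := gridAction_le F p n g
  have h2 := (le_abs_self _).trans (abs_act_sub_act_le F G hp n (gridPath g))
  have h3 : ∑ k ∈ Finset.range (n + 1), |F k (gridPath g k) - G k (gridPath g k)| ≤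
      ∑ k ∈ Finset.range (n + 1), b k :=
    Finset.sum_le_sum fun k hk =>
      hb k (Nat.lt_succ_iff.1 (Finset.mem_range.1 hk)) _ (gridPath_mem hD g k)
  linarith

lemma abs_gridAction_sub_le {F G : ℕ → ℝ → ℝ} {p : ℝ} (hp : p ∈ Set.Icc (0 : ℝ) 1) {n : ℕ}
    {D : Finset ℝ} (hD : (0 : ℝ) ∈ D) {b : ℕ → ℝ}
    (hb : ∀ k ≤ n, ∀ y ∈ D, |F k y - G k y| ≤ b k) :
    |gridAction F p n D - gridAction G p n D| ≤ ∑ k ∈ Finset.range (n + 1), b k := by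
  have h1 := gridAction_le_add hp hD hb
  have h2 := gridAction_le_add hp hD (F := G) (G := F) (b := b)
    (fun k hk y hy => by rw [abs_sub_comm]; exact hb k hk y hy)
  rw [abs_le]; constructor <;> linarith

/-- The largest load of a cell within distance `r` from the origin. -/
noncomputable def maxLoad (k : ℤ) (r : ℕ) (ω : Config) : ℕ :=
  (Finset.Icc (-(r : ℤ)) r).sup (fun i => ω.load k i)

lemma measurable_maxLoad (k : ℤ) (r : ℕ) : Measurable (maxLoad k r) := by
  have h : ∀ s : Finset ℤ, Measurable (fun ω : Config => s.sup (fun i => ω.load k i)) := by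
    classical
    intro s
    induction s using Finset.induction_on with
    | empty => simp
    | insert a s _ ih => simpa [Finset.sup_insert] using (Config.measurable_load k a).max ih
  exact h _

lemma load_le_maxLoad {ω : Config} (k : ℤ) {i : ℤ} {r : ℕ} (h1 : -(r : ℤ) ≤ i) (h2 : i ≤ r) :
    ω.load k i ≤ maxLoad k r ω :=
  Finset.le_sup (f := fun i => ω.load k i) (Finset.mem_Icc.2 ⟨h1, h2⟩)

/-- The crude bound of a maximum by a sum costs a factor `2 r + 1` in the exponential moment, hence
only a logarithm after rescaling. -/
lemma exp_maxLoad_le (k : ℤ) (r : ℕ) (ω : Config) :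
    ENNReal.ofReal (Real.exp (maxLoad k r ω)) ≤
      ∑ i ∈ Finset.Icc (-(r : ℤ)) r, ENNReal.ofReal (Real.exp (ω.load k i)) := by
  obtain ⟨i, hi, h⟩ := Finset.exists_mem_eq_sup (Finset.Icc (-(r : ℤ)) r)
    ⟨0, by simp⟩ (fun i => ω.load k i)
  rw [maxLoad, h]
  exact Finset.single_le_sum (f := fun i => ENNReal.ofReal (Real.exp (ω.load k i)))
    (fun _ _ => zero_le) hi

lemma load_slice (k : ℤ) (i : ℤ) (ω : Config) : (ω.slice k).load k i = ω.load k i := by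
  rw [Config.load, Config.count_slice, Config.load]
  congr 1
  rw [Set.inter_eq_left]
  rintro q ⟨h, -⟩
  exact h

lemma maxLoad_slice (k : ℤ) (r : ℕ) (ω : Config) : maxLoad k r (ω.slice k) = maxLoad k r ω := by
  simp only [maxLoad, load_slice]

lemma lintegral_exp_maxLoad_le {P : Measure Config}
    (hload : ∀ k i : ℤ, ∫⁻ ω, ENNReal.ofReal (Real.exp (ω.load k i)) ∂P = ENNReal.ofReal loadMoment)
    (k : ℤ) (r : ℕ) :
    ∫⁻ ω, ENNReal.ofReal (Real.exp (maxLoad k r ω)) ∂P ≤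
      ENNReal.ofReal ((2 * r + 1) * loadMoment) := by
  calc ∫⁻ ω, ENNReal.ofReal (Real.exp (maxLoad k r ω)) ∂P
      ≤ ∫⁻ ω, ∑ i ∈ Finset.Icc (-(r : ℤ)) r, ENNReal.ofReal (Real.exp (ω.load k i)) ∂P :=
        lintegral_mono fun ω => exp_maxLoad_le k r ω
    _ = ∑ i ∈ Finset.Icc (-(r : ℤ)) r, ENNReal.ofReal loadMoment := by
        rw [lintegral_finsetSum _ fun i _ => measurable_ofReal_exp_load k i]
        exact Finset.sum_congr rfl fun i _ => hload k i
    _ = ENNReal.ofReal ((2 * r + 1) * loadMoment) := by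
        rw [Finset.sum_const, nsmul_eq_mul, Int.card_Icc, ENNReal.ofReal_mul (by positivity)]
        congr 1
        rw [show ((r : ℤ) + 1 - -(r : ℤ)).toNat = 2 * r + 1 by omega]
        rw [show (2 * (r : ℝ) + 1) = ((2 * r + 1 : ℕ) : ℝ) by push_cast; ring,
          ENNReal.ofReal_natCast]

lemma loadMoment_ge_one : 1 ≤ loadMoment :=
  Real.one_le_exp (by linarith [Real.add_one_le_exp (1 : ℝ)])

/-- A variable with a finite exponential moment `B` has, divided by `L`, an exponential moment
of order `B ^ (1 / L)`. -/
lemma integral_exp_div_le {α : Type*} [MeasurableSpace α] {P : Measure α}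
    [IsProbabilityMeasure P] {X : α → ℝ} (hX : Measurable X) {B L : ℝ}
    (hB : 1 ≤ B) (hL : 1 ≤ L) (h : ∫⁻ a, ENNReal.ofReal (Real.exp (X a)) ∂P ≤ ENNReal.ofReal B) :
    Integrable (fun a => Real.exp (X a / L)) P ∧
      ∫ a, Real.exp (X a / L) ∂P ≤ 2 * Real.exp (Real.log B / L) := by
  have hB0 : 0 < B := by linarith
  have hi : Integrable (fun a => Real.exp (X a)) P := by
    refine ⟨hX.exp.aestronglyMeasurable, ?_⟩
    rw [hasFiniteIntegral_iff_ofReal (Filter.Eventually.of_forall fun _ => (Real.exp_pos _).le)]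
    exact h.trans_lt ENNReal.ofReal_lt_top
  have hle : ∫ a, Real.exp (X a) ∂P ≤ B := by
    rw [integral_eq_lintegral_of_nonneg_ae
      (Filter.Eventually.of_forall fun _ => (Real.exp_pos _).le) hX.exp.aestronglyMeasurable]
    exact ENNReal.toReal_le_of_le_ofReal hB0.le h
  -- After normalization by `B ^ (1 / L)` the exponent is `(X - log B) / L`. If it is nonpositive
  -- its exponential is at most `1`; otherwise dividing by `L ≥ 1` has only decreased it. Adding the
  -- two cases gives the factor `2`.
  have hpt : ∀ a, Real.exp (X a / L) ≤
      Real.exp (Real.log B / L) * (1 + Real.exp (X a) / B) := by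
    intro a
    have h1 : Real.exp (X a) / B = Real.exp (X a - Real.log B) := by
      rw [Real.exp_sub, Real.exp_log hB0]
    have h2 : Real.exp (X a / L) =
        Real.exp (Real.log B / L) * Real.exp ((X a - Real.log B) / L) := by
      rw [← Real.exp_add]; congr 1; ring
    rw [h1, h2]
    refine mul_le_mul_of_nonneg_left ?_ (Real.exp_pos _).le
    rcases le_total (X a - Real.log B) 0 with h | h
    · have : Real.exp ((X a - Real.log B) / L) ≤ 1 :=
        Real.exp_le_one_iff.2 (div_nonpos_of_nonpos_of_nonneg h (by linarith))
      linarith [Real.exp_pos (X a - Real.log B)]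
    · have := Real.exp_le_exp.2 (div_le_self h hL)
      linarith
  have hi2 : Integrable (fun a => Real.exp (Real.log B / L) * (1 + Real.exp (X a) / B)) P :=
    ((integrable_const _).add (hi.div_const B)).const_mul _
  have hi1 : Integrable (fun a => Real.exp (X a / L)) P :=
    hi2.mono' ((hX.div_const L).exp.aestronglyMeasurable) (Filter.Eventually.of_forall fun a => by
      rw [Real.norm_eq_abs, abs_of_pos (Real.exp_pos _)]; exact hpt a)
  refine ⟨hi1, (integral_mono hi1 hi2 hpt).trans ?_⟩
  rw [integral_const_mul, integral_add (integrable_const _) (hi.div_const B), integral_div]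
  simp only [integral_const, probReal_univ, one_smul]
  have : (∫ a, Real.exp (X a) ∂P) / B ≤ 1 := (div_le_one hB0).2 hle
  nlinarith [Real.exp_pos (Real.log B / L)]

lemma abs_shotField_le {φ : ℝ → ℝ} {K : ℝ} (hK0 : 0 ≤ K) (hK : ∀ x, |φ x| ≤ K)
    (x : ℕ → Config) (k : ℕ) {y : ℝ} {r : ℕ} (hy : |y| ≤ r) :
    |shotField φ x k y| ≤ K * maxLoad k r (x k) := by
  refine (abs_shotSum_kick_le hK (x k) k _ _ y).trans (mul_le_mul_of_nonneg_left ?_ hK0)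
  have h1 : -(r : ℤ) ≤ ⌊y⌋ := Int.le_floor.2 (by push_cast; exact (abs_le.1 hy).1)
  have h2 : ⌊y⌋ ≤ r := by
    have := (Int.floor_le y).trans (abs_le.1 hy).2
    exact_mod_cast this
  exact Nat.cast_le.2 (load_le_maxLoad (ω := x k) k h1 h2)

/-- The grid action as a function of the configurations at times `0, …, n`. -/
noncomputable def sliceGridAction (φ : ℝ → ℝ) (p : ℝ) (n r m : ℕ) (x : Fin (n + 1) → Config) : ℝ :=
  -- The action involves times `0, …, n` only, so the choice `x 0` at later times is immaterial.
  gridAction (shotField φ (fun k => if h : k < n + 1 then x ⟨k, h⟩ else x 0)) p n (grid r m)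

lemma measurable_sliceGridAction {φ : ℝ → ℝ} (hφ : Continuous φ) (p : ℝ) (n r m : ℕ) :
    Measurable (sliceGridAction φ p n r m) := by
  have h : ∀ k : ℕ, Measurable (fun x : Fin (n + 1) → Config =>
      if h : k < n + 1 then x ⟨k, h⟩ else x 0) := by
    intro k
    by_cases h : k < n + 1
    · simpa [h] using measurable_pi_apply _
    · simpa [h] using measurable_pi_apply _
  exact measurable_gridAction hφ h p n (grid r m)

lemma sliceGridAction_slice {φ : ℝ → ℝ} (hφ_supp : {x : ℝ | φ x ≠ 0} ⊆ Set.Ioo (-1) 1) {ω : Config}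
    (hω : ω.IsRegular) (p : ℝ) (n r m : ℕ) :
    sliceGridAction φ p n r m (fun k => ω.slice k) = gridAction (field φ ω) p n (grid r m) := by
  rw [sliceGridAction, gridAction, gridAction]
  refine iInf_congr fun g => act_congr (fun _ _ => rfl) fun k hk => ?_
  rw [← hω.shotField_eq hφ_supp]
  simp [shotField, Nat.lt_succ_iff.2 hk]

/-- The field changes at time `i` only, and a grid path visits that time at a single point of `[-r,
r]`. -/
lemma abs_sliceGridAction_update_sub_le {φ : ℝ → ℝ} {K p : ℝ} (hK0 : 0 ≤ K)
    (hK : ∀ x, |φ x| ≤ K) (hp : p ∈ Set.Icc (0 : ℝ) 1) {n r m : ℕ} (x : Fin (n + 1) → Config)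
    (i : Fin (n + 1)) (y : Config) :
    |sliceGridAction φ p n r m (Function.update x i y) - sliceGridAction φ p n r m x| ≤
      K * (maxLoad i r y + maxLoad i r (x i)) := by
  have h := abs_gridAction_sub_le hp (zero_mem_grid r m) (n := n)
    (F := shotField φ (fun k => if h : k < n + 1 then Function.update x i y ⟨k, h⟩ else
      Function.update x i y 0))
    (G := shotField φ (fun k => if h : k < n + 1 then x ⟨k, h⟩ else x 0))
    (b := fun k => if k = i then K * (maxLoad i r y + maxLoad i r (x i)) else 0) ?_
  · refine h.trans_eq ?_
    rw [Finset.sum_ite_eq' (Finset.range (n + 1)) (i : ℕ), if_pos (Finset.mem_range.2 i.2)]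
  · intro k hk z hz
    have hk' : k < n + 1 := Nat.lt_succ_iff.2 hk
    by_cases hki : k = i
    · subst hki
      simp only [if_true]
      have h1 := abs_shotField_le hK0 hK (fun k => if h : k < n + 1 then
        Function.update x i y ⟨k, h⟩ else Function.update x i y 0) i (abs_le_of_mem_grid hz)
      have h2 := abs_shotField_le hK0 hK (fun k => if h : k < n + 1 then x ⟨k, h⟩ else x 0) i
        (abs_le_of_mem_grid hz)
      simp only [hk', dif_pos, Fin.eta, Function.update_self] at h1 h2
      rw [mul_add]
      exact (abs_sub _ _).trans (add_le_add h1 h2)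
    · have hne : (⟨k, hk'⟩ : Fin (n + 1)) ≠ i := fun h => hki (by rw [← h])
      simp [shotField, hk', hki, Function.update_of_ne hne]

lemma abs_sliceGridAction_le {φ : ℝ → ℝ} {K p : ℝ} (hK0 : 0 ≤ K)
    (hK : ∀ x, |φ x| ≤ K) (hp : p ∈ Set.Icc (0 : ℝ) 1) {n r m : ℕ} (x : Fin (n + 1) → Config) :
    |sliceGridAction φ p n r m x| ≤
      |gridAction (fun _ _ => 0) p n (grid r m)| + ∑ i : Fin (n + 1), K * maxLoad i r (x i) := by
  set x' : ℕ → Config := fun k => if h : k < n + 1 then x ⟨k, h⟩ else x 0 with hx'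
  have h := abs_gridAction_sub_le hp (zero_mem_grid r m) (n := n)
    (F := shotField φ x') (G := fun _ _ => 0) (b := fun k => K * maxLoad k r (x' k))
    (fun k hk z hz => by
      rw [sub_zero]; exact abs_shotField_le hK0 hK x' k (abs_le_of_mem_grid hz))
  have h2 : ∑ k ∈ Finset.range (n + 1), K * (maxLoad k r (x' k) : ℝ) =
      ∑ i : Fin (n + 1), K * maxLoad i r (x i) := by
    rw [← Fin.sum_univ_eq_sum_range (fun k => K * (maxLoad k r (x' k) : ℝ))]
    refine Finset.sum_congr rfl fun i _ => ?_
    simp only [hx', i.2, dif_pos, Fin.eta]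
  rw [h2] at h
  have h3 := abs_sub_abs_le_abs_sub (sliceGridAction φ p n r m x)
    (gridAction (fun _ _ => 0) p n (grid r m))
  change |sliceGridAction φ p n r m x - _| ≤ _ at h
  linarith

/-- Exponential moments of grid actions. -/
theorem lintegral_exp_gridAction_le {φ : ℝ → ℝ} {K p : ℝ} (hφ : Continuous φ) (hK1 : 0 < K)
    (hK : ∀ x, |φ x| ≤ K) (hp : p ∈ Set.Icc (0 : ℝ) 1)
    {P : Measure Config} [IsProbabilityMeasure P]
    (hind : iIndepFun Config.slice P)
    (hload : ∀ k i : ℤ, ∫⁻ ω, ENNReal.ofReal (Real.exp (ω.load k i)) ∂P = ENNReal.ofReal loadMoment)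
    {n r m : ℕ} {L : ℝ} (hL : 1 ≤ L) {s : ℝ} (hs : |s| ≤ 1) :
    Integrable (fun ω => sliceGridAction φ p n r m (fun k => ω.slice k)) P ∧
    ∫⁻ ω, ENNReal.ofReal (Real.exp (s * ((sliceGridAction φ p n r m (fun k => ω.slice k) -
      ∫ ω, sliceGridAction φ p n r m (fun k => ω.slice k) ∂P) / (2 * K * L)))) ∂P ≤
      ENNReal.ofReal (Real.exp (2 * s ^ 2 *
        (2 * Real.exp (Real.log ((2 * r + 1) * loadMoment) / L)) ^ 2 * (n + 1))) := by
  have hKL : 0 < 2 * K * L := by positivity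
  set X : Config → Fin (n + 1) → Config := fun ω k => ω.slice k with hX
  have hXm : Measurable X := measurable_pi_lambda _ fun k => Config.measurable_slice _
  set ν : Fin (n + 1) → Measure Config := fun k => P.map (Config.slice k) with hν
  have hνp : ∀ k, IsProbabilityMeasure (ν k) := fun k =>
    Measure.isProbabilityMeasure_map (Config.measurable_slice _).aemeasurable
  have hlaw : P.map X = Measure.pi ν := by
    have hinj : Function.Injective (fun k : Fin (n + 1) => ((k : ℕ) : ℤ)) := fun a b h =>
      Fin.ext (Nat.cast_injective h)
    exact (iIndepFun_iff_map_fun_eq_pi_map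
      (fun k : Fin (n + 1) => (Config.measurable_slice (k : ℕ)).aemeasurable)).1
      (hind.precomp hinj)
  set f : (Fin (n + 1) → Config) → ℝ := fun x => sliceGridAction φ p n r m x / (2 * K * L) with hf
  have hfm : Measurable f := (measurable_sliceGridAction hφ p n r m).div_const _
  -- Division by `2 K L` is chosen so that `exp (2 Z)` becomes `exp (maxLoad / L)`, whose moment is
  -- bounded by `integral_exp_div_le`.
  set Z : Fin (n + 1) → Config → ℝ := fun i ω => (maxLoad i r ω : ℝ) / (2 * L) with hZ
  have hcast : Measurable (fun n : ℕ => (n : ℝ)) := measurable_from_top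
  have hmL : ∀ i : Fin (n + 1), Measurable (fun ω => (maxLoad i r ω : ℝ)) :=
    fun i => hcast.comp (measurable_maxLoad _ r)
  have hB : 1 ≤ (2 * (r : ℝ) + 1) * loadMoment := by
    have h1 := loadMoment_ge_one
    have h2 : (0 : ℝ) ≤ r := Nat.cast_nonneg r
    nlinarith
  have hexp : ∀ (i : Fin (n + 1)) (ω : Config),
      Real.exp (2 * Z i ω) = Real.exp ((maxLoad i r ω : ℝ) / L) := by
    intro i ω
    congr 1
    simp only [hZ]
    field_simp
  have hmom : ∀ i : Fin (n + 1), Integrable (fun ω => Real.exp (2 * Z i ω)) (ν i) ∧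
      ∫ ω, Real.exp (2 * Z i ω) ∂(ν i) ≤
        2 * Real.exp (Real.log ((2 * r + 1) * loadMoment) / L) := by
    intro i
    simp only [hexp]
    refine integral_exp_div_le (hmL i) hB hL ?_
    rw [hν, lintegral_map ((hmL i).exp.ennreal_ofReal) (Config.measurable_slice _)]
    simp only [maxLoad_slice]
    exact lintegral_exp_maxLoad_le hload _ r
  have hmain := lintegral_exp_pi_le (n + 1) ν f hfm Z (fun i => (hmL i).div_const _)
    (fun i ω => by positivity) (fun i => (hmom i).1) (fun i => (hmom i).2)
    (|gridAction (fun _ _ => 0) p n (grid r m)| / (2 * K * L)) ?_ ?_ hs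
  · rw [← hlaw] at hmain
    obtain ⟨h1, h2⟩ := hmain
    rw [integrable_map_measure hfm.aestronglyMeasurable hXm.aemeasurable] at h1
    rw [lintegral_map (by fun_prop) hXm,
      integral_map hXm.aemeasurable hfm.aestronglyMeasurable] at h2
    have h3 : Integrable (fun ω => sliceGridAction φ p n r m (X ω)) P := by
      have := h1.mul_const (2 * K * L)
      refine this.congr (Filter.Eventually.of_forall fun ω => ?_)
      simp only [Function.comp, hf]
      field_simp
    refine ⟨h3, ?_⟩
    simp only [hf, integral_div] at h2
    have h4 : ∀ ω, (sliceGridAction φ p n r m (X ω) -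
        ∫ ω, sliceGridAction φ p n r m (X ω) ∂P) / (2 * K * L) =
        sliceGridAction φ p n r m (X ω) / (2 * K * L) -
        (∫ ω, sliceGridAction φ p n r m (X ω) ∂P) / (2 * K * L) := fun ω => sub_div _ _ _
    simp only [hX] at h4 h2 ⊢
    simp only [h4]
    refine h2.trans_eq ?_
    push_cast
    rfl
  · intro x
    have h := abs_sliceGridAction_le hK1.le hK hp (n := n) (r := r) (m := m) x
    simp only [hf, hZ]
    rw [abs_div, abs_of_pos hKL, div_le_iff₀ hKL, add_mul, div_mul_cancel₀ _ hKL.ne',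
      Finset.sum_mul]
    refine h.trans (add_le_add le_rfl (Finset.sum_le_sum fun i _ => le_of_eq ?_))
    field_simp
  · intro x i y
    have h := abs_sliceGridAction_update_sub_le hK1.le hK hp (n := n) (r := r) (m := m) x i y
    simp only [hf, hZ]
    rw [← sub_div, abs_div, abs_of_pos hKL, div_le_iff₀ hKL]
    refine h.trans_eq ?_
    field_simp

/-! ### Concentration of the optimal action around its mean -/

/-- The facts about the shape `φ` and the law `P` on which the concentration argument is based. -/
structure ShotNoise (φ : ℝ → ℝ) (K p C : ℝ) (P : Measure Config) : Prop where
  cont : Continuous φ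
  supp : {x : ℝ | φ x ≠ 0} ⊆ Set.Ioo (-1) 1
  one_le_bound : 1 ≤ K
  bound : ∀ x, |φ x| ≤ K
  weight : p ∈ Set.Icc (0 : ℝ) 1
  nice : ∀ᵐ ω ∂P, ω.IsNice
  indep : iIndepFun Config.slice P
  load : ∀ k i : ℤ, ∫⁻ ω, ENNReal.ofReal (Real.exp (ω.load k i)) ∂P = ENNReal.ofReal loadMoment
  shear : ∀ (a : ℤ) (b v : ℝ), MeasurePreserving (Config.image (shear a b v)) P P
  one_le_rate : 1 ≤ C
  growth : ∀ n : ℕ, 1 ≤ n → ∫⁻ ω, pathWeight n ω ∂P ≤ ENNReal.ofReal (Real.exp (C * n))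

/-- The optimal action of bridges from `(0, 0)` to `(n, 0)`. -/
noncomputable def bridge (φ : ℝ → ℝ) (p : ℝ) (n : ℕ) (ω : Config) : ℝ :=
  bridgeAction (field φ ω) p n

section Concentration

variable {φ : ℝ → ℝ} {K p C : ℝ} {P : Measure Config} {n : ℕ}

lemma ShotNoise.controlled (h : ShotNoise φ K p C P) {ω : Config} (hω : ω.IsNice) (n : ℕ) :
    Controlled (field φ ω) n K (excess n ω) :=
  hω.controlled h.supp (zero_le_one.trans h.one_le_bound) h.bound n

lemma ShotNoise.aemeasurable_bridge (h : ShotNoise φ K p C P) (n : ℕ) :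
    AEMeasurable (bridge φ p n) P :=
  aemeasurable_bridgeAction h.cont h.supp (zero_le_one.trans h.one_le_bound) h.bound h.nice
    h.weight n

lemma ShotNoise.abs_bridge_le (h : ShotNoise φ K p C P) {ω : Config} (hω : ω.IsNice) (n : ℕ) :
    |bridge φ p n ω| ≤ K * excess n ω + (K ^ 2 + K) * n := by
  have h1 := (h.controlled hω n).le_bridgeAction h.weight
  have h2 := (h.controlled hω n).bridgeAction_le_bound h.weight
  have h3 : 0 ≤ K ^ 2 * n := by positivity
  rw [bridge, abs_le]
  constructor <;> linarith

lemma ShotNoise.integrable_bridge [IsProbabilityMeasure P] (h : ShotNoise φ K p C P) (hn : 1 ≤ n) :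
    Integrable (bridge φ p n) P := by
  refine (((integrable_excess h.nice (h.growth n hn)).const_mul K).add
    (integrable_const ((K ^ 2 + K) * n))).mono' (h.aemeasurable_bridge n).aestronglyMeasurable ?_
  filter_upwards [h.nice] with ω hω
  exact h.abs_bridge_le hω n

lemma ShotNoise.le_integral_bridge [IsProbabilityMeasure P] (h : ShotNoise φ K p C P) (hn : 1 ≤ n) :
    -(K ^ 2 + K + K * C) * n ≤ ∫ ω, bridge φ p n ω ∂P := by
  have hi := integrable_excess h.nice (h.growth n hn)
  have h1 : ∫ ω, (-(K ^ 2 + K) * n - K * excess n ω) ∂P ≤ ∫ ω, bridge φ p n ω ∂P := by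
    refine integral_mono_ae ((integrable_const _).sub (hi.const_mul K)) (h.integrable_bridge hn) ?_
    filter_upwards [h.nice] with ω hω
    exact (h.controlled hω n).le_bridgeAction h.weight
  rw [integral_sub (integrable_const _) (hi.const_mul K), integral_const_mul K] at h1
  simp only [integral_const, probReal_univ, one_smul] at h1
  have h2 := integral_excess_le h.nice (h.growth n hn)
  have h3 := mul_le_mul_of_nonneg_left h2 (zero_le_one.trans h.one_le_bound)
  linarith

/-- The grid approximation of the bridge action, as a measurable function. -/
noncomputable def gridBridge (φ : ℝ → ℝ) (p : ℝ) (n r m : ℕ) (ω : Config) : ℝ :=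
  sliceGridAction φ p n r m (fun k => ω.slice k)

lemma ShotNoise.measurable_gridBridge (h : ShotNoise φ K p C P) (n r m : ℕ) :
    Measurable (gridBridge φ p n r m) := by
  have hX : Measurable (fun (ω : Config) (k : Fin (n + 1)) => ω.slice k) :=
    measurable_pi_lambda _ fun k => Config.measurable_slice _
  exact (measurable_sliceGridAction h.cont p n r m).comp hX

/-- The zero path lies in the grid, so the grid action is at most the action of the zero path, while
the bridge action has the lower bound for controlled fields. The estimate is independent of the grid
and serves as the dominating function. -/
lemma ShotNoise.gridBridge_sub_bridge (h : ShotNoise φ K p C P) {ω : Config} (hω : ω.IsNice)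
    (n r m : ℕ) : 0 ≤ gridBridge φ p n r m ω - bridge φ p n ω ∧
      gridBridge φ p n r m ω - bridge φ p n ω ≤ 2 * K * excess n ω + (K ^ 2 + 2 * K) * n := by
  have hc := h.controlled hω n
  have h0 := hc.le_bridgeAction h.weight
  have h1 := hc.bridgeAction_le_gridAction h.weight (zero_mem_grid r m)
  have h2 := (gridAction_le_zero (field φ ω) p n (zero_mem_grid r m)).trans
    (hc.act_zero_le h.weight)
  rw [gridBridge, sliceGridAction_slice h.supp hω.1, bridge]
  constructor <;> linarith

/-- From `t ≤ 2 exp (t / 2)` and `t / 2 ≤ t - a n / 2`. It bounds the mean of the excess over the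
event of large excess by an exponential moment. -/
lemma excess_le_of_lt {ω : Config} (hω : ω.IsNice) {a : ℝ} (ha : a * n < excess n ω) :
    excess n ω ≤ 2 * ((pathWeight n ω).toReal * Real.exp (-(a * n / 2))) := by
  rw [← exp_excess (hω.2 n), ← Real.exp_add]
  have h1 := Real.add_one_le_exp (excess n ω / 2)
  have h2 : Real.exp (excess n ω / 2) ≤ Real.exp (excess n ω + -(a * n / 2)) :=
    Real.exp_le_exp.2 (by linarith)
  linarith

/-- The mean of a fine grid approximation on a long enough interval is within a bounded distance
of the mean of the bridge action, and the approximation is good with high probability. -/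
lemma ShotNoise.exists_gridBridge [IsProbabilityMeasure P] (h : ShotNoise φ K p C P) (hn : 1 ≤ n) {r : ℕ}
    (hr : 4 * (K ^ 2 + 2 * K + 2 * K * (2 * C + 2)) * n ^ 2 ≤ (r : ℝ) ^ 2) :
    ∃ m : ℕ,
      P.real {ω | excess n ω ≤ (2 * C + 2) * n ∧ 1 ≤ |gridBridge φ p n r m ω - bridge φ p n ω|} ≤
        Real.exp (-n) ∧
      |∫ ω, gridBridge φ p n r m ω ∂P - ∫ ω, bridge φ p n ω ∂P| ≤ 1 + 2 * (K ^ 2 + 4 * K) := by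
  have hK0 : 0 ≤ K := zero_le_one.trans h.one_le_bound
  -- `excess_le_of_lt` discounts only by `a n / 2 = (C + 1) n`; against the growth `exp (C n)` this
  -- still leaves `exp (-n)`.
  set a : ℝ := 2 * C + 2 with ha
  set G : Set Config := {ω | excess n ω ≤ a * n} with hG
  have hGm : MeasurableSet G := measurable_excess n measurableSet_Iic
  set d : ℕ → Config → ℝ := fun m => G.indicator
    (fun ω => gridBridge φ p n r m ω - bridge φ p n ω) with hd
  have hdm : ∀ m, AEStronglyMeasurable (d m) P := fun m =>
    (((h.measurable_gridBridge n r m).aemeasurable.sub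
      (h.aemeasurable_bridge n)).aestronglyMeasurable.indicator hGm)
  have hlim : ∀ᵐ ω ∂P, Filter.Tendsto (fun m => d m ω) Filter.atTop (nhds 0) := by
    filter_upwards [h.nice] with ω hω
    by_cases hωG : ω ∈ G
    · have h1 := hω.tendsto_gridAction (n := n) (r := r) h.cont h.supp hK0 h.bound h.weight hωG hr
      have h2 := h1.sub_const (bridge φ p n ω)
      simp only [hd, Set.indicator_of_mem hωG, gridBridge, sliceGridAction_slice h.supp hω.1]
      simpa [bridge] using h2
    · simp [hd, hωG]
  have hbi : Integrable (fun ω => 2 * K * excess n ω + (K ^ 2 + 2 * K) * n) P :=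
    ((integrable_excess h.nice (h.growth n hn)).const_mul (2 * K)).add (integrable_const _)
  have hdle : ∀ m, ∀ᵐ ω ∂P, ‖d m ω‖ ≤ 2 * K * excess n ω + (K ^ 2 + 2 * K) * n := by
    intro m
    filter_upwards [h.nice] with ω hω
    obtain ⟨h1, h2⟩ := h.gridBridge_sub_bridge hω n r m
    by_cases hωG : ω ∈ G
    · simp only [hd, Set.indicator_of_mem hωG]
      rwa [Real.norm_eq_abs, abs_of_nonneg h1]
    · simp only [hd, Set.indicator_of_notMem hωG, norm_zero]
      linarith
  -- On the good event, dominated convergence handles the mean and convergence in measure the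
  -- probability; a single `m` is then chosen for both.
  have hint : Filter.Tendsto (fun m => ∫ ω, d m ω ∂P) Filter.atTop (nhds 0) := by
    have := tendsto_integral_of_dominated_convergence _ hdm hbi hdle hlim
    simpa using this
  have hmeas := tendstoInMeasure_of_tendsto_ae hdm hlim
  rw [tendstoInMeasure_iff_measureReal_norm] at hmeas
  have hmeas1 := hmeas 1 one_pos
  have he := hmeas1.eventually_le_const (Real.exp_pos (-(n : ℝ)))
  have he2 := hint.eventually_le_const (one_pos (α := ℝ))
  obtain ⟨m, hm1, hm2⟩ := (he.and he2).exists
  refine ⟨m, ?_, ?_⟩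
  · refine le_trans (measureReal_mono ?_) hm1
    rintro ω ⟨h1, h2⟩
    have hωG : ω ∈ G := h1
    change 1 ≤ ‖d m ω - 0‖
    simp only [hd, Set.indicator_of_mem hωG, sub_zero]
    exact h2
  · set D : Config → ℝ := fun ω => gridBridge φ p n r m ω - bridge φ p n ω with hD
    have hDm : AEStronglyMeasurable D P := ((h.measurable_gridBridge n r m).aemeasurable.sub
      (h.aemeasurable_bridge n)).aestronglyMeasurable
    have hDi : Integrable D P := by
      refine hbi.mono' hDm ?_
      filter_upwards [h.nice] with ω hω
      obtain ⟨h1, h2⟩ := h.gridBridge_sub_bridge hω n r m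
      rwa [Real.norm_eq_abs, abs_of_nonneg h1]
    have hgi : Integrable (gridBridge φ p n r m) P := by
      refine (hDi.add (h.integrable_bridge hn)).congr (Filter.Eventually.of_forall fun ω => ?_)
      simp [hD]
    have hW := integrable_toReal_pathWeight (h.growth n hn)
    have hDle : ∫ ω, D ω ∂P ≤ ∫ ω, (d m ω + (K ^ 2 + 4 * K) *
        (2 * ((pathWeight n ω).toReal * Real.exp (-(a * n / 2))))) ∂P := by
      have hdi : Integrable (d m) P := hDi.indicator hGm
      refine integral_mono_ae hDi
        (hdi.add (((hW.mul_const _).const_mul 2).const_mul _)) ?_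
      filter_upwards [h.nice] with ω hω
      obtain ⟨h1, h2⟩ := h.gridBridge_sub_bridge hω n r m
      by_cases hωG : ω ∈ G
      · simp only [hd, Set.indicator_of_mem hωG, hD]
        have : 0 ≤ (K ^ 2 + 4 * K) *
          (2 * ((pathWeight n ω).toReal * Real.exp (-(a * n / 2)))) := by positivity
        linarith
      · have hlt : a * n < excess n ω := not_le.1 hωG
        have h3 := excess_le_of_lt hω hlt
        have h4 : (n : ℝ) ≤ excess n ω := by
          have : (1 : ℝ) ≤ a := by rw [ha]; linarith [h.one_le_rate]
          nlinarith [(Nat.cast_nonneg n : (0 : ℝ) ≤ n)]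
        simp only [hd, Set.indicator_of_notMem hωG, hD, zero_add]
        have h5 := mul_le_mul_of_nonneg_left h4 (show 0 ≤ K ^ 2 + 2 * K by positivity)
        have h6 := mul_le_mul_of_nonneg_left h3 (show 0 ≤ K ^ 2 + 4 * K by positivity)
        linarith
    have hdi : Integrable (d m) P := hDi.indicator hGm
    rw [integral_add hdi (((hW.mul_const _).const_mul 2).const_mul _), integral_const_mul,
      integral_const_mul, integral_mul_const] at hDle
    have hW1 : (∫ ω, (pathWeight n ω).toReal ∂P) * Real.exp (-(a * n / 2)) ≤ 1 := by
      calc _ ≤ Real.exp (C * n) * Real.exp (-(a * n / 2)) :=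
            mul_le_mul_of_nonneg_right (integral_toReal_pathWeight_le (h.growth n hn))
              (Real.exp_pos _).le
        _ = Real.exp (-n) := by rw [← Real.exp_add]; congr 1; rw [ha]; ring
        _ ≤ 1 := Real.exp_le_one_iff.2 (by simp)
    have hD0 : 0 ≤ ∫ ω, D ω ∂P := by
      refine integral_nonneg_of_ae ?_
      filter_upwards [h.nice] with ω hω
      exact (h.gridBridge_sub_bridge hω n r m).1
    rw [← integral_sub hgi (h.integrable_bridge hn)]
    change |∫ ω, D ω ∂P| ≤ _
    rw [abs_of_nonneg hD0]
    have h7 := mul_le_mul_of_nonneg_left hW1 (show 0 ≤ (K ^ 2 + 4 * K) * 2 by positivity)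
    linarith

lemma measureReal_le_abs_of_lintegral_exp {Y : Config → ℝ} (hY : Measurable Y) {s B : ℝ}
    (hB : 0 ≤ B)
    (h1 : ∫⁻ ω, ENNReal.ofReal (Real.exp (s * Y ω)) ∂P ≤ ENNReal.ofReal B)
    (h2 : ∫⁻ ω, ENNReal.ofReal (Real.exp (-s * Y ω)) ∂P ≤ ENNReal.ofReal B) (hs : 0 ≤ s) (t : ℝ) :
    P.real {ω | t ≤ |Y ω|} ≤ 2 * B * Real.exp (-(s * t)) := by
  have key : ∀ s' : ℝ, ∫⁻ ω, ENNReal.ofReal (Real.exp (s' * Y ω)) ∂P ≤ ENNReal.ofReal B →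
      P {ω | s * t ≤ s' * Y ω} ≤ ENNReal.ofReal (B * Real.exp (-(s * t))) := by
    intro s' hs'
    have h3 := meas_ge_le_lintegral_div (μ := P)
      (f := fun ω => ENNReal.ofReal (Real.exp (s' * Y ω)))
      (by fun_prop) (ε := ENNReal.ofReal (Real.exp (s * t)))
      (by simpa using Real.exp_pos _) ENNReal.ofReal_ne_top
    have h4 : {ω | s * t ≤ s' * Y ω} ⊆
        {ω | ENNReal.ofReal (Real.exp (s * t)) ≤ ENNReal.ofReal (Real.exp (s' * Y ω))} :=
      fun ω hω => ENNReal.ofReal_le_ofReal (Real.exp_le_exp.2 hω)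
    refine (measure_mono h4).trans (h3.trans ?_)
    rw [Real.exp_neg, ← div_eq_mul_inv, ENNReal.ofReal_div_of_pos (Real.exp_pos _)]
    exact ENNReal.div_le_div_right hs' _
  have hsub : {ω | t ≤ |Y ω|} ⊆ {ω | s * t ≤ s * Y ω} ∪ {ω | s * t ≤ -s * Y ω} := by
    intro ω hω
    have hω' : t ≤ |Y ω| := hω
    have h5 := mul_le_mul_of_nonneg_left hω' hs
    rcases le_total 0 (Y ω) with h | h
    · left; rw [abs_of_nonneg h] at h5; exact h5
    · right; rw [abs_of_nonpos h] at h5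
      change s * t ≤ -s * Y ω
      linarith
  have h6 : P {ω | t ≤ |Y ω|} ≤ ENNReal.ofReal (2 * B * Real.exp (-(s * t))) := by
    refine (measure_mono hsub).trans ((measure_union_le _ _).trans
      ((add_le_add (key s h1) (key (-s) h2)).trans_eq ?_))
    rw [← ENNReal.ofReal_add (by positivity) (by positivity)]
    congr 1; ring
  exact ENNReal.toReal_le_of_le_ofReal (by positivity) h6

lemma one_le_log {n : ℕ} (hn : 3 ≤ n) : 1 ≤ Real.log n := by
  rw [Real.le_log_iff_exp_le (by positivity)]
  have : (3 : ℝ) ≤ n := by exact_mod_cast hn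
  linarith [Real.exp_one_lt_d9]

set_option maxHeartbeats 800000 in
/-- The optimal action concentrates exponentially around its mean. -/
theorem ShotNoise.exists_concentration [IsProbabilityMeasure P] (h : ShotNoise φ K p C P) :
    ∃ c₁ c₂ : ℝ, 0 < c₁ ∧ 0 < c₂ ∧ ∀ n : ℕ, 3 ≤ n → ∀ u : ℝ,
      u ≤ n * (Real.sqrt n * Real.log n) →
      P.real {ω | u < |bridge φ p n ω - ∫ ω, bridge φ p n ω ∂P|} ≤
        c₁ * Real.exp (-c₂ * (u / (Real.sqrt n * Real.log n))) := by
  have hK1 := h.one_le_bound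
  have hK0 : 0 < K := zero_lt_one.trans_le hK1
  have hC1 := h.one_le_rate
  -- Optimal bridges whose excess is at most `(2 C + 2) n` stay within distance `R n` of the origin.
  obtain ⟨R, hR⟩ := exists_nat_ge (4 * (K ^ 2 + 2 * K + 2 * K * (2 * C + 2)))
  set B₀ : ℝ := (2 * R + 1) * loadMoment with hB₀
  have hB₀1 : 1 ≤ B₀ := by
    have h1 := loadMoment_ge_one
    have h2 : (0 : ℝ) ≤ R := Nat.cast_nonneg R
    nlinarith
  set M : ℝ := 2 * Real.exp (1 + Real.log B₀) with hM
  set κ : ℝ := 1 + 2 * (K ^ 2 + 4 * K) with hκ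
  refine ⟨2 + 2 * Real.exp (4 * M ^ 2) * Real.exp ((1 + κ) / (2 * K)), 1 / (2 * K), by positivity,
    by positivity, fun n hn u hu => ?_⟩
  have hn1 : 1 ≤ n := by omega
  have hn0 : (0 : ℝ) < n := by exact_mod_cast hn1
  have hnR : (1 : ℝ) ≤ n := by exact_mod_cast hn1
  set L := Real.log n with hL
  have hL1 : 1 ≤ L := one_le_log hn
  set q := Real.sqrt n with hq
  have hq1 : 1 ≤ q := Real.one_le_sqrt.2 hnR
  have hqL : 1 ≤ q * L := by nlinarith
  have hqL0 : 0 < q * L := by linarith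
  set T := u / (q * L) with hT
  have hTn : T ≤ n := (div_le_iff₀ hqL0).2 hu
  set r := R * n with hr
  have hr' : 4 * (K ^ 2 + 2 * K + 2 * K * (2 * C + 2)) * n ^ 2 ≤ (r : ℝ) ^ 2 := by
    have h1 : (1 : ℝ) ≤ R := by
      have : (0 : ℝ) ≤ K * (2 * C + 2) := by positivity
      nlinarith
    rw [hr]; push_cast
    rw [mul_pow]
    refine mul_le_mul_of_nonneg_right (hR.trans ?_) (sq_nonneg _)
    nlinarith
  obtain ⟨m, hm1, hm2⟩ := h.exists_gridBridge hn1 hr'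
  set g := gridBridge φ p n r m with hg
  set eg := ∫ ω, g ω ∂P with heg
  set eb := ∫ ω, bridge φ p n ω ∂P with heb
  have hgm : Measurable g := h.measurable_gridBridge n r m
  -- The maximum over about `n` cells costs `log n + log B₀`; scaling by `L = log n` makes this
  -- bounded. This is the origin of the logarithm in the tail bound.
  have hMle : 2 * Real.exp (Real.log ((2 * (r : ℝ) + 1) * loadMoment) / L) ≤ M := by
    have h0 := loadMoment_ge_one
    have h1 : (2 * (r : ℝ) + 1) * loadMoment ≤ n * B₀ := by
      rw [hr, hB₀]; push_cast
      have : (2 * (R * n : ℝ) + 1) ≤ n * (2 * R + 1) := by linarith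
      nlinarith
    have h2 := Real.log_le_log (by positivity) h1
    rw [Real.log_mul hn0.ne' (by positivity)] at h2
    have h3 : Real.log ((2 * (r : ℝ) + 1) * loadMoment) / L ≤ 1 + Real.log B₀ := by
      rw [div_le_iff₀ (by linarith)]
      have h4 := Real.log_nonneg hB₀1
      nlinarith
    rw [hM]
    exact mul_le_mul_of_nonneg_left (Real.exp_le_exp.2 h3) zero_le_two
  -- The scale `s = ± 1 / √n` compensates the `n + 1` independent variables.
  have hexp : ∀ s : ℝ, s ^ 2 = 1 / n →
      ∫⁻ ω, ENNReal.ofReal (Real.exp (s * ((g ω - eg) / (2 * K * L)))) ∂P ≤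
        ENNReal.ofReal (Real.exp (4 * M ^ 2)) := by
    intro s hs
    have hs1 : |s| ≤ 1 := by
      rw [← sq_le_one_iff_abs_le_one, hs, div_le_one hn0]; exact hnR
    refine (lintegral_exp_gridAction_le h.cont hK0 h.bound h.weight h.indep h.load hL1 hs1).2.trans
      (ENNReal.ofReal_le_ofReal (Real.exp_le_exp.2 ?_))
    rw [hs]
    have h1 : (2 * Real.exp (Real.log ((2 * (r : ℝ) + 1) * loadMoment) / L)) ^ 2 ≤ M ^ 2 :=
      pow_le_pow_left₀ (by positivity) hMle 2
    have h2 : 2 * (1 / (n : ℝ)) * (n + 1) ≤ 4 := by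
      rw [mul_one_div, div_mul_eq_mul_div, div_le_iff₀ hn0]; linarith
    calc _ = (2 * (1 / (n : ℝ)) * (n + 1)) *
          (2 * Real.exp (Real.log ((2 * (r : ℝ) + 1) * loadMoment) / L)) ^ 2 := by ring
      _ ≤ 4 * M ^ 2 := mul_le_mul h2 h1 (sq_nonneg _) (by norm_num)
  have hqs : (1 / q) ^ 2 = 1 / (n : ℝ) := by
    rw [div_pow, one_pow, hq, Real.sq_sqrt hn0.le]
  have htail := measureReal_le_abs_of_lintegral_exp (P := P) (Y := fun ω => (g ω - eg) / (2 * K * L))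
    ((hgm.sub_const eg).div_const _) (Real.exp_pos _).le (hexp (1 / q) hqs)
    (hexp (-(1 / q)) (by rw [neg_sq, hqs])) (by positivity) ((u - 1 - κ) / (2 * K * L))
  have hexcess := measureReal_excess_gt_le h.nice (h.growth n hn1) (2 * C + 2)
  have hexcess' : P.real {ω | (2 * C + 2) * n < excess n ω} ≤ Real.exp (-n) :=
    hexcess.trans (Real.exp_le_exp.2 (by nlinarith))
  -- Outside the first two events the approximation error is below `1`, and the means differ by at
  -- most `κ`, so the grid action must deviate by at least `u - 1 - κ`.
  have hsub : {ω | u < |bridge φ p n ω - eb|} ⊆ ({ω | (2 * C + 2) * n < excess n ω} ∪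
      {ω | excess n ω ≤ (2 * C + 2) * n ∧ 1 ≤ |g ω - bridge φ p n ω|}) ∪
      {ω | (u - 1 - κ) / (2 * K * L) ≤ |(g ω - eg) / (2 * K * L)|} := by
    intro ω hω
    by_contra hcon
    simp only [Set.mem_union, Set.mem_ofPred_eq, not_or, not_and, not_lt, not_le] at hcon
    obtain ⟨⟨h1, h2⟩, h3⟩ := hcon
    have h4 := h2 h1
    rw [abs_div, abs_of_pos (show 0 < 2 * K * L by positivity),
      div_lt_div_iff_of_pos_right (by positivity)] at h3
    have hω' : u < |bridge φ p n ω - eb| := hω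
    have h5 : |bridge φ p n ω - eb| ≤ |g ω - bridge φ p n ω| + |g ω - eg| + |eg - eb| := by
      have e1 := abs_le.1 (le_refl |g ω - bridge φ p n ω|)
      have e2 := abs_le.1 (le_refl |g ω - eg|)
      have e3 := abs_le.1 (le_refl |eg - eb|)
      rw [abs_le]; constructor <;> linarith [e1.1, e1.2, e2.1, e2.2, e3.1, e3.2]
    linarith
  have hfin := (measureReal_mono (μ := P) hsub).trans ((measureReal_union_le _ _).trans
    (add_le_add ((measureReal_union_le _ _).trans (add_le_add hexcess' hm1)) htail))
  -- The upper limit on `u` enters here: it gives `T ≤ n`, so the `exp (-n)` errors fit under the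
  -- claimed tail.
  have hexpn : Real.exp (-(n : ℝ)) ≤ Real.exp (-(1 / (2 * K)) * T) := by
    refine Real.exp_le_exp.2 ?_
    have h1 : 1 / (2 * K) ≤ 1 := (div_le_one (by positivity)).2 (by linarith)
    have h0 : 0 < 1 / (2 * K) := by positivity
    nlinarith
  have hlast : Real.exp (-(1 / q * ((u - 1 - κ) / (2 * K * L)))) ≤
      Real.exp ((1 + κ) / (2 * K)) * Real.exp (-(1 / (2 * K)) * T) := by
    rw [← Real.exp_add]
    refine Real.exp_le_exp.2 ?_
    have hκ0 : 0 ≤ 1 + κ := by positivity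
    have e1 : -(1 / q * ((u - 1 - κ) / (2 * K * L))) =
        (1 + κ) / (2 * K) * (1 / (q * L)) + -(1 / (2 * K)) * T := by
      rw [hT]; field_simp; ring
    rw [e1]
    have e2 : 1 / (q * L) ≤ 1 := (div_le_one hqL0).2 hqL
    have e3 : 0 ≤ (1 + κ) / (2 * K) := by positivity
    linarith [mul_le_mul_of_nonneg_left e2 e3]
  have hE := mul_le_mul_of_nonneg_left hlast (show 0 ≤ 2 * Real.exp (4 * M ^ 2) by positivity)
  linarith

end Concentration

/-! ### Splitting and gluing of paths -/

lemma act_add (F : ℕ → ℝ → ℝ) (p : ℝ) (m n : ℕ) (γ : ℕ → ℝ) :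
    act F p (m + n) γ = act F p m γ + act (fun k => F (m + k)) p n (fun k => γ (m + k)) := by
  simp only [act, Finset.sum_range_add, add_assoc]
  ring

lemma act_update_last (F : ℕ → ℝ → ℝ) (p : ℝ) (m : ℕ) (γ : ℕ → ℝ) (y : ℝ) :
    act F p (m + 1) (Function.update γ (m + 1) y) = act F p (m + 1) γ +
      (1 / 2) * ((y - γ m) ^ 2 - (γ (m + 1) - γ m) ^ 2) +
      (1 - p) * (F (m + 1) y - F (m + 1) (γ (m + 1))) := by
  have h1 : act F p m (Function.update γ (m + 1) y) = act F p m γ :=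
    act_congr (fun k hk => Function.update_of_ne (by omega) _ _) (fun _ _ => rfl)
  rw [act_add, act_add F p m 1 γ, h1]
  simp [act, Function.update_of_ne]
  ring

lemma act_update_first (F : ℕ → ℝ → ℝ) (p : ℝ) (m : ℕ) (γ : ℕ → ℝ) (y : ℝ) :
    act F p (m + 1) (Function.update γ 0 y) = act F p (m + 1) γ +
      (1 / 2) * ((γ 1 - y) ^ 2 - (γ 1 - γ 0) ^ 2) + p * (F 0 y - F 0 (γ 0)) := by
  have h1 : (fun k => Function.update γ 0 y (1 + k)) = fun k => γ (1 + k) := by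
    ext k; exact Function.update_of_ne (by omega) _ _
  rw [add_comm m 1, act_add, act_add F p 1 m γ, h1]
  simp [act, Function.update_of_ne]
  ring

lemma half_sq_sub_sq_le {x y a : ℝ} (h : |y - x| ≤ 1) :
    (1 / 2) * ((y - a) ^ 2 - (x - a) ^ 2) ≤ |x - a| + 1 / 2 := by
  have h1 : (y - x) * (x - a) ≤ |x - a| := by
    calc (y - x) * (x - a) ≤ |(y - x) * (x - a)| := le_abs_self _
      _ = |y - x| * |x - a| := abs_mul _ _
      _ ≤ 1 * |x - a| := mul_le_mul_of_nonneg_right h (abs_nonneg _)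
      _ = |x - a| := one_mul _
  have h2 : (y - x) ^ 2 ≤ 1 := by
    rw [← sq_abs]
    exact pow_le_one₀ (abs_nonneg _) h
  nlinarith

lemma field_image_shear (φ : ℝ → ℝ) (ω : Config) (a : ℕ) (b v : ℝ) :
    field φ (ω.image (shear a b v)) = fun k x => field φ ω (a + k) (b + v * k + x) := by
  rw [← lineField_eq]
  ext k x
  simp [lineField, field]

section Doubling

variable {φ : ℝ → ℝ} {K p C : ℝ} {P : Measure Config} {n : ℕ}

lemma ShotNoise.exists_minimizer (h : ShotNoise φ K p C P) {ω : Config} (hω : ω.IsNice) (n : ℕ) :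
    ∃ γ : ℕ → ℝ, γ 0 = 0 ∧ γ n = 0 ∧ act (field φ ω) p n γ = bridge φ p n ω := by
  obtain ⟨γ, h0, hn, hγ⟩ := ((h.controlled hω n).isLeast h.weight
    (fun k => continuous_potential h.cont h.supp hω.1 k)).1
  exact ⟨γ, h0, hn, hγ.symm⟩

lemma ShotNoise.bridge_le_act (h : ShotNoise φ K p C P) {ω : Config} (hω : ω.IsNice) {γ : ℕ → ℝ}
    (h0 : γ 0 = 0) (hn : γ n = 0) : bridge φ p n ω ≤ act (field φ ω) p n γ :=
  (h.controlled hω n).bridgeAction_le h.weight h0 hn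

/-- The shear correction `v ^ 2 / 2 * n` is nonnegative and can be dropped, since doubling only
needs upper bounds for the two halves. -/
lemma ShotNoise.bridge_image_le_act (h : ShotNoise φ K p C P) {ω : Config} {a : ℕ} {b v : ℝ}
    (hω : (ω.image (KickedBurgers.shear a b v)).IsNice) {γ : ℕ → ℝ}
    (h0 : γ 0 = b) (hn : γ n = b + v * n) :
    bridge φ p n (ω.image (KickedBurgers.shear a b v)) ≤
      act (fun k => field φ ω (a + k)) p n γ := by
  rw [act_line _ p b v n γ h0 hn]
  have h1 := h.bridge_le_act hω (n := n) (γ := fun k => γ k - (b + v * k)) (by simp [h0])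
    (by simp [hn])
  rw [field_image_shear] at h1
  have : 0 ≤ v ^ 2 / 2 * n := by positivity
  linarith

/-- Subadditivity of the bridge action. -/
lemma ShotNoise.bridge_add_le (h : ShotNoise φ K p C P) {ω : Config} (hω : ω.IsNice) (m n : ℕ)
    (hω' : (ω.image (KickedBurgers.shear m 0 0)).IsNice) :
    bridge φ p (m + n) ω ≤
      bridge φ p m ω + bridge φ p n (ω.image (KickedBurgers.shear m 0 0)) := by
  obtain ⟨γ, h0, hm, hγ⟩ := h.exists_minimizer hω m
  obtain ⟨γ', h0', hn', hγ'⟩ := h.exists_minimizer hω' n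
  have h1 := h.bridge_le_act hω (n := m + n)
    (γ := fun k => if k ≤ m then γ k else γ' (k - m)) (by simp [h0]) (by
      rcases Nat.eq_zero_or_pos n with rfl | hn
      · simp [hm]
      · simp [hn', hn.ne'])
  rw [act_add] at h1
  have e1 : act (field φ ω) p m (fun k => if k ≤ m then γ k else γ' (k - m)) =
      act (field φ ω) p m γ := act_congr (fun k hk => by simp [hk]) (fun _ _ => rfl)
  have e2 : act (fun k => field φ ω (m + k)) p n
      (fun k => if m + k ≤ m then γ (m + k) else γ' (m + k - m)) =
      act (field φ (ω.image (KickedBurgers.shear m 0 0))) p n γ' := by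
    rw [field_image_shear]
    refine act_congr (fun k _ => ?_) (fun k _ => by simp)
    rcases Nat.eq_zero_or_pos k with rfl | hk
    · simp [hm, h0']
    · simp [hk.ne']
  rw [e1, e2, hγ, hγ'] at h1
  exact h1

/-- The optimal bridge of length `2 n` passes, up to small changes, through a lattice point at
time `n`. -/
lemma ShotNoise.exists_le_bridge_two_mul (h : ShotNoise φ K p C P) {ω : Config} (hω : ω.IsNice)
    (hn : 1 ≤ n) {H : ℝ} (hH : 8 * (K ^ 2 + 2 * K + 2 * K * (2 * C + 2)) ≤ H) {r : ℕ}
    (hr : 2 * H * n + 1 ≤ r)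
    (hshear : ∀ (a : ℕ) (b v : ℤ),
      (ω.image (KickedBurgers.shear a b ((v : ℝ) / n))).IsNice)
    (hexc : excess (n + n) ω ≤ (2 * C + 2) * (n + n)) :
    ∃ i ∈ Finset.Icc (-(r : ℤ)) r,
      bridge φ p n (ω.image (KickedBurgers.shear (0 : ℕ) ((0 : ℤ) : ℝ) ((i : ℝ) / n))) +
        bridge φ p n (ω.image (KickedBurgers.shear n i (((-i : ℤ) : ℝ) / n))) ≤
      bridge φ p (n + n) ω + (2 * H * Real.sqrt n + 1 + 2 * K * maxLoad n r ω) := by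
  have hK1 := h.one_le_bound
  have hK0 : 0 ≤ K := zero_le_one.trans hK1
  have hC1 := h.one_le_rate
  have hnR : (1 : ℝ) ≤ n := by exact_mod_cast hn
  have hn0 : (n : ℝ) ≠ 0 := by positivity
  have hH1 : 1 ≤ H := by
    have : 0 ≤ K * (2 * C + 2) := by positivity
    nlinarith
  obtain ⟨γ, h0, h2n, hγ⟩ := h.exists_minimizer hω (n + n)
  have hkin := (h.controlled hω (n + n)).kinetic_le h.weight h0
    (hγ.le.trans (h.bridge_le_act hω rfl rfl))
  have hkin' : ∑ k ∈ Finset.range (n + n), (γ (k + 1) - γ k) ^ 2 ≤ H * n := by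
    refine hkin.trans ?_
    push_cast
    have h1 := mul_le_mul_of_nonneg_left hexc (show 0 ≤ 8 * K by positivity)
    have h2 := mul_le_mul_of_nonneg_right hH (Nat.cast_nonneg n : (0 : ℝ) ≤ n)
    nlinarith
  -- A single increment is bounded by the whole kinetic energy. The resulting order `√n` is exactly
  -- the error that can be afforded when moving the midpoint.
  have hstep : ∀ k < n + n, |γ (k + 1) - γ k| ≤ H * Real.sqrt n := by
    intro k hk
    have h1 : (γ (k + 1) - γ k) ^ 2 ≤ H * n :=
      (Finset.single_le_sum (f := fun k => (γ (k + 1) - γ k) ^ 2) (fun _ _ => sq_nonneg _)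
        (Finset.mem_range.2 hk)).trans hkin'
    refine abs_le_of_sq_le_sq (h1.trans ?_) (by positivity)
    rw [mul_pow, Real.sq_sqrt (Nat.cast_nonneg n)]
    exact mul_le_mul_of_nonneg_right (by nlinarith) (Nat.cast_nonneg n)
  set x := γ n with hx
  have hxr : |x| ≤ 2 * H * n := by
    have h1 := sq_le_of_kinetic_le h0 (show n ≤ n + n by omega)
    refine abs_le_of_sq_le_sq (h1.trans ?_) (by positivity)
    push_cast
    have h2 := mul_le_mul_of_nonneg_left hkin' (show (0 : ℝ) ≤ n + n by positivity)
    refine h2.trans ?_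
    nlinarith [sq_nonneg (n : ℝ), mul_le_mul_of_nonneg_right hH1 (sq_nonneg (n : ℝ)),
      mul_nonneg (show 0 ≤ H * (H - 1) by nlinarith) (sq_nonneg (n : ℝ))]
  -- With this rounding `x` and `i` lie in the same unit cell, so the same load bounds the field at
  -- both. The halves then have endpoints on lines of slopes `i / n` and `-i / n`.
  set i := ⌊x⌋ with hi
  have hfl1 := Int.floor_le x
  have hfl2 := Int.lt_floor_add_one x
  obtain ⟨hx1, hx2⟩ := abs_le.1 hxr
  have hi1 : -(r : ℤ) ≤ i := by
    rw [hi, Int.le_floor]; push_cast; linarith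
  have hi2 : i ≤ r := by
    have : (i : ℝ) ≤ r := by linarith
    exact_mod_cast this
  have hix : |(i : ℝ) - x| ≤ 1 := by
    rw [abs_le]; constructor <;> linarith
  refine ⟨i, Finset.mem_Icc.2 ⟨hi1, hi2⟩, ?_⟩
  obtain ⟨m, rfl⟩ : ∃ m, n = m + 1 := ⟨n - 1, by omega⟩
  have hsplit := act_add (field φ ω) p (m + 1) (m + 1) γ
  have hA := h.bridge_image_le_act (hshear 0 0 i) (n := m + 1)
    (γ := Function.update γ (m + 1) i) (by simp [Function.update_of_ne, h0])
    (by rw [Function.update_self]; field_simp; push_cast; ring)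
  have hB := h.bridge_image_le_act (hshear (m + 1) i (-i)) (n := m + 1)
    (γ := Function.update (fun k => γ (m + 1 + k)) 0 i) (by simp)
    (by rw [Function.update_of_ne (by omega), h2n]; field_simp; push_cast; ring)
  simp only [zero_add] at hA
  rw [act_update_last] at hA
  rw [act_update_first] at hB
  have hq1 := half_sq_sub_sq_le (a := γ m) hix
  have hq2 := half_sq_sub_sq_le (a := γ (m + 1 + 1)) hix
  have hs1 := hstep m (by omega)
  have hs2 := hstep (m + 1) (by omega)
  rw [abs_sub_comm] at hs2
  have hF1 : |field φ ω (m + 1) x| ≤ K * maxLoad (m + 1 : ℕ) r ω := by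
    refine (abs_potential_le h.supp h.bound hω.1 _ x).trans (mul_le_mul_of_nonneg_left ?_ hK0)
    exact Nat.cast_le.2 (load_le_maxLoad _ hi1 hi2)
  have hF2 : |field φ ω (m + 1) i| ≤ K * maxLoad (m + 1 : ℕ) r ω := by
    refine (abs_potential_le h.supp h.bound hω.1 _ (i : ℝ)).trans
      (mul_le_mul_of_nonneg_left ?_ hK0)
    rw [Int.floor_intCast]
    exact Nat.cast_le.2 (load_le_maxLoad _ hi1 hi2)
  have hF3 := abs_le.1 hF1
  have hF4 := abs_le.1 hF2
  rw [← hγ, hsplit]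
  simp only [add_zero] at hB
  rw [← hx] at hA hB
  have e1 : (γ (m + 1 + 1) - (i : ℝ)) ^ 2 = ((i : ℝ) - γ (m + 1 + 1)) ^ 2 := by ring
  have e2 : (γ (m + 1 + 1) - x) ^ 2 = (x - γ (m + 1 + 1)) ^ 2 := by ring
  rw [e1, e2] at hB
  linarith [hF3.1, hF4.2]

end Doubling

/-! ### Means of the optimal action -/

section Means

variable {φ : ℝ → ℝ} {K p C : ℝ} {P : Measure Config} {n : ℕ}

lemma bridge_zero (φ : ℝ → ℝ) (p : ℝ) (ω : Config) : bridge φ p 0 ω = 0 := by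
  have : bridgeValues (field φ ω) p 0 = {0} := by
    ext t
    constructor
    · rintro ⟨γ, -, -, rfl⟩; simp [act]
    · rintro rfl; exact ⟨fun _ => 0, rfl, rfl, by simp [act]⟩
  rw [bridge, bridgeAction, this, csInf_singleton]

lemma ShotNoise.integrable_bridge' [IsProbabilityMeasure P] (h : ShotNoise φ K p C P) (n : ℕ) :
    Integrable (bridge φ p n) P := by
  rcases Nat.eq_zero_or_pos n with rfl | hn
  · simpa only [funext (bridge_zero φ p)] using integrable_const (0 : ℝ)
  · exact h.integrable_bridge hn

lemma ShotNoise.integrable_bridge_image [IsProbabilityMeasure P] (h : ShotNoise φ K p C P)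
    (n : ℕ) (a : ℤ) (b v : ℝ) :
    Integrable (fun ω => bridge φ p n (ω.image (KickedBurgers.shear a b v))) P :=
  (h.shear a b v).integrable_comp_of_integrable (h.integrable_bridge' n)

lemma ShotNoise.integral_bridge_image (h : ShotNoise φ K p C P) (n : ℕ) (a : ℤ) (b v : ℝ) :
    ∫ ω, bridge φ p n (ω.image (KickedBurgers.shear a b v)) ∂P = ∫ ω, bridge φ p n ω ∂P := by
  have hT := h.shear a b v
  conv_rhs => rw [← hT.map_eq]
  rw [integral_map hT.aemeasurable]
  rw [hT.map_eq]
  exact (h.aemeasurable_bridge n).aestronglyMeasurable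

lemma ShotNoise.ae_isNice_image (h : ShotNoise φ K p C P) (a : ℤ) (b v : ℝ) :
    ∀ᵐ ω ∂P, (ω.image (KickedBurgers.shear a b v)).IsNice :=
  (h.shear a b v).quasiMeasurePreserving.ae h.nice

/-- The mean action of bridges is subadditive. -/
lemma ShotNoise.subadditive [IsProbabilityMeasure P] (h : ShotNoise φ K p C P) :
    Subadditive (fun n => ∫ ω, bridge φ p n ω ∂P) := by
  intro m n
  change ∫ ω, bridge φ p (m + n) ω ∂P ≤ (∫ ω, bridge φ p m ω ∂P) + ∫ ω, bridge φ p n ω ∂P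
  rw [← h.integral_bridge_image n m 0 0, ← integral_add (h.integrable_bridge' m)
    (h.integrable_bridge_image n m 0 0)]
  refine integral_mono_ae (h.integrable_bridge' _)
    ((h.integrable_bridge' m).add (h.integrable_bridge_image n m 0 0)) ?_
  filter_upwards [h.nice, h.ae_isNice_image m 0 0] with ω hω hω'
  exact h.bridge_add_le hω m n hω'

lemma ShotNoise.bddBelow_rates [IsProbabilityMeasure P] (h : ShotNoise φ K p C P) :
    BddBelow (Set.range fun n : ℕ => (∫ ω, bridge φ p n ω ∂P) / n) := by
  refine ⟨-(K ^ 2 + K + K * C), ?_⟩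
  rintro _ ⟨n, rfl⟩
  have hK := zero_le_one.trans h.one_le_bound
  have hC := zero_le_one.trans h.one_le_rate
  -- At length zero the quotient is `0` by convention, and the proposed lower bound is nonpositive.
  rcases Nat.eq_zero_or_pos n with rfl | hn
  · simp only [Nat.cast_zero, div_zero]
    linarith [sq_nonneg K, mul_nonneg hK hC]
  · have hn0 : (0 : ℝ) < n := by exact_mod_cast hn
    simp only
    rw [le_div_iff₀ hn0]
    exact h.le_integral_bridge hn

lemma ShotNoise.measureReal_image [IsProbabilityMeasure P] (h : ShotNoise φ K p C P)
    (n : ℕ) (a : ℤ) (b v t e : ℝ) :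
    P.real {ω | t < |bridge φ p n (ω.image (KickedBurgers.shear a b v)) - e|} =
      P.real {ω | t < |bridge φ p n ω - e|} := by
  have hT := h.shear a b v
  have hS : NullMeasurableSet {ω | t < |bridge φ p n ω - e|} P :=
    nullMeasurableSet_lt aemeasurable_const
      (continuous_abs.measurable.comp_aemeasurable ((h.aemeasurable_bridge n).sub_const e))
  exact congrArg ENNReal.toReal (hT.measure_preimage hS)

lemma measureReal_maxLoad_le [IsProbabilityMeasure P] (h : ShotNoise φ K p C P) (k : ℤ) (r : ℕ)
    (t : ℝ) :
    P.real {ω | t < maxLoad k r ω} ≤ (2 * r + 1) * loadMoment * Real.exp (-t) := by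
  have hB : 0 ≤ (2 * (r : ℝ) + 1) * loadMoment := by
    have := loadMoment_ge_one
    positivity
  have hm : Measurable (fun ω => ENNReal.ofReal (Real.exp (maxLoad k r ω))) :=
    (measurable_from_top (f := fun n : ℕ => ENNReal.ofReal (Real.exp n))).comp
      (measurable_maxLoad k r)
  have h3 := meas_ge_le_lintegral_div (μ := P) hm.aemeasurable (ε := ENNReal.ofReal (Real.exp t))
    (by simpa using Real.exp_pos _) ENNReal.ofReal_ne_top
  have h4 : {ω | t < maxLoad k r ω} ⊆
      {ω | ENNReal.ofReal (Real.exp t) ≤ ENNReal.ofReal (Real.exp (maxLoad k r ω))} :=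
    fun ω hω => ENNReal.ofReal_le_ofReal (Real.exp_le_exp.2 (le_of_lt hω))
  refine ENNReal.toReal_le_of_le_ofReal (by positivity) ((measure_mono h4).trans (h3.trans ?_))
  rw [Real.exp_neg, ← div_eq_mul_inv, ENNReal.ofReal_div_of_pos (Real.exp_pos _)]
  exact ENNReal.div_le_div_right (lintegral_exp_maxLoad_le h.load k r) _

/-- Deviations of order `√n log² n` have polynomially small probability. -/
lemma ShotNoise.exists_tail [IsProbabilityMeasure P] (h : ShotNoise φ K p C P) :
    ∃ (c τ N : ℝ), 0 < c ∧ 0 < τ ∧ ∀ k : ℕ, 3 ≤ k → N ≤ k →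
      P.real {ω | τ * (Real.sqrt k * Real.log k ^ 2) <
        |bridge φ p k ω - ∫ ω, bridge φ p k ω ∂P|} ≤ c / (k : ℝ) ^ 3 := by
  obtain ⟨c₁, c₂, hc₁, hc₂, hconc⟩ := h.exists_concentration
  -- With this choice the exponent of the concentration bound is exactly `-3 log k`.
  set τ : ℝ := 3 / c₂ with hτ
  have hτ0 : 0 < τ := by positivity
  -- Needed to keep the deviation `τ √k log² k` within the range where concentration is available.
  have hlogle : ∀ x : ℝ, 1 ≤ x → 4 * τ ^ 2 ≤ x → τ * Real.log x ≤ x := by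
    intro x hx1 hx
    have hx0 : 0 < x := by linarith
    have h1 : Real.log x = 2 * Real.log (Real.sqrt x) := by
      rw [Real.log_sqrt hx0.le]; ring
    have h2 := Real.log_le_sub_one_of_pos (Real.sqrt_pos.2 hx0)
    have h3 : 2 * τ ≤ Real.sqrt x := Real.le_sqrt_of_sq_le (by nlinarith)
    have h4 := Real.mul_self_sqrt hx0.le
    have h5 : τ * Real.log x ≤ τ * (2 * Real.sqrt x) := by
      rw [h1]; exact mul_le_mul_of_nonneg_left (by linarith) hτ0.le
    nlinarith [mul_le_mul_of_nonneg_right h3 (Real.sqrt_nonneg x)]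
  refine ⟨c₁, τ, 4 * τ ^ 2, hc₁, hτ0, ?_⟩
  intro k hk3 hkτ
  have hkR : (1 : ℝ) ≤ k := by exact_mod_cast (by omega : 1 ≤ k)
  have hlk := one_le_log hk3
  have hsk : 1 ≤ Real.sqrt k := Real.one_le_sqrt.2 hkR
  have h1 := hconc k hk3 (τ * (Real.sqrt k * Real.log k ^ 2)) (by
    have h2 := mul_le_mul_of_nonneg_right (hlogle k hkR hkτ)
      (show 0 ≤ Real.sqrt k * Real.log k by positivity)
    calc τ * (Real.sqrt k * Real.log k ^ 2) =
        τ * Real.log k * (Real.sqrt k * Real.log k) := by ring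
      _ ≤ _ := h2)
  refine h1.trans_eq ?_
  have e1 : -c₂ * (τ * (Real.sqrt k * Real.log k ^ 2) / (Real.sqrt k * Real.log k)) =
      -((3 : ℕ) * Real.log k) := by
    rw [hτ]; field_simp; push_cast; ring
  rw [e1, Real.exp_neg, Real.exp_nat_mul, Real.exp_log (by linarith), div_eq_mul_inv]

set_option maxHeartbeats 1600000 in
/-- Almost additivity of the mean action under doubling. -/
theorem ShotNoise.exists_doubling [IsProbabilityMeasure P] (h : ShotNoise φ K p C P) :
    ∃ (D : ℝ) (n₀ : ℕ), 0 < D ∧ ∀ n : ℕ, n₀ ≤ n →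
      2 * ∫ ω, bridge φ p n ω ∂P ≤
        ∫ ω, bridge φ p (n + n) ω ∂P + D * (Real.sqrt n * Real.log n ^ 2) := by
  have hK1 := h.one_le_bound
  have hK0 : 0 ≤ K := zero_le_one.trans hK1
  have hC1 := h.one_le_rate
  obtain ⟨c₁, τ, N₁, hc₁, hτ0, htail⟩ := h.exists_tail
  set H : ℝ := 8 * (K ^ 2 + 2 * K + 2 * K * (2 * C + 2)) with hH
  have hH0 : 0 ≤ H := by positivity
  obtain ⟨R, hR⟩ := exists_nat_ge (2 * H + 1)
  have hlm := loadMoment_ge_one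
  -- The exceptional events have probabilities at most these terms divided by `n`, so `Q < n` leaves
  -- a configuration outside all of them.
  set Q : ℝ := 1 + (2 * R + 1) * loadMoment + 2 * ((2 * R + 1) * c₁) + c₁ with hQ
  obtain ⟨N, hN⟩ := exists_nat_gt (max Q (N₁))
  -- The `10 τ` combines two deviations at length `n` with one at length `2 n`, at most eight times
  -- as large; `2 H` and `1` pay for moving the midpoint, and `8 K` for a maximal load of at most `4
  -- log n` with factor `2 K`.
  refine ⟨10 * τ + 2 * H + 1 + 8 * K, max 3 N, by positivity, fun n hn => ?_⟩
  have hn3 : 3 ≤ n := (le_max_left _ _).trans hn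
  have hn1 : 1 ≤ n := by omega
  have hnR : (1 : ℝ) ≤ n := by exact_mod_cast hn1
  have hn0 : (0 : ℝ) < n := by linarith
  have hNn : (N : ℝ) ≤ n := by exact_mod_cast (le_max_right _ _).trans hn
  have hQn : Q < n := (le_max_left _ _).trans_lt (hN.trans_le hNn)
  have hτn : N₁ ≤ n := ((le_max_right _ _).trans_lt (hN.trans_le hNn)).le
  set L := Real.log n with hL
  have hL1 : 1 ≤ L := one_le_log hn3
  set q := Real.sqrt n with hq
  have hq1 : 1 ≤ q := Real.one_le_sqrt.2 hnR
  have hqq : q * q = n := Real.mul_self_sqrt hn0.le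
  have hexpL : Real.exp L = n := Real.exp_log hn0
  set t := τ * (q * L ^ 2) with ht
  set E₁ := ∫ ω, bridge φ p n ω ∂P with hE₁
  set E₂ := ∫ ω, bridge φ p (n + n) ω ∂P with hE₂
  set r := R * n with hr
  set t₂ := τ * (Real.sqrt ((n + n : ℕ) : ℝ) * Real.log ((n + n : ℕ) : ℝ) ^ 2) with ht₂
  -- the exceptional events
  set S₁ : Set Config := {ω | (2 * C + 2) * ((n + n : ℕ) : ℝ) < excess (n + n) ω} with hS₁
  set S₂ : Set Config := {ω | 4 * L < maxLoad n r ω} with hS₂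
  set S₃ : ℤ → Set Config := fun i => {ω | t <
    |bridge φ p n (ω.image (KickedBurgers.shear (0 : ℕ) ((0 : ℤ) : ℝ) ((i : ℝ) / n))) - E₁|}
    with hS₃
  set S₄ : ℤ → Set Config := fun i => {ω | t <
    |bridge φ p n (ω.image (KickedBurgers.shear n i (((-i : ℤ) : ℝ) / n))) - E₁|} with hS₄
  set S₅ : Set Config := {ω | t₂ < |bridge φ p (n + n) ω - E₂|} with hS₅
  set I := Finset.Icc (-(r : ℤ)) r with hI
  have hcard : (I.card : ℝ) ≤ (2 * R + 1) * n := by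
    rw [hI, Int.card_Icc, show ((r : ℤ) + 1 - -(r : ℤ)).toNat = 2 * r + 1 by omega, hr]
    push_cast
    nlinarith
  have hP₁ : P.real S₁ ≤ 1 / n := by
    refine (measureReal_excess_gt_le h.nice (h.growth (n + n) (by omega)) _).trans ?_
    have h1 : (C - (2 * C + 2)) * ((n + n : ℕ) : ℝ) ≤ -L := by
      have h2 : L ≤ n := by
        have := Real.log_le_sub_one_of_pos hn0
        linarith
      push_cast
      nlinarith
    refine (Real.exp_le_exp.2 h1).trans_eq ?_
    rw [Real.exp_neg, hexpL, one_div]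
  have hcube : ∀ c : ℝ, 0 ≤ c → c * n / (n : ℝ) ^ 3 ≤ c / n := by
    intro c hc
    rw [div_le_div_iff₀ (by positivity) hn0]
    nlinarith [mul_nonneg hc (mul_nonneg (sq_nonneg (n : ℝ)) (sub_nonneg.2 hnR))]
  have hP₂ : P.real S₂ ≤ (2 * R + 1) * loadMoment / n := by
    refine (measureReal_maxLoad_le h n r (4 * L)).trans ?_
    have e1 : Real.exp (-(4 * L)) = 1 / (n : ℝ) ^ 4 := by
      rw [Real.exp_neg, show 4 * L = (4 : ℕ) * L by norm_num, Real.exp_nat_mul, hexpL, one_div]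
    rw [e1, hr]
    push_cast
    have h1 : (2 * ((R : ℝ) * n) + 1) * loadMoment ≤ (2 * R + 1) * loadMoment * n := by nlinarith
    have h2 : 1 / (n : ℝ) ^ 4 ≤ 1 / (n : ℝ) ^ 3 :=
      one_div_le_one_div_of_le (by positivity) (pow_le_pow_right₀ hnR (by norm_num))
    calc _ ≤ (2 * R + 1) * loadMoment * n * (1 / (n : ℝ) ^ 3) :=
          mul_le_mul h1 h2 (by positivity) (by positivity)
      _ = (2 * R + 1) * loadMoment * n / (n : ℝ) ^ 3 := by ring
      _ ≤ _ := hcube _ (by positivity)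
  -- A union bound over the `O(n)` possible midpoints. By shear invariance every sheared half has
  -- the tail of a bridge at the origin, and the decay `n ^ (-3)` beats their number.
  have hcell : ∀ S : ℤ → Set Config, (∀ i, P.real (S i) ≤ c₁ / (n : ℝ) ^ 3) →
      P.real (⋃ i ∈ I, S i) ≤ (2 * R + 1) * c₁ / n := by
    intro S hS
    refine (measureReal_biUnion_finset_le I S).trans ((Finset.sum_le_card_nsmul I _ _
      (fun i _ => hS i)).trans ?_)
    rw [nsmul_eq_mul]
    calc _ ≤ (2 * R + 1) * n * (c₁ / (n : ℝ) ^ 3) :=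
          mul_le_mul_of_nonneg_right hcard (by positivity)
      _ = (2 * R + 1) * c₁ * n / (n : ℝ) ^ 3 := by ring
      _ ≤ _ := hcube _ (by positivity)
  have hP₃ : P.real (⋃ i ∈ I, S₃ i) ≤ (2 * R + 1) * c₁ / n :=
    hcell S₃ fun i => (h.measureReal_image n _ _ _ t E₁).trans_le (htail n hn3 hτn)
  have hP₄ : P.real (⋃ i ∈ I, S₄ i) ≤ (2 * R + 1) * c₁ / n :=
    hcell S₄ fun i => (h.measureReal_image n _ _ _ t E₁).trans_le (htail n hn3 hτn)
  have hnn : ((n + n : ℕ) : ℝ) = 2 * n := by push_cast; ring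
  have hP₅ : P.real S₅ ≤ c₁ / n := by
    refine (htail (n + n) (by omega) (by rw [hnn]; linarith)).trans ?_
    refine div_le_div_of_nonneg_left hc₁.le hn0 ?_
    rw [hnn]
    nlinarith [pow_le_pow_right₀ hnR (show 1 ≤ 3 by norm_num), pow_pos hn0 3]
  have hbad : P.real ((((S₁ ∪ S₂) ∪ ⋃ i ∈ I, S₃ i) ∪ ⋃ i ∈ I, S₄ i) ∪ S₅) < 1 := by
    have h1 := measureReal_union_le (μ := P) (((S₁ ∪ S₂) ∪ ⋃ i ∈ I, S₃ i) ∪ ⋃ i ∈ I, S₄ i) S₅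
    have h2 := measureReal_union_le (μ := P) ((S₁ ∪ S₂) ∪ ⋃ i ∈ I, S₃ i) (⋃ i ∈ I, S₄ i)
    have h3 := measureReal_union_le (μ := P) (S₁ ∪ S₂) (⋃ i ∈ I, S₃ i)
    have h4 := measureReal_union_le (μ := P) S₁ S₂
    have h5 : 1 / n + (2 * R + 1) * loadMoment / n + (2 * R + 1) * c₁ / n +
        (2 * R + 1) * c₁ / n + c₁ / n = Q / (n : ℝ) := by rw [hQ]; ring
    have h6 : Q / n < 1 := (div_lt_one hn0).2 hQn
    linarith
  -- Integer parameters leave countably many shears, so niceness holds for all of them at once.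
  -- Lattice midpoints make this possible.
  have hshear : ∀ᵐ ω ∂P, ∀ (a : ℕ) (b v : ℤ),
      (ω.image (KickedBurgers.shear a b ((v : ℝ) / n))).IsNice :=
    ae_all_iff.2 fun a => ae_all_iff.2 fun b => ae_all_iff.2 fun v => h.ae_isNice_image _ _ _
  -- The claim compares deterministic means, so a single good configuration is enough.
  obtain ⟨ω, hω, hωs, hωb⟩ : ∃ ω : Config, ω.IsNice ∧ (∀ (a : ℕ) (b v : ℤ),
      (ω.image (KickedBurgers.shear a b ((v : ℝ) / n))).IsNice) ∧
      ω ∉ (((S₁ ∪ S₂) ∪ ⋃ i ∈ I, S₃ i) ∪ ⋃ i ∈ I, S₄ i) ∪ S₅ := by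
    by_contra hcon
    push Not at hcon
    refine hbad.not_ge ?_
    have h1 : P Set.univ ≤ P ((((S₁ ∪ S₂) ∪ ⋃ i ∈ I, S₃ i) ∪ ⋃ i ∈ I, S₄ i) ∪ S₅) := by
      refine measure_mono_ae ?_
      filter_upwards [h.nice, hshear] with ω hω hω' _
      exact hcon ω hω hω'
    have h2 := ENNReal.toReal_mono (measure_ne_top _ _) h1
    simpa [Measure.real] using h2
  simp only [Set.mem_union, not_or] at hωb
  obtain ⟨⟨⟨⟨hω₁, hω₂⟩, hω₃⟩, hω₄⟩, hω₅⟩ := hωb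
  have hr' : 2 * H * n + 1 ≤ (r : ℝ) := by
    rw [hr]; push_cast
    nlinarith
  have hexc : excess (n + n) ω ≤ (2 * C + 2) * (n + n) := by
    have h1 : ¬ ((2 * C + 2) * ((n + n : ℕ) : ℝ) < excess (n + n) ω) := hω₁
    push_cast at h1
    exact not_lt.1 h1
  obtain ⟨i, hi, hmain⟩ := h.exists_le_bridge_two_mul hω hn1 hH.ge hr' hωs hexc
  have h₃ := not_lt.1 (fun hc => hω₃ (Set.mem_biUnion (Finset.mem_coe.2 hi) hc) :
    ¬ (t < |bridge φ p n (ω.image (KickedBurgers.shear (0 : ℕ) ((0 : ℤ) : ℝ) ((i : ℝ) / n))) - E₁|))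
  have h₄ := not_lt.1 (fun hc => hω₄ (Set.mem_biUnion (Finset.mem_coe.2 hi) hc) :
    ¬ (t < |bridge φ p n (ω.image (KickedBurgers.shear n i (((-i : ℤ) : ℝ) / n))) - E₁|))
  have h₂ : (maxLoad n r ω : ℝ) ≤ 4 * L := not_lt.1 hω₂
  have h₅ : |bridge φ p (n + n) ω - E₂| ≤ t₂ := not_lt.1 hω₅
  have h₃' := (abs_le.1 h₃).1
  have h₄' := (abs_le.1 h₄).1
  have h₅' := (abs_le.1 h₅).2
  have ht₂le : t₂ ≤ 8 * t := by
    have e1 : Real.sqrt ((n + n : ℕ) : ℝ) ≤ 2 * q := by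
      rw [hnn, hq]
      refine Real.sqrt_le_iff.2 ⟨by positivity, ?_⟩
      rw [mul_pow, Real.sq_sqrt hn0.le]; linarith
    have e2 : Real.log ((n + n : ℕ) : ℝ) ≤ 2 * L := by
      rw [hnn, Real.log_mul two_ne_zero hn0.ne']
      have : Real.log 2 ≤ L := Real.log_le_log two_pos (by exact_mod_cast (by omega : 2 ≤ n))
      linarith
    have e3 : 0 ≤ Real.log ((n + n : ℕ) : ℝ) := Real.log_natCast_nonneg _
    rw [ht₂, ht]
    have e4 : Real.log ((n + n : ℕ) : ℝ) ^ 2 ≤ (2 * L) ^ 2 := pow_le_pow_left₀ e3 e2 2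
    have e5 : Real.sqrt ((n + n : ℕ) : ℝ) * Real.log ((n + n : ℕ) : ℝ) ^ 2 ≤
        2 * q * (2 * L) ^ 2 := mul_le_mul e1 e4 (sq_nonneg _) (by positivity)
    calc _ ≤ τ * (2 * q * (2 * L) ^ 2) := mul_le_mul_of_nonneg_left e5 hτ0.le
      _ = _ := by ring
  have hLL : L ≤ q * L ^ 2 := (le_self_pow₀ hL1 two_ne_zero).trans
    (le_mul_of_one_le_left (sq_nonneg L) hq1)
  have hqLL : q ≤ q * L ^ 2 := le_mul_of_one_le_right (by linarith) (one_le_pow₀ hL1)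
  have hone : 1 ≤ q * L ^ 2 := hq1.trans hqLL
  have hKm := mul_le_mul_of_nonneg_left h₂ (show 0 ≤ 2 * K by positivity)
  have e8 := mul_le_mul_of_nonneg_left hLL (show 0 ≤ 8 * K by positivity)
  have e9 := mul_le_mul_of_nonneg_left hqLL (show 0 ≤ 2 * H by positivity)
  have e10 : (10 * τ + 2 * H + 1 + 8 * K) * (q * L ^ 2) =
      10 * t + 2 * H * (q * L ^ 2) + q * L ^ 2 + 8 * K * (q * L ^ 2) := by rw [ht]; ring
  rw [e10]
  linarith

end Means

/-! ### Convergence rate of the means -/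

/-- Since `512 = 2 ^ 9`, doubling multiplies the logarithm by at most `10 / 9`, and `(10 / 9) ^ 2 /
√2 < 9 / 10`. -/
lemma log_sq_div_sqrt_two_mul_le {x : ℝ} (hx : 512 ≤ x) :
    Real.log (2 * x) ^ 2 / Real.sqrt (2 * x) ≤ 9 / 10 * (Real.log x ^ 2 / Real.sqrt x) := by
  have hx0 : 0 < x := by linarith
  have hl2 := Real.log_pos one_lt_two
  have hL : 9 * Real.log 2 ≤ Real.log x := by
    rw [show 9 * Real.log 2 = ((9 : ℕ) : ℝ) * Real.log 2 by norm_num, ← Real.log_pow]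
    exact Real.log_le_log (by norm_num) (by norm_num; exact hx)
  have hs2 : (7 / 5 : ℝ) ≤ Real.sqrt 2 := Real.le_sqrt_of_sq_le (by norm_num)
  have hs := Real.sqrt_pos.2 hx0
  rw [Real.log_mul two_ne_zero hx0.ne', Real.sqrt_mul zero_le_two, mul_div_assoc',
    div_le_div_iff₀ (by positivity) hs]
  have h1 : (Real.log 2 + Real.log x) ^ 2 ≤ (10 / 9 * Real.log x) ^ 2 :=
    pow_le_pow_left₀ (by linarith) (by linarith) 2
  have h2 : (10 / 9 * Real.log x) ^ 2 ≤ 9 / 10 * Real.log x ^ 2 * Real.sqrt 2 := by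
    nlinarith [mul_le_mul_of_nonneg_left hs2 (sq_nonneg (Real.log x)), sq_nonneg (Real.log x)]
  calc _ ≤ 9 / 10 * Real.log x ^ 2 * Real.sqrt 2 * Real.sqrt x :=
        mul_le_mul_of_nonneg_right (h1.trans h2) hs.le
    _ = _ := by ring

/-- A subadditive sequence which is almost additive under doubling is close to linear. -/
theorem sub_lim_le_of_doubling {E : ℕ → ℝ} (hE : Subadditive E)
    (hb : BddBelow (Set.range fun n => E n / n)) {D : ℝ} (hD : 0 ≤ D) {n₀ : ℕ}
    (hdbl : ∀ n, n₀ ≤ n → 2 * E n ≤ E (n + n) + D * (Real.sqrt n * Real.log n ^ 2))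
    {n : ℕ} (hn : n₀ ≤ n) (hn' : 512 ≤ n) :
    E n - hE.lim * n ≤ 5 * D * (Real.sqrt n * Real.log n ^ 2) := by
  set g : ℕ → ℝ := fun m => Real.log m ^ 2 / Real.sqrt m with hg
  have hsg : ∀ m : ℕ, 0 < m → g m * m = Real.sqrt m * Real.log m ^ 2 := by
    intro m hm
    have hm0 : (0 : ℝ) < m := by exact_mod_cast hm
    have h1 := Real.sqrt_pos.2 hm0
    have h2 := Real.mul_self_sqrt hm0.le
    simp only [hg]
    nth_rewrite 3 [← h2]
    field_simp
  -- One doubling loses at most `D / 2 * g m` in the normalized mean, while `5 D g` drops by at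
  -- least `5 D / 10 * g m`. The constant `5` makes the corrected quantity monotone along doublings,
  -- and its limit is the asymptotic rate.
  have hstep : ∀ m, n₀ ≤ m → 512 ≤ m →
      E m / m - 5 * D * g m ≤ E (2 * m) / (2 * m : ℕ) - 5 * D * g (2 * m) := by
    intro m hm hm'
    have hm0 : (0 : ℝ) < m := by exact_mod_cast (by omega : 0 < m)
    have h1 := hdbl m hm
    rw [← two_mul m, ← hsg m (by omega)] at h1
    have h2 : g (2 * m) ≤ 9 / 10 * g m := by
      have := log_sq_div_sqrt_two_mul_le (x := m) (by exact_mod_cast hm')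
      simpa only [hg, Nat.cast_mul, Nat.cast_ofNat] using this
    have h3 : E m / m ≤ E (2 * m) / (2 * m : ℕ) + D / 2 * g m := by
      push_cast
      rw [div_add' _ _ _ (by positivity), div_le_div_iff₀ hm0 (by positivity)]
      nlinarith [mul_le_mul_of_nonneg_right h1 hm0.le]
    nlinarith [mul_le_mul_of_nonneg_left h2 hD]
  have hiter : ∀ k : ℕ, E n / n - 5 * D * g n ≤
      E (2 ^ k * n) / (2 ^ k * n : ℕ) - 5 * D * g (2 ^ k * n) := by
    intro k
    induction k with
    | zero => simp
    | succ k ih =>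
      have h1 : n ≤ 2 ^ k * n := Nat.le_mul_of_pos_left _ (by positivity)
      have h2 := hstep (2 ^ k * n) (hn.trans h1) (hn'.trans h1)
      rw [show 2 ^ (k + 1) * n = 2 * (2 ^ k * n) by ring]
      exact ih.trans h2
  have hlim : Filter.Tendsto (fun k : ℕ => E (2 ^ k * n) / (2 ^ k * n : ℕ)) Filter.atTop
      (nhds hE.lim) := by
    refine (hE.tendsto_lim hb).comp (Filter.tendsto_atTop_mono (fun k => ?_)
      (tendsto_pow_atTop_atTop_of_one_lt one_lt_two))
    exact Nat.le_mul_of_pos_right _ (by omega)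
  have hle : E n / n - 5 * D * g n ≤ hE.lim := by
    refine ge_of_tendsto' hlim fun k => (hiter k).trans ?_
    have : 0 ≤ g (2 ^ k * n) := by positivity
    nlinarith [mul_nonneg hD this]
  have hn0 : (0 : ℝ) < n := by exact_mod_cast (by omega : 0 < n)
  have h1 := mul_le_mul_of_nonneg_right hle hn0.le
  rw [sub_mul, div_mul_cancel₀ _ hn0.ne', mul_assoc, hsg n (by omega)] at h1
  linarith

/-! ### Arbitrary slopes -/

section Slopes

variable {φ : ℝ → ℝ} {K p C : ℝ} {P : Measure Config}

lemma ShotNoise.isLeast_optimalAction (h : ShotNoise φ K p C P) {ω : Config} {v : ℝ}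
    (hω : (ω.image (KickedBurgers.shear 0 0 v)).IsNice) (n : ℕ) :
    IsLeast (actionValues φ p ω 0 n 0 (v * n)) (optimalAction φ p ω 0 n 0 (v * n)) ∧
    optimalAction φ p ω 0 n 0 (v * n) =
      bridge φ p n (ω.image (KickedBurgers.shear 0 0 v)) + v ^ 2 / 2 * n := by
  have h1 := actionValues_eq φ p ω 0 0 v n
  have h2 := (h.controlled hω n).isLeast h.weight
    (fun k => continuous_potential h.cont h.supp hω.1 k)
  rw [← lineField_eq] at h2
  have h3 := optimalAction_eq ⟨_, h2.2⟩
  simp only [zero_add] at h1 h3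
  refine ⟨?_, by rw [h3, lineField_eq, bridge]⟩
  rw [h1, h3]
  exact ⟨⟨_, h2.1, rfl⟩, by rintro _ ⟨t, ht, rfl⟩; exact add_le_add_left (h2.2 ht) _⟩

lemma ShotNoise.ae_optimalAction_eq (h : ShotNoise φ K p C P) (v : ℝ) (n : ℕ) :
    ∀ᵐ ω ∂P, optimalAction φ p ω 0 n 0 (v * n) =
      bridge φ p n (ω.image (KickedBurgers.shear 0 0 v)) + v ^ 2 / 2 * n := by
  filter_upwards [h.ae_isNice_image 0 0 v] with ω hω
  exact (h.isLeast_optimalAction hω n).2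

lemma ShotNoise.integrable_optimalAction [IsProbabilityMeasure P] (h : ShotNoise φ K p C P)
    (v : ℝ) (n : ℕ) : Integrable (fun ω => optimalAction φ p ω 0 n 0 (v * n)) P :=
  ((h.integrable_bridge_image n 0 0 v).add (integrable_const (v ^ 2 / 2 * (n : ℝ)))).congr
    ((h.ae_optimalAction_eq v n).mono fun _ hω => hω.symm)

lemma ShotNoise.integral_optimalAction [IsProbabilityMeasure P] (h : ShotNoise φ K p C P)
    (v : ℝ) (n : ℕ) :
    ∫ ω, optimalAction φ p ω 0 n 0 (v * n) ∂P = ∫ ω, bridge φ p n ω ∂P + v ^ 2 / 2 * n := by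
  rw [integral_congr_ae (h.ae_optimalAction_eq v n),
    integral_add (h.integrable_bridge_image n 0 0 v) (integrable_const _),
    h.integral_bridge_image n 0 0 v]
  simp

lemma ShotNoise.meanActionRates_eq [IsProbabilityMeasure P] (h : ShotNoise φ K p C P) (v : ℝ) :
    meanActionRates φ p P v = OrderIso.addRight (v ^ 2 / 2) ''
      ((fun n : ℕ => (∫ ω, bridge φ p n ω ∂P) / n) '' Set.Ici 1) := by
  have key : ∀ n : ℕ, 1 ≤ n → (∫ ω, optimalAction φ p ω 0 n 0 (v * n) ∂P) / n =
      (∫ ω, bridge φ p n ω ∂P) / n + v ^ 2 / 2 := by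
    intro n hn
    have hn0 : (n : ℝ) ≠ 0 := by exact_mod_cast (by omega : n ≠ 0)
    rw [h.integral_optimalAction, add_div, mul_div_cancel_right₀ _ hn0]
  ext t
  constructor
  · rintro ⟨n, hn, rfl⟩
    exact ⟨_, ⟨n, hn, rfl⟩, (key n hn).symm⟩
  · rintro ⟨_, ⟨n, hn, rfl⟩, rfl⟩
    exact ⟨n, hn, (key n hn).symm⟩

lemma ShotNoise.bddBelow_meanActionRates [IsProbabilityMeasure P] (h : ShotNoise φ K p C P)
    (v : ℝ) : BddBelow (meanActionRates φ p P v) := by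
  rw [h.meanActionRates_eq]
  exact (OrderIso.addRight _).monotone.map_bddBelow
    (h.bddBelow_rates.mono (Set.image_subset_range _ _))

/-- Shear invariance shifts every rate by `v ^ 2 / 2`, and `Subadditive.lim` is by definition the
infimum of the rates over `n ≥ 1`. -/
lemma ShotNoise.shapeFunction_eq [IsProbabilityMeasure P] (h : ShotNoise φ K p C P) (v : ℝ) :
    shapeFunction φ p P v = h.subadditive.lim + v ^ 2 / 2 := by
  have h1 := (OrderIso.addRight (v ^ 2 / 2)).map_csInf' (Set.Nonempty.image
    (fun n : ℕ => (∫ ω, bridge φ p n ω ∂P) / n) ⟨1, Set.mem_Ici.2 le_rfl⟩)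
    (h.bddBelow_rates.mono (Set.image_subset_range _ (Set.Ici 1)))
  rw [shapeFunction, h.meanActionRates_eq, ← h1, OrderIso.addRight_apply, Subadditive.lim]

/-- Concentration of the optimal action around the shape function, uniformly in the slope. -/
theorem ShotNoise.exists_concentration_shapeFunction [IsProbabilityMeasure P]
    (h : ShotNoise φ K p C P) :
    ∃ c₀ c₁ c₂ c₃ : ℝ, 0 < c₀ ∧ 0 < c₁ ∧ 0 < c₂ ∧ 0 < c₃ ∧
      ∀ (v : ℝ) (n : ℕ), c₀ < n → ∀ u : ℝ, c₃ * (Real.sqrt n * Real.log n ^ 2) < u →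
        u ≤ n * (Real.sqrt n * Real.log n) →
          P.real {ω | u < |optimalAction φ p ω 0 n 0 (v * n) - shapeFunction φ p P v * n|} ≤
            c₁ * Real.exp (-c₂ * (u / (Real.sqrt n * Real.log n))) := by
  obtain ⟨c₁, c₂, hc₁, hc₂, hconc⟩ := h.exists_concentration
  obtain ⟨D, n₀, hD, hdbl⟩ := h.exists_doubling
  -- The bias of the mean is at most `5 D √n log² n`, so `c₃ = 10 D` makes it at most `u / 2`; the
  -- other half of `u` is left to concentration, which halves `c₂`.
  refine ⟨max n₀ 512, c₁, c₂ / 2, 10 * D, by positivity, hc₁, by positivity, by positivity,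
    fun v n hn u hu hu' => ?_⟩
  have hn₀ : n₀ ≤ n := by exact_mod_cast ((le_max_left _ _).trans_lt hn).le
  have hn₁ : 512 ≤ n := by exact_mod_cast ((le_max_right _ _).trans_lt hn).le
  have hn0 : (0 : ℝ) < n := by exact_mod_cast (by omega : 0 < n)
  have hup := sub_lim_le_of_doubling h.subadditive h.bddBelow_rates hD.le hdbl hn₀ hn₁
  have hlow := h.subadditive.lim_le_div h.bddBelow_rates (by omega : n ≠ 0)
  rw [le_div_iff₀ hn0] at hlow
  set E := ∫ ω, bridge φ p n ω ∂P with hE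
  have hL := one_le_log (by omega : 3 ≤ n)
  have hs := Real.sqrt_pos.2 hn0
  have hu0 : 0 < u := lt_of_le_of_lt (by positivity) hu
  have hbr := hconc n (by omega) (u / 2) (by linarith)
  rw [← h.measureReal_image n 0 0 v (u / 2) E] at hbr
  have hexp : -c₂ * (u / 2 / (Real.sqrt n * Real.log n)) =
      -(c₂ / 2) * (u / (Real.sqrt n * Real.log n)) := by ring
  rw [hexp] at hbr
  refine le_trans (ENNReal.toReal_mono (measure_ne_top _ _) (measure_mono_ae ?_)) hbr
  filter_upwards [h.ae_optimalAction_eq v n] with ω hω hlt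
  change u < |_| at hlt
  change u / 2 < |bridge φ p n (ω.image (KickedBurgers.shear 0 0 v)) - E|
  rw [hω, h.shapeFunction_eq] at hlt
  have h1 : |E - h.subadditive.lim * n| ≤ u / 2 := by
    rw [abs_of_nonneg (by linarith)]
    linarith
  have h2 := abs_add_le (bridge φ p n (ω.image (KickedBurgers.shear 0 0 v)) - E)
    (E - h.subadditive.lim * n)
  have h3 : bridge φ p n (ω.image (KickedBurgers.shear 0 0 v)) + v ^ 2 / 2 * n -
      (h.subadditive.lim + v ^ 2 / 2) * n =
      bridge φ p n (ω.image (KickedBurgers.shear 0 0 v)) - E + (E - h.subadditive.lim * n) := by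
    ring
  rw [h3] at hlt
  linarith

end Slopes

lemma exists_bound_of_support {φ : ℝ → ℝ} (hφ : Continuous φ)
    (hφ_supp : {x : ℝ | φ x ≠ 0} ⊆ Set.Ioo (-1) 1) : ∃ K, 1 ≤ K ∧ ∀ x, |φ x| ≤ K := by
  obtain ⟨K, hK⟩ := isCompact_Icc.exists_bound_of_continuousOn
    (hφ.continuousOn (s := Set.Icc (-1 : ℝ) 1))
  refine ⟨max K 1, le_max_right _ _, fun x => ?_⟩
  by_cases hx : φ x = 0
  · rw [hx, abs_zero]
    exact zero_le_one.trans (le_max_right _ _)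
  · exact (hK x (Set.Ioo_subset_Icc_self (hφ_supp hx))).trans (le_max_left _ _)

end KickedBurgers

theorem mainTheorem5
    (φ : ℝ → ℝ) (hφ_diff : Differentiable ℝ φ) (hφ_even : ∀ x, φ (-x) = φ x)
    (hφ_ne : {x : ℝ | φ x ≠ 0}.Nonempty)
    (hφ_supp : {x : ℝ | φ x ≠ 0} ⊆ Set.Ioo (-1) 1)
    (Pξ Pκ : Measure ℝ) [IsProbabilityMeasure Pξ] [IsProbabilityMeasure Pκ]
    (hξ : Pξ (Set.Icc (-1) 1)ᶜ = 0) (hκ : Pκ (Set.Ioc 0 1)ᶜ = 0)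
    (P : Measure KickedBurgers.Config) [IsProbabilityMeasure P]
    (hP : KickedBurgers.IsPoissonLaw P (KickedBurgers.drivingMeasure Pξ Pκ))
    (p : ℝ) (hp : p ∈ Set.Icc (0 : ℝ) 1) :
    (∀ (v : ℝ) (n : ℕ), 1 ≤ n →
      (∀ᵐ ω ∂P, IsLeast (KickedBurgers.actionValues φ p ω 0 n 0 (v * n))
        (KickedBurgers.optimalAction φ p ω 0 n 0 (v * n))) ∧
      Integrable (fun ω => KickedBurgers.optimalAction φ p ω 0 n 0 (v * n)) P) ∧
    (∀ v : ℝ, BddBelow (KickedBurgers.meanActionRates φ p P v)) ∧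
    ∃ c₀ c₁ c₂ c₃ c₄ : ℝ, 0 < c₀ ∧ 0 < c₁ ∧ 0 < c₂ ∧ 0 < c₃ ∧ 0 < c₄ ∧
      ∀ (v : ℝ) (n : ℕ), c₀ < (n : ℝ) →
        ∀ u ∈ Set.Ioc (c₃ * (n : ℝ) ^ (1 / 2 : ℝ) * (Real.log n) ^ 2)
            (c₄ * (n : ℝ) ^ (3 / 2 : ℝ) * Real.log n),
          P.real {ω | u < |KickedBurgers.optimalAction φ p ω 0 n 0 (v * n)
              - KickedBurgers.shapeFunction φ p P v * n|}
            ≤ c₁ * Real.exp (-c₂ * (u / ((n : ℝ) ^ (1 / 2 : ℝ) * Real.log n))) := by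
  obtain ⟨K, hK1, hK⟩ := KickedBurgers.exists_bound_of_support hφ_diff.continuous hφ_supp
  obtain ⟨C, hC1, hC⟩ := hP.exists_lintegral_pathWeight_le hξ hκ
  have h : KickedBurgers.ShotNoise φ K p C P :=
    { cont := hφ_diff.continuous
      supp := hφ_supp
      one_le_bound := hK1
      bound := hK
      weight := hp
      nice := hP.ae_isNice hξ hκ
      indep := hP.iIndepFun_slice
      load := hP.lintegral_exp_load hξ hκ
      shear := hP.measurePreserving_image_shear
      one_le_rate := hC1
      growth := hC }
  refine ⟨fun v n _ => ⟨?_, h.integrable_optimalAction v n⟩, h.bddBelow_meanActionRates, ?_⟩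
  · filter_upwards [h.ae_isNice_image 0 0 v] with ω hω
    exact (h.isLeast_optimalAction hω n).1
  · obtain ⟨c₀, c₁, c₂, c₃, h₀, h₁, h₂, h₃, hmain⟩ := h.exists_concentration_shapeFunction
    -- The value `c₄ = 1` works because `n ^ (3 / 2) * log n` is exactly the limit `n * (√n * log
    -- n)` of the concentration bound.
    refine ⟨c₀, c₁, c₂, c₃, 1, h₀, h₁, h₂, h₃, one_pos, fun v n hn u hu => ?_⟩
    have e : (n : ℝ) ^ (3 / 2 : ℝ) = n * (n : ℝ) ^ (1 / 2 : ℝ) := by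
      rw [show (3 / 2 : ℝ) = 1 + 1 / 2 by norm_num, Real.rpow_add (h₀.trans hn), Real.rpow_one]
    rw [e] at hu
    rw [← Real.sqrt_eq_rpow] at hu ⊢
    obtain ⟨hu₁, hu₂⟩ := hu
    exact hmain v n hn u (by linarith) (by linarith)
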